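/- All vector spaces are over $\mathbb{C}$. For a graded space $M=\coprod_i M_i$ let $M'=\coprod_i M_i^*$ be its graded dual. For a series $f(x)=\sum_i f_i x^i$ with finitely many negative powers and an operator $D$, $e^{xD}f(x)=\sum_{k\ge 0}\frac{x^k}{k!}D^k f(x)$. "Converges absolutely" refers to the multiple Laurent series in the indicated variables ($z_i$, or $z_1-z_2$ and $z_2$), and "rational" means rational with the only possible poles at $z_i=0$ and $z_i=z_j$ ($i\ne j$). A *meromorphic open-string vertex algebra* (MOSVA) is a $\mathbb{Z}$-graded space $V=\coprod_{n}V_{(n)}$ with a linear map $V\otimes V\to V[[x,x^{-1}]]$, $u\otimes v\mapsto Y_V(u,x)v$, and a vector $\mathbf 1\in V$ such that, with $\mathbf d_V v=nv$ for $v\in V_{(n)}$ and $D_Vv=\lim_{x\to0}\frac{d}{dx}Y_V(v,x)\mathbf 1$: (1) $V_{(n)}=0$ for $n\ll0$, and $[\mathbf d_V,Y_V(v,x)]=x\frac{d}{dx}Y_V(v,x)+Y_V(\mathbf d_Vv,x)$; (2) $Y_V(\mathbf 1,x)=1_V$; $Y_V(u,x)\mathbf 1\in V[[x]]$ with constant term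 $u$; (3) $\frac{d}{dx}Y_V(v,x)=Y_V(D_Vv,x)=[D_V,Y_V(v,x)]$; (4) for $v'\in V'$, $n\ge1$, the series $\langle v',Y_V(u_1,z_1)\cdots Y_V(u_n,z_n)v\rangle$ converges absolutely for $|z_1|>\cdots>|z_n|>0$ to a rational function, and $\langle v',Y_V(Y_V(u_1,z_1-z_2)u_2,z_2)v\rangle$ converges absolutely for $|z_2|>|z_1-z_2|>0$ to a rational function; (5) the series $\langle v',Y_V(u_1,z_1)Y_V(u_2,z_2)v\rangle$ and $\langle v',Y_V(Y_V(u_1,z_1-z_2)u_2,z_2)v\rangle$ have the same sum for $|z_1|>|z_2|>|z_1-z_2|>0$. A *left $V$-module* $(W,Y_W^L,\mathbf d_W,D_W)$ is a $\mathbb{C}$-graded space $W=\coprod_{m\in\mathbb{C}}W_{[m]}$ with a linear map $V\otimes W\to W[[x,x^{-1}]]$, $u\otimes w\mapsto Y_W^L(u,x)w$, and operators $\mathbf d_W$, $D_W$ with $D_WW_{[m]}\subseteq W_{[m+1]}$, such that: $W_{[m]}=0$ when $\mathrm{Re}\,m$ is sufficiently negative; $\mathbf d_Ww=mw$ for $w\in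 W_{[m]}$; $[\mathbf d_W,Y_W^L(u,x)]=Y_W^L(\mathbf d_Vu,x)+x\frac{d}{dx}Y_W^L(u,x)$; $Y_W^L(\mathbf 1,x)=1_W$; $\frac{d}{dx}Y_W^L(u,x)=Y_W^L(D_Vu,x)=[D_W,Y_W^L(u,x)]$; and (4), (5) hold for $w'\in W'$, $w\in W$ with the products $\langle w',Y_W^L(u_1,z_1)\cdots Y_W^L(u_n,z_n)w\rangle$ and the iterates $\langle w',Y_W^L(Y_V(u_1,z_1-z_2)u_2,z_2)w\rangle$. A *right $V$-module* $(W,Y_W^R,\mathbf d_W,D_W)$ is such a graded space with operators $\mathbf d_W$, $D_W$ as above (the same lower bound, weight and $\mathbf d_W$-grading conditions) and a linear map $W\otimes V\to W[[x,x^{-1}]]$, $w\otimes u\mapsto Y_W^R(w,x)u$, such that: $\mathbf d_WY_W^R(w,x)-Y_W^R(w,x)\mathbf d_V=Y_W^R(\mathbf d_Ww,x)+x\frac{d}{dx}Y_W^R(w,x)$; $Y_W^R(w,x)\mathbf 1\in W[[x]]$ with constant term $w$; $\frac{d}{dx}Y_W^R(w,x)=Y_W^R(D_Ww,x)=D_WY_W^R(w,x)-Y_W^R(w,x)D_V$;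 and (4), (5) hold for $w'\in W'$ with the products $\langle w',Y_W^R(w,z_1)Y_V(u_1,z_2)\cdots Y_V(u_{n-1},z_n)u_n\rangle$ and the iterates $\langle w',Y_W^R(Y_W^R(w,z_1-z_2)u_1,z_2)u_2\rangle$. For a MOSVA $(V,Y_V,\mathbf 1)$ let $V^{op}=(V,Y_V^s,\mathbf 1)$ with $Y_V^s(u,x)v=e^{xD_V}Y_V(v,-x)u$. **Theorem.** Let $V$ be a MOSVA and $W$ a $\mathbb{C}$-graded vector space with operators $\mathbf d_W$, $D_W$. Then $V^{op}$ is a MOSVA, and: (a) If $(W,Y_W^L,\mathbf d_W,D_W)$ is a left $V$-module and $Y_W^{s(L)}(w,x)v=e^{xD_W}Y_W^L(v,-x)w$, then $(W,Y_W^{s(L)},\mathbf d_W,D_W)$ is a right $V^{op}$-module. (b) Conversely, if $(W,Y_W^{s(L)},\mathbf d_W,D_W)$ is a right $V^{op}$-module and $Y_W^L(v,x)w=e^{xD_W}Y_W^{s(L)}(w,-x)v$, then $(W,Y_W^L,\mathbf d_W,D_W)$ is a left $V$-module. (c) The constructions in (a) and (b) are inverse to each other. Thus left $V$-modules and right $V^{op}$-modules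 are the same thing. -/

import Mathlib

/-! ## Formal series -/

/-- The space `M[[x, x⁻¹]]` of doubly infinite formal series with coefficients in `M`:
`f i` is the coefficient of `x ^ i`. -/
abbrev BiSeries (M : Type*) : Type _ := ℤ → M

namespace BiSeries

variable {M N : Type*} [AddCommGroup M] [Module ℂ M] [AddCommGroup N] [Module ℂ N]

/-- The formal derivative `d/dx`. -/
def deriv (f : BiSeries M) : BiSeries M := fun i => ((i : ℂ) + 1) • f (i + 1)

/-- The operator `x d/dx`. -/
def xderiv (f : BiSeries M) : BiSeries M := fun i => (i : ℂ) • f i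

/-- Apply a linear map to all coefficients. -/
def map (T : M →ₗ[ℂ] N) (f : BiSeries M) : BiSeries N := fun i => T (f i)

/-- The series consisting of the constant term `m` only. -/
def const (m : M) : BiSeries M := Pi.single 0 m

/-- The substitution `x ↦ -x`. -/
noncomputable def subNeg (f : BiSeries M) : BiSeries M := fun i => ((-1 : ℂ) ^ i) • f i

/-- `e^{xD} f(x)`: the coefficient of `x ^ i` is `∑_{k ≥ 0} D^k f_{i-k} / k!`. For a lower truncated
series `f`, the only case in which it is used, this is a finite sum. -/
noncomputable def exp (D : M →ₗ[ℂ] M) (f : BiSeries M) : BiSeries M :=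
  fun i => ∑ᶠ k : ℕ, ((k.factorial : ℂ)⁻¹) • (D ^ k) (f (i - k))

/-- Only finitely many negative powers of `x` occur. -/
def LowerTruncated (f : BiSeries M) : Prop := ∃ N : ℤ, ∀ i < N, f i = 0

theorem exp_support_finite (D : M →ₗ[ℂ] M) {f : BiSeries M} (hf : LowerTruncated f) (i : ℤ) :
    (Function.support fun k : ℕ => ((k.factorial : ℂ)⁻¹) • (D ^ k) (f (i - k))).Finite := by
  obtain ⟨N, hN⟩ := hf
  refine (Set.finite_Iic (i - N).toNat).subset fun k hk => ?_
  by_contra h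
  apply hk
  have : f (i - k) = 0 := hN _ (by simp only [Set.mem_Iic, not_le] at h; omega)
  simp [this]

theorem LowerTruncated.subNeg {f : BiSeries M} (hf : LowerTruncated f) :
    LowerTruncated (subNeg f) := by
  obtain ⟨N, hN⟩ := hf
  exact ⟨N, fun i hi => by simp [BiSeries.subNeg, hN i hi]⟩

theorem LowerTruncated.exp (D : M →ₗ[ℂ] M) {f : BiSeries M} (hf : LowerTruncated f) :
    LowerTruncated (exp D f) := by
  obtain ⟨N, hN⟩ := hf
  refine ⟨N, fun i hi => ?_⟩
  have : ∀ k : ℕ, ((k.factorial : ℂ)⁻¹) • (D ^ k) (f (i - k)) = 0 := fun k => by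
    simp [hN (i - k) (by omega)]
  simp [BiSeries.exp, this]

theorem exp_add (D : M →ₗ[ℂ] M) {f g : BiSeries M} (hf : LowerTruncated f)
    (hg : LowerTruncated g) : exp D (f + g) = exp D f + exp D g := by
  funext i
  simp only [exp, Pi.add_apply, map_add, smul_add]
  exact finsum_add_distrib (exp_support_finite D hf i) (exp_support_finite D hg i)

theorem exp_smul (D : M →ₗ[ℂ] M) (c : ℂ) {f : BiSeries M} (hf : LowerTruncated f) :
    exp D (c • f) = c • exp D f := by
  funext i
  simp only [exp, Pi.smul_apply, map_smul]
  rw [smul_finsum' c (exp_support_finite D hf i)]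
  exact finsum_congr fun k => smul_comm _ _ _

theorem subNeg_add (f g : BiSeries M) : subNeg (f + g) = subNeg f + subNeg g := by
  funext i; simp [subNeg]

theorem subNeg_smul (c : ℂ) (f : BiSeries M) : subNeg (c • f) = c • subNeg f := by
  funext i; simp only [subNeg, Pi.smul_apply]; exact smul_comm _ _ _

end BiSeries

section VertexMaps

variable {A B C P Q M : Type*}
  [AddCommGroup A] [Module ℂ A] [AddCommGroup B] [Module ℂ B] [AddCommGroup C] [Module ℂ C]
  [AddCommGroup P] [Module ℂ P] [AddCommGroup Q] [Module ℂ Q] [AddCommGroup M] [Module ℂ M]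

/-- A vertex operator map `A ⊗ B → M[[x, x⁻¹]]`, `a ⊗ b ↦ Y(a, x) b`, as a bilinear map. -/
abbrev VertexMap (A B M : Type*) [AddCommGroup A] [Module ℂ A] [AddCommGroup B] [Module ℂ B]
    [AddCommGroup M] [Module ℂ M] : Type _ := A →ₗ[ℂ] B →ₗ[ℂ] BiSeries M

/-- Each series `Y(a, x) b` has only finitely many negative powers of `x`. -/
def VertexMap.Truncated (Y : VertexMap A B M) : Prop := ∀ a b, BiSeries.LowerTruncated (Y a b)

/-- The skew-symmetry opposite vertex operator map `b ⊗ a ↦ e^{xD} Y(a, -x) b`. -/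
noncomputable def VertexMap.skew (D : M →ₗ[ℂ] M) (Y : VertexMap A B M) (hY : Y.Truncated) :
    VertexMap B A M :=
  LinearMap.mk₂ ℂ (fun b a => BiSeries.exp D (BiSeries.subNeg (Y a b)))
    (fun b b' a => by
      rw [map_add, BiSeries.subNeg_add,
        BiSeries.exp_add D (hY a b).subNeg (hY a b').subNeg])
    (fun c b a => by
      rw [map_smul, BiSeries.subNeg_smul, BiSeries.exp_smul D c (hY a b).subNeg])
    (fun b a a' => by
      rw [map_add, LinearMap.add_apply, BiSeries.subNeg_add,
        BiSeries.exp_add D (hY a b).subNeg (hY a' b).subNeg])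
    (fun c b a => by
      rw [map_smul, LinearMap.smul_apply, BiSeries.subNeg_smul,
        BiSeries.exp_smul D c (hY a b).subNeg])

theorem VertexMap.Truncated.skew (D : M →ₗ[ℂ] M) {Y : VertexMap A B M} (hY : Y.Truncated) :
    (VertexMap.skew D Y hY).Truncated := fun b a => (hY a b).subNeg.exp D

/-! ## Graded duals, rational functions, convergence of correlation functions -/

/-- The graded dual `⨁ M_i^*` of `M = ⨁ M_i`, as the space of those linear functionals on `M`
that vanish on all but finitely many of the `M_i`. -/
def gradedDual {ι : Type*} (gr : ι → Submodule ℂ M) : Set (Module.Dual ℂ M) :=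
  {f | {i | ∃ m ∈ gr i, f m ≠ 0}.Finite}

/-- `f` is a rational function of `z_0, …, z_{n-1}` with the only possible poles at `z_i = 0` and
at `z_i = z_j` for `i ≠ j`. -/
def RationalWithDiagonalPoles {n : ℕ} (f : (Fin n → ℂ) → ℂ) : Prop :=
  ∃ (g : MvPolynomial (Fin n) ℂ) (p : Fin n → ℕ) (q : Fin n → Fin n → ℕ),
    ∀ z : Fin n → ℂ, (∀ i, z i ≠ 0) → Function.Injective z →
      f z = MvPolynomial.eval z g /
        ((∏ i, z i ^ p i) * ∏ i, ∏ j ∈ Finset.Ioi i, (z i - z j) ^ q i j)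

/-- The coefficient of `x_0 ^ k_0 ⋯ x_{n-1} ^ k_{n-1}` in `Y(b_0, x_0) ⋯ Y(b_{n-1}, x_{n-1}) p`. -/
def productCoeff (Y : VertexMap B P P) : {n : ℕ} → (Fin n → B) → (Fin n → ℤ) → P → P
  | 0, _, _, p => p
  | _ + 1, b, k, p => Y (b 0) (productCoeff Y (Fin.tail b) (Fin.tail k) p) (k 0)

/-- For all `n ≥ 0`, the multiple series
`⟨m', Y₁(a, z_0) Y₂(b_0, z_1) ⋯ Y₂(b_{n-1}, z_n) p⟩` converges absolutely when
`|z_0| > ⋯ > |z_n| > 0` to a rational function with the only possible poles at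
`z_i = 0` and `z_i = z_j`. (For complex series, `HasSum` is absolute convergence.) -/
def ProductsRational {ι : Type*} (gr : ι → Submodule ℂ M)
    (Y₁ : VertexMap A P M) (Y₂ : VertexMap B P P) : Prop :=
  ∀ (n : ℕ) (a : A) (b : Fin n → B) (p : P), ∀ m' ∈ gradedDual gr,
    ∃ f : (Fin (n + 1) → ℂ) → ℂ, RationalWithDiagonalPoles f ∧
      ∀ z : Fin (n + 1) → ℂ, StrictAnti (fun i => ‖z i‖) → (∀ i, 0 < ‖z i‖) →
        HasSum (fun k : Fin (n + 1) → ℤ =>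
          m' (Y₁ a (productCoeff Y₂ b (Fin.tail k) p) (k 0)) * ∏ i, z i ^ k i) (f z)

/-- The terms of the double series `⟨m', Y₁(a, z_0) Y₂(b, z_1) c⟩`. -/
noncomputable def productTerm (Y₁ : VertexMap A P M) (Y₂ : VertexMap B C P)
    (m' : Module.Dual ℂ M) (a : A) (b : B) (c : C) (z : Fin 2 → ℂ) (k : ℤ × ℤ) : ℂ :=
  m' (Y₁ a (Y₂ b c k.2) k.1) * (z 0 ^ k.1 * z 1 ^ k.2)

/-- The terms of the double series `⟨m', Y₁(Y₂(a, z_0 - z_1) b, z_1) c⟩`. -/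
noncomputable def iterateTerm (Y₁ : VertexMap Q C M) (Y₂ : VertexMap A B Q)
    (m' : Module.Dual ℂ M) (a : A) (b : B) (c : C) (z : Fin 2 → ℂ) (k : ℤ × ℤ) : ℂ :=
  m' (Y₁ (Y₂ a b k.1) c k.2) * ((z 0 - z 1) ^ k.1 * z 1 ^ k.2)

/-- The double series `⟨m', Y₁(Y₂(a, z_0 - z_1) b, z_1) c⟩` converges absolutely when
`|z_1| > |z_0 - z_1| > 0` to a rational function with the only possible poles at
`z_0 = 0`, `z_1 = 0` and `z_0 = z_1`. -/
def IteratesRational {ι : Type*} (gr : ι → Submodule ℂ M)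
    (Y₁ : VertexMap Q C M) (Y₂ : VertexMap A B Q) : Prop :=
  ∀ (a : A) (b : B) (c : C), ∀ m' ∈ gradedDual gr,
    ∃ f : (Fin 2 → ℂ) → ℂ, RationalWithDiagonalPoles f ∧
      ∀ z : Fin 2 → ℂ, ‖z 0 - z 1‖ < ‖z 1‖ → 0 < ‖z 0 - z 1‖ →
        HasSum (iterateTerm Y₁ Y₂ m' a b c z) (f z)

/-- `⟨m', Y₁(a, z_0) Y₂(b, z_1) c⟩ = ⟨m', Y₃(Y₄(a, z_0 - z_1) b, z_1) c⟩` when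
`|z_0| > |z_1| > |z_0 - z_1| > 0`, as an equality of sums of absolutely convergent series. -/
def VertexAssociativity {ι : Type*} (gr : ι → Submodule ℂ M)
    (Y₁ : VertexMap A P M) (Y₂ : VertexMap B C P)
    (Y₃ : VertexMap Q C M) (Y₄ : VertexMap A B Q) : Prop :=
  ∀ (a : A) (b : B) (c : C), ∀ m' ∈ gradedDual gr, ∀ z : Fin 2 → ℂ,
    ‖z 1‖ < ‖z 0‖ → ‖z 0 - z 1‖ < ‖z 1‖ → 0 < ‖z 0 - z 1‖ →
      ∃ s : ℂ, HasSum (productTerm Y₁ Y₂ m' a b c z) s ∧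
        HasSum (iterateTerm Y₃ Y₄ m' a b c z) s

end VertexMaps

/-! ## Meromorphic open-string vertex algebras -/

/-- The operator that acts on `gr n` as multiplication by `n`. -/
noncomputable def weightOperator {V : Type*} [AddCommGroup V] [Module ℂ V]
    (gr : ℤ → Submodule ℂ V) (h : DirectSum.IsInternal gr) : V →ₗ[ℂ] V :=
  (DirectSum.toModule ℂ ℤ V fun n => (n : ℂ) • (gr n).subtype) ∘ₗ
    (LinearEquiv.ofBijective (DirectSum.coeLinearMap gr)
      (show Function.Bijective (DirectSum.coeLinearMap gr) from h)).symm.toLinearMap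

theorem weightOperator_of_mem {V : Type*} [AddCommGroup V] [Module ℂ V]
    (gr : ℤ → Submodule ℂ V) (h : DirectSum.IsInternal gr) {n : ℤ} {v : V} (hv : v ∈ gr n) :
    weightOperator gr h v = (n : ℂ) • v := by
  have h' : Function.Bijective (DirectSum.coeLinearMap gr) := h
  have : (LinearEquiv.ofBijective (DirectSum.coeLinearMap gr) h').symm v =
      DirectSum.lof ℂ ℤ (fun i => gr i) n ⟨v, hv⟩ := by
    rw [LinearEquiv.symm_apply_eq, LinearEquiv.ofBijective_apply, DirectSum.coeLinearMap_lof]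
  rw [weightOperator, LinearMap.comp_apply, LinearEquiv.coe_coe, this, DirectSum.toModule_lof]
  rfl

/-- The data underlying a MOSVA on `V`: a grading `V = ⨁_{n ∈ ℤ} V_(n)`, a vertex operator map and
a vacuum. -/
structure VertexData (V : Type*) [AddCommGroup V] [Module ℂ V] where
  gr : ℤ → Submodule ℂ V
  internal : DirectSum.IsInternal gr
  Y : VertexMap V V V
  vac : V

namespace VertexData

variable {V : Type*} [AddCommGroup V] [Module ℂ V]

/-- `d_V v = n v` for `v ∈ V_(n)`. -/
noncomputable def d (A : VertexData V) : V →ₗ[ℂ] V := weightOperator A.gr A.internal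

/-- `D_V v = lim_{x → 0} d/dx Y(v, x) 1`, the coefficient of `x` in `Y(v, x) 1`. -/
def D (A : VertexData V) : V →ₗ[ℂ] V := LinearMap.proj (1 : ℤ) ∘ₗ A.Y.flip A.vac

/-- The opposite: the same grading and vacuum, with the skew-symmetry opposite vertex operator
map `u ⊗ v ↦ e^{x D_V} Y(v, -x) u`. -/
noncomputable def op (A : VertexData V) (h : A.Y.Truncated) : VertexData V where
  gr := A.gr
  internal := A.internal
  Y := VertexMap.skew A.D A.Y h
  vac := A.vac

end VertexData

/-- Meromorphic open-string vertex algebras. -/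
structure IsMOSVA {V : Type*} [AddCommGroup V] [Module ℂ V] (A : VertexData V) : Prop where
  lowerBound : ∃ N : ℤ, ∀ n < N, A.gr n = ⊥
  d_commutator : ∀ u v, BiSeries.map A.d (A.Y u v) - A.Y u (A.d v) =
    BiSeries.xderiv (A.Y u v) + A.Y (A.d u) v
  identity : ∀ v, A.Y A.vac v = BiSeries.const v
  creation : ∀ u, (∀ i < 0, A.Y u A.vac i = 0) ∧ A.Y u A.vac 0 = u
  D_derivative : ∀ u v, BiSeries.deriv (A.Y u v) = A.Y (A.D u) v
  D_commutator : ∀ u v, BiSeries.deriv (A.Y u v) =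
    BiSeries.map A.D (A.Y u v) - A.Y u (A.D v)
  products_rational : ProductsRational A.gr A.Y A.Y
  iterates_rational : IteratesRational A.gr A.Y A.Y
  associativity : VertexAssociativity A.gr A.Y A.Y A.Y A.Y

/-! ## Left and right modules -/

section Modules

variable {V W : Type*} [AddCommGroup V] [Module ℂ V] [AddCommGroup W] [Module ℂ W]

/-- `(W, Y, d, D)`, where `W = ⨁_{m ∈ ℂ} gr m`, is a left module for `A`. -/
structure IsLeftModule (A : VertexData V) (gr : ℂ → Submodule ℂ W) (Y : VertexMap V W W)
    (d D : W →ₗ[ℂ] W) : Prop where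
  internal : DirectSum.IsInternal gr
  D_weight : ∀ m, ∀ w ∈ gr m, D w ∈ gr (m + 1)
  lowerBound : ∃ B : ℝ, ∀ m : ℂ, m.re < B → gr m = ⊥
  d_grading : ∀ m, ∀ w ∈ gr m, d w = m • w
  d_commutator : ∀ u w, BiSeries.map d (Y u w) - Y u (d w) =
    Y (A.d u) w + BiSeries.xderiv (Y u w)
  identity : ∀ w, Y A.vac w = BiSeries.const w
  D_derivative : ∀ u w, BiSeries.deriv (Y u w) = Y (A.D u) w
  D_commutator : ∀ u w, BiSeries.deriv (Y u w) = BiSeries.map D (Y u w) - Y u (D w)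
  products_rational : ProductsRational gr Y Y
  iterates_rational : IteratesRational gr Y A.Y
  associativity : VertexAssociativity gr Y Y Y A.Y

/-- `(W, Y, d, D)`, where `W = ⨁_{m ∈ ℂ} gr m`, is a right module for `A`. -/
structure IsRightModule (A : VertexData V) (gr : ℂ → Submodule ℂ W) (Y : VertexMap W V W)
    (d D : W →ₗ[ℂ] W) : Prop where
  internal : DirectSum.IsInternal gr
  D_weight : ∀ m, ∀ w ∈ gr m, D w ∈ gr (m + 1)
  lowerBound : ∃ B : ℝ, ∀ m : ℂ, m.re < B → gr m = ⊥
  d_grading : ∀ m, ∀ w ∈ gr m, d w = m • w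
  d_commutator : ∀ w u, BiSeries.map d (Y w u) - Y w (A.d u) =
    Y (d w) u + BiSeries.xderiv (Y w u)
  creation : ∀ w, (∀ i < 0, Y w A.vac i = 0) ∧ Y w A.vac 0 = w
  D_derivative : ∀ w u, BiSeries.deriv (Y w u) = Y (D w) u
  D_commutator : ∀ w u, BiSeries.deriv (Y w u) = BiSeries.map D (Y w u) - Y w (A.D u)
  products_rational : ProductsRational gr Y A.Y
  iterates_rational : IteratesRational gr Y Y
  associativity : VertexAssociativity gr Y A.Y Y Y

end Modules

/-! ## Lower truncation of the vertex operators, which makes `e^{xD} Y(a, -x) b` meaningful -/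

section Truncation

theorem BiSeries.LowerTruncated.add {M : Type*} [AddCommGroup M] [Module ℂ M] {f g : BiSeries M}
    (hf : f.LowerTruncated) (hg : g.LowerTruncated) : (f + g).LowerTruncated := by
  obtain ⟨N, hN⟩ := hf
  obtain ⟨K, hK⟩ := hg
  refine ⟨min N K, fun i hi => ?_⟩
  rw [Pi.add_apply, hN i (lt_of_lt_of_le hi (min_le_left _ _)),
    hK i (lt_of_lt_of_le hi (min_le_right _ _)), add_zero]

theorem eigenvalue_of_grading {ι M : Type*} [DecidableEq ι] [AddCommGroup M] [Module ℂ M]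
    {gr : ι → Submodule ℂ M} (h : DirectSum.IsInternal gr) (wt : ι → ℂ) {d : M →ₗ[ℂ] M}
    (hd : ∀ i, ∀ m ∈ gr i, d m = wt i • m) {c : M} {l : ℂ} (hc : d c = l • c) (h0 : c ≠ 0) :
    ∃ i, wt i = l ∧ gr i ≠ ⊥ := by
  obtain ⟨y, rfl⟩ := h.2 c
  let T : (DirectSum ι fun i => gr i) →ₗ[ℂ] DirectSum ι fun i => gr i :=
    DFinsupp.mapRange.linearMap fun i => wt i • LinearMap.id
  have hT : d ∘ₗ DirectSum.coeLinearMap gr = DirectSum.coeLinearMap gr ∘ₗ T := by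
    refine DirectSum.linearMap_ext _ fun i => LinearMap.ext fun x => ?_
    have h1 : T (DirectSum.lof ℂ ι (fun i => gr i) i x) =
        DirectSum.lof ℂ ι (fun i => gr i) i (wt i • x) := by
      exact DFinsupp.mapRange_single (hf := fun i => by simp)
    simp only [LinearMap.comp_apply, h1, DirectSum.coeLinearMap_lof]
    exact hd i x x.2
  have h1 : T y = l • y := by
    apply h.1
    have := LinearMap.congr_fun hT y
    simp only [LinearMap.comp_apply] at this
    have h2 := (DirectSum.coeLinearMap gr).map_smul l y
    exact this.symm.trans (hc.trans h2.symm)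
  have hy : y ≠ 0 := fun hy => h0 (by rw [hy, map_zero])
  obtain ⟨i, hi⟩ : ∃ i, y i ≠ 0 := by
    by_contra hcon
    push Not at hcon
    exact hy (DFinsupp.ext hcon)
  refine ⟨i, ?_, fun hbot => hi ?_⟩
  · have h2 : wt i • y i = l • y i := by
      exact DFunLike.congr_fun h1 i
    exact smul_left_injective ℂ hi h2
  · have := (y i).2
    exact Subtype.ext ((Submodule.mem_bot ℂ).mp (hbot ▸ this))

variable {A B M : Type*} [AddCommGroup A] [Module ℂ A] [AddCommGroup B] [Module ℂ B]
  [AddCommGroup M] [Module ℂ M]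

theorem truncated_of_commutator {ι κ μ : Type*} [DecidableEq ι] [DecidableEq κ] [DecidableEq μ]
    {grA : ι → Submodule ℂ A} {grB : κ → Submodule ℂ B} {grM : μ → Submodule ℂ M}
    (hA : DirectSum.IsInternal grA) (hB : DirectSum.IsInternal grB)
    (hM : DirectSum.IsInternal grM) (wA : ι → ℂ) (wB : κ → ℂ) (wM : μ → ℂ)
    {dA : A →ₗ[ℂ] A} {dB : B →ₗ[ℂ] B} {d : M →ₗ[ℂ] M}
    (hdA : ∀ i, ∀ a ∈ grA i, dA a = wA i • a) (hdB : ∀ i, ∀ b ∈ grB i, dB b = wB i • b)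
    (hd : ∀ i, ∀ m ∈ grM i, d m = wM i • m)
    (hbound : ∃ L : ℝ, ∀ i, (wM i).re < L → grM i = ⊥) (Y : VertexMap A B M)
    (hY : ∀ a b, BiSeries.map d (Y a b) - Y a (dB b) = Y (dA a) b + BiSeries.xderiv (Y a b)) :
    Y.Truncated := by
  obtain ⟨L, hL⟩ := hbound
  have hz : BiSeries.LowerTruncated (0 : BiSeries M) := ⟨0, fun _ _ => rfl⟩
  intro a b
  have ha : a ∈ ⨆ i, grA i := by rw [hA.submodule_iSup_eq_top]; trivial
  induction ha using Submodule.iSup_induction' with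
  | zero => simpa using hz
  | add x y _ _ hx hy => simpa using hx.add hy
  | mem i a ha =>
    have hb : b ∈ ⨆ i, grB i := by rw [hB.submodule_iSup_eq_top]; trivial
    induction hb using Submodule.iSup_induction' with
    | zero => simpa using hz
    | add x y _ _ hx hy => simpa using hx.add hy
    | mem j b hb =>
      refine ⟨⌊L - (wA i).re - (wB j).re⌋, fun n hn => ?_⟩
      by_contra hne
      have h1 := congrFun (hY a b) n
      simp only [hdA i a ha, hdB j b hb, map_smul, LinearMap.smul_apply, Pi.sub_apply,
        Pi.add_apply, Pi.smul_apply, BiSeries.map, BiSeries.xderiv] at h1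
      have h2 : d (Y a b n) = (wA i + wB j + n) • Y a b n := by
        rw [sub_eq_iff_eq_add.mp h1]; module
      obtain ⟨m, hm, hbot⟩ := eigenvalue_of_grading hM wM hd h2 hne
      apply hbot
      apply hL
      have h3 : (n : ℝ) < L - (wA i).re - (wB j).re :=
        lt_of_lt_of_le (Int.cast_lt.mpr hn) (Int.floor_le _)
      rw [hm]
      simp only [Complex.add_re, Complex.intCast_re]
      linarith

variable {V W : Type*} [AddCommGroup V] [Module ℂ V] [AddCommGroup W] [Module ℂ W]

theorem VertexData.d_of_mem (A : VertexData V) (n : ℤ) (v : V) (hv : v ∈ A.gr n) :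
    A.d v = (n : ℂ) • v := weightOperator_of_mem A.gr A.internal hv

theorem IsMOSVA.truncated {A : VertexData V} (hA : IsMOSVA A) : A.Y.Truncated := by
  obtain ⟨N, hN⟩ := hA.lowerBound
  refine truncated_of_commutator A.internal A.internal A.internal (fun n : ℤ => (n : ℂ))
    (fun n : ℤ => (n : ℂ)) (fun n : ℤ => (n : ℂ)) A.d_of_mem A.d_of_mem A.d_of_mem
    ⟨N, fun i hi => hN i ?_⟩ A.Y fun u v => ?_
  · simpa using hi
  · rw [hA.d_commutator u v, add_comm]

theorem IsLeftModule.truncated {A : VertexData V} {gr : ℂ → Submodule ℂ W}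
    {Y : VertexMap V W W} {d D : W →ₗ[ℂ] W} (h : IsLeftModule A gr Y d D) : Y.Truncated := by
  classical
  exact truncated_of_commutator A.internal h.internal h.internal (fun n : ℤ => (n : ℂ))
    id id A.d_of_mem h.d_grading h.d_grading h.lowerBound Y h.d_commutator

theorem IsRightModule.truncated {A : VertexData V} {gr : ℂ → Submodule ℂ W}
    {Y : VertexMap W V W} {d D : W →ₗ[ℂ] W} (h : IsRightModule A gr Y d D) : Y.Truncated := by
  classical
  exact truncated_of_commutator h.internal A.internal h.internal id (fun n : ℤ => (n : ℂ))
    id h.d_grading A.d_of_mem h.d_grading h.lowerBound Y h.d_commutator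

/-- The opposite `V^op` of a MOSVA `V`. -/
noncomputable abbrev IsMOSVA.op {A : VertexData V} (hA : IsMOSVA A) : VertexData V :=
  A.op hA.truncated

/-- `w ⊗ v ↦ e^{x D_W} Y(v, -x) w` for a left module. -/
noncomputable abbrev IsLeftModule.skew {A : VertexData V} {gr : ℂ → Submodule ℂ W}
    {Y : VertexMap V W W} {d D : W →ₗ[ℂ] W} (h : IsLeftModule A gr Y d D) : VertexMap W V W :=
  VertexMap.skew D Y h.truncated

/-- `v ⊗ w ↦ e^{x D_W} Y(w, -x) v` for a right module. -/
noncomputable abbrev IsRightModule.skew {A : VertexData V} {gr : ℂ → Submodule ℂ W}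
    {Y : VertexMap W V W} {d D : W →ₗ[ℂ] W} (h : IsRightModule A gr Y d D) : VertexMap V W W :=
  VertexMap.skew D Y h.truncated

end Truncation

/-! The algebra, a left module and a right module are instances of one pattern, `IsVertexSystem`:
products `Y₁(a, x) Y₂(b, t) p`, iterates `Y₁(Y₄(a, ·) b, ·) p`, and operators `D`. The two
`D`-axioms say formally that `Y₁(e^{yD_A} a, x) = Y₁(a, x + y)` and `Y₁(a, x) e^{yD_P} = e^{yD}
Y₁(a, x - y)`. Writing `Yˢ` for the skew of `Y`, associativity then gives `Y₁ˢ(p, z₀) Y₄ˢ(b, z₁) a =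
e^{z₀D} Y₁(Y₄(a, -z₁) b, z₁ - z₀) p = e^{z₀D} Y₁(a, -z₀) Y₂(b, z₁ - z₀) p`, `Y₁ˢ(Y₂ˢ(p, z₀ - z₁) b,
z₁) a = e^{z₁D} Y₁(a, -z₁) e^{(z₀ - z₁)D} Y₂(b, z₁ - z₀) p`, which is the same expression. So the
skewed maps are again associative (`skew_two_point`). Against `m'` in the graded dual the factor
`e^{zD}` is a polynomial in `z`, because `D` raises weights and weights are bounded below
(`gradedDual_comp_pow_eq_zero`).

The analytic difficulty is that these identities hold only on small regions, whereas products of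
arbitrarily many skewed operators must converge on `|z₀| > ⋯ > |z_n| > 0`. The nested functions
`⟨m', Y₁(Y₄ˢ(b₀, y₀) ⋯ a, x) Y₂(c₀, t₀) ⋯ p⟩` are treated by induction on the number of `b`'s
(`nested_rational`): moving `b₀` outside turns it into `Y₂(b₀, x + y₀)`. The resulting rational
function has an absolutely convergent Laurent expansion on the larger region, since every possible
pole factor has a dominant monomial there (`exists_nested_coeff`). Its coefficients are the expected
ones by Fourier uniqueness on tori and analytic continuation in `y₀` (`laurent_eq_of_fiberwise`).

The remaining axioms are formal identities for `e^{xD}`. The constructions are mutually inverse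
because `e^{xD} e^{-xD} = 1` (`exp_subNeg_exp_subNeg`) and because `V^op` has the same `D` as `V`
(`op_D`). -/

/-! ## Uniqueness of coefficients of Laurent series -/

section LaurentSeries

open MeasureTheory

attribute [local instance] instMeasureSpaceUnitAddCircle
  instIsProbabilityMeasureUnitAddCircleVolume

/-- An absolutely convergent multiple Laurent series that vanishes on a torus is zero. -/
theorem laurent_eq_zero_of_torus {ι : Type*} [Fintype ι] (c : (ι → ℤ) → ℂ) (r : ι → ℝ)
    (hr : ∀ i, 0 < r i)
    (h : ∀ z : ι → ℂ, (∀ i, ‖z i‖ = r i) → HasSum (fun k => c k * ∏ i, z i ^ k i) 0) :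
    c = 0 := by
  classical
  -- Absorbing the radii into the coefficients reduces to a Fourier series on the unit torus.
  set c' : (ι → ℤ) → ℂ := fun k => c k * ∏ i, (r i : ℂ) ^ k i with hc'
  have key : ∀ θ : UnitAddTorus ι,
      HasSum (fun k => c' k * UnitAddTorus.mFourier k θ) 0 := by
    intro θ
    have := h (fun i => r i * fourier 1 (θ i)) (fun i => by
      rw [fourier_one, norm_mul, Circle.norm_coe, mul_one, Complex.norm_real,
        Real.norm_of_nonneg (hr i).le])
    refine this.congr_fun fun k => ?_
    simp only [hc', UnitAddTorus.mFourier, ContinuousMap.coe_mk, mul_assoc,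
      ← Finset.prod_mul_distrib]
    congr 1
    refine Finset.prod_congr rfl fun i _ => ?_
    rw [mul_zpow]
    congr 1
    simp [fourier_apply, AddCircle.toCircle_zsmul]
  have hsum : Summable fun k => ‖c' k‖ := by
    have := (key 0).summable.norm
    refine this.congr fun k => ?_
    simp [UnitAddTorus.mFourier]
  have hs : Summable fun k => c' k • (UnitAddTorus.mFourier k : C(UnitAddTorus ι, ℂ)) := by
    refine Summable.of_norm (hsum.congr fun k => ?_)
    rw [norm_smul, UnitAddTorus.mFourier_norm, mul_one]
  have h0 : HasSum (fun k => c' k • (UnitAddTorus.mFourier k : C(UnitAddTorus ι, ℂ))) 0 := by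
    obtain ⟨g, hg⟩ := hs
    have : g = 0 := by
      ext θ
      have h1 := (ContinuousMap.evalCLM ℂ θ).hasSum hg
      have h2 : HasSum (fun k => c' k * UnitAddTorus.mFourier k θ) (g θ) := by
        simpa using h1
      exact h2.unique (key θ)
    exact this ▸ hg
  funext n
  -- Uniform convergence passes to `L²`, where pairing with the `n`-th orthonormal mode isolates `c'
  -- n`.
  have h2 := ((innerSL ℂ (UnitAddTorus.mFourierLp (d := ι) 2 n)).comp
    (ContinuousMap.toLp (E := ℂ) 2 (volume : Measure (UnitAddTorus ι)) ℂ)).hasSum h0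
  have h3 : HasSum (fun k => if k = n then c' n else 0) (0 : ℂ) := by
    rw [map_zero] at h2
    refine h2.congr_fun fun k => ?_
    have ho := orthonormal_iff_ite.mp (UnitAddTorus.orthonormal_mFourier (d := ι)) n k
    simp only [map_smul, ContinuousLinearMap.comp_apply, innerSL_apply_apply, smul_eq_mul]
    change _ = c' k * inner ℂ (UnitAddTorus.mFourierLp 2 n) (UnitAddTorus.mFourierLp 2 k)
    rw [ho]
    by_cases hk : k = n
    · simp [hk]
    · simp [hk, Ne.symm hk]
  have h4 := (hasSum_ite_eq n (c' n)).unique h3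
  have h5 : ∏ i, (r i : ℂ) ^ n i ≠ 0 :=
    Finset.prod_ne_zero_iff.mpr fun i _ => zpow_ne_zero _ (by exact_mod_cast (hr i).ne')
  exact (mul_eq_zero.mp h4).resolve_right h5

theorem laurent_eq_of_torus {ι : Type*} [Fintype ι] (c c' : (ι → ℤ) → ℂ) (r : ι → ℝ)
    (hr : ∀ i, 0 < r i)
    (h : ∀ z : ι → ℂ, (∀ i, ‖z i‖ = r i) → ∃ v, HasSum (fun k => c k * ∏ i, z i ^ k i) v ∧
      HasSum (fun k => c' k * ∏ i, z i ^ k i) v) :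
    c = c' := by
  refine sub_eq_zero.mp (laurent_eq_zero_of_torus (c - c') r hr fun z hz => ?_)
  obtain ⟨v, h1, h2⟩ := h z hz
  simpa [sub_mul] using h1.sub h2

theorem laurent_two_eq_of_torus (c c' : ℤ × ℤ → ℂ) (r s : ℝ) (hr : 0 < r) (hs : 0 < s)
    (h : ∀ x y : ℂ, ‖x‖ = r → ‖y‖ = s → ∃ v, HasSum (fun k => c k * (x ^ k.1 * y ^ k.2)) v ∧
      HasSum (fun k => c' k * (x ^ k.1 * y ^ k.2)) v) :
    c = c' := by
  let e := finTwoArrowEquiv ℤ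
  have := laurent_eq_of_torus (c ∘ e) (c' ∘ e) ![r, s] (by simp [Fin.forall_fin_two, hr, hs])
    fun z hz => by
      obtain ⟨v, h1, h2⟩ := h (z 0) (z 1) (hz 0) (hz 1)
      refine ⟨v, (e.hasSum_iff.mpr h1).congr_fun fun k => ?_,
        (e.hasSum_iff.mpr h2).congr_fun fun k => ?_⟩ <;>
      simp [e, Fin.prod_univ_two, finTwoArrowEquiv]
  funext k
  simpa using congrFun this (e.symm k)

/-- A Laurent series in `y = e^s` is analytic on a half plane. -/
theorem differentiableOn_tsum_exp {J : Type*} (a : J → ℂ) (n : J → ℤ) (R : ℝ)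
    (h : ∀ s : ℝ, s < R → Summable fun j => ‖a j‖ * Real.exp (s * n j)) :
    DifferentiableOn ℂ (fun s : ℂ => ∑' j, a j * Complex.exp (s * n j)) {s | s.re < R} := by
  intro s hs
  have hs' : s.re < R := hs
  obtain ⟨q, hq1, hq2⟩ := exists_between hs'
  have ho : IsOpen {w : ℂ | s.re - 1 < w.re ∧ w.re < q} :=
    (isOpen_lt continuous_const Complex.continuous_re).inter
      (isOpen_lt Complex.continuous_re continuous_const)
  -- On the strip `s.re - 1 < Re w < q` each term is at most the sum of its sizes on the two edges,
  -- whatever the sign of `n j`.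
  have := Complex.differentiableOn_tsum_of_summable_norm
    (F := fun j (w : ℂ) => a j * Complex.exp (w * n j))
    ((h (s.re - 1) (by linarith)).add (h q hq2))
    (fun j => (by fun_prop : Differentiable ℂ _).differentiableOn) ho (fun j w hw => by
      rw [norm_mul, Complex.norm_exp, ← mul_add]
      have : (w * n j).re = w.re * n j := by simp
      rw [this]
      refine mul_le_mul_of_nonneg_left ?_ (norm_nonneg _)
      rcases le_total 0 (n j : ℝ) with hn | hn
      · exact (Real.exp_le_exp.mpr (mul_le_mul_of_nonneg_right hw.2.le hn)).trans
          (le_add_of_nonneg_left (Real.exp_pos _).le)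
      · exact (Real.exp_le_exp.mpr (mul_le_mul_of_nonpos_right hw.1.le hn)).trans
          (le_add_of_nonneg_right (Real.exp_pos _).le))
  exact (this.differentiableAt (ho.mem_nhds ⟨by simp, hq1⟩)).differentiableWithinAt

/-- For fixed `x`, the substitution `y = e^s` turns the punctured disc `0 < |y| < |x|/2` into a half
plane. There the difference of the two sums is holomorphic and vanishes near a point with `e^s =
-x/4`, where `|x + y| < |x|`. The identity theorem removes that extra condition, and then a whole
torus is available. -/
theorem laurent_two_eq_of_open (c c' : ℤ × ℤ → ℂ)
    (hc : ∀ x y : ℂ, 2 * ‖y‖ < ‖x‖ → 0 < ‖y‖ → Summable fun k => c k * (x ^ k.1 * y ^ k.2))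
    (hc' : ∀ x y : ℂ, 2 * ‖y‖ < ‖x‖ → 0 < ‖y‖ → Summable fun k => c' k * (x ^ k.1 * y ^ k.2))
    (h : ∀ x y : ℂ, 2 * ‖y‖ < ‖x‖ → 0 < ‖y‖ → ‖x + y‖ < ‖x‖ →
      ∑' k, c k * (x ^ k.1 * y ^ k.2) = ∑' k, c' k * (x ^ k.1 * y ^ k.2)) :
    c = c' := by
  let e := c - c'
  have he : ∀ x y : ℂ, 2 * ‖y‖ < ‖x‖ → 0 < ‖y‖ → Summable fun k => e k * (x ^ k.1 * y ^ k.2) :=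
    fun x y h1 h2 => by simpa [e, sub_mul] using (hc x y h1 h2).sub (hc' x y h1 h2)
  have he0 : ∀ x y : ℂ, 2 * ‖y‖ < ‖x‖ → 0 < ‖y‖ → ‖x + y‖ < ‖x‖ →
      ∑' k, e k * (x ^ k.1 * y ^ k.2) = 0 := fun x y h1 h2 h3 => by
    simp only [e, Pi.sub_apply, sub_mul]
    rw [(hc x y h1 h2).tsum_sub (hc' x y h1 h2), h x y h1 h2 h3, sub_self]
  have main : ∀ x y : ℂ, 2 * ‖y‖ < ‖x‖ → 0 < ‖y‖ → ∑' k, e k * (x ^ k.1 * y ^ k.2) = 0 := by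
    intro x y hxy hy
    have hx : 0 < ‖x‖ := by linarith
    have hx0 : x ≠ 0 := norm_pos_iff.mp hx
    set R := Real.log (‖x‖ / 2)
    have hR : ∀ s : ℝ, s < R → 2 * Real.exp s < ‖x‖ := fun s hs => by
      have := (Real.lt_log_iff_exp_lt (by positivity)).mp hs
      linarith
    let G : ℂ → ℂ := fun s => ∑' k : ℤ × ℤ, (e k * x ^ k.1) * Complex.exp (s * k.2)
    have hG : ∀ s : ℂ, G s = ∑' k, e k * (x ^ k.1 * Complex.exp s ^ k.2) := fun s =>
      tsum_congr fun k => by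
        rw [mul_assoc, ← Complex.exp_int_mul, mul_comm s]
    have hd : DifferentiableOn ℂ G {s | s.re < R} := by
      refine differentiableOn_tsum_exp _ _ R fun s hs => ?_
      have := (he x (Complex.exp s) (by
        rw [Complex.norm_exp, Complex.ofReal_re]; exact hR s hs)
        (norm_pos_iff.mpr (Complex.exp_ne_zero _))).norm
      refine this.congr fun k => ?_
      rw [← mul_assoc, norm_mul, ← Complex.exp_int_mul, Complex.norm_exp, mul_comm s]
      simp
    have ho : IsOpen {s : ℂ | s.re < R} := isOpen_lt Complex.continuous_re continuous_const
    have hconv : IsPreconnected {s : ℂ | s.re < R} := (convex_halfSpace_re_lt R).isPreconnected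
    -- a point of the open set where `G` is known to vanish
    obtain ⟨s₀, hs₀⟩ : ∃ s₀ : ℂ, Complex.exp s₀ = -x / 4 :=
      ⟨_, Complex.exp_log (div_ne_zero (neg_ne_zero.mpr hx0) (by norm_num))⟩
    have hU : IsOpen {s : ℂ | 2 * ‖Complex.exp s‖ < ‖x‖ ∧ ‖x + Complex.exp s‖ < ‖x‖} :=
      IsOpen.and (isOpen_lt (by fun_prop) (by fun_prop)) (isOpen_lt (by fun_prop) (by fun_prop))
    have hs₀R : s₀.re < R := by
      rw [Real.lt_log_iff_exp_lt (by positivity), ← Complex.norm_exp, hs₀, norm_div, norm_neg]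
      norm_num
      linarith
    have hs₀U : s₀ ∈ {s : ℂ | 2 * ‖Complex.exp s‖ < ‖x‖ ∧ ‖x + Complex.exp s‖ < ‖x‖} := by
      constructor
      · rw [hs₀, norm_div, norm_neg]
        norm_num
        linarith
      · rw [hs₀, show x + -x / 4 = x * (3 / 4) by ring, norm_mul]
        norm_num
        linarith
    have hz : G =ᶠ[nhds s₀] 0 := by
      filter_upwards [hU.mem_nhds hs₀U] with s hs
      rw [hG]
      exact he0 x _ hs.1 (norm_pos_iff.mpr (Complex.exp_ne_zero _)) hs.2
    have hzero := (hd.analyticOnNhd ho).eqOn_zero_of_preconnected_of_eventuallyEq_zero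
      hconv hs₀R hz
    have hyexp : Complex.exp (Complex.log y) = y := Complex.exp_log (norm_pos_iff.mp hy)
    have := hzero (show (Complex.log y).re < R by
      rw [Complex.log_re]
      exact Real.log_lt_log hy (by linarith))
    rw [hG, hyexp] at this
    exact this
  refine sub_eq_zero.mp (laurent_two_eq_of_torus e 0 3 1 (by norm_num) (by norm_num)
    fun x y hx hy => ⟨0, ?_, ?_⟩)
  · have h1 : 2 * ‖y‖ < ‖x‖ := by rw [hx, hy]; norm_num
    have h2 : 0 < ‖y‖ := by rw [hy]; norm_num
    exact main x y h1 h2 ▸ (he x y h1 h2).hasSum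
  · simp

/-- If the double series with coefficients `s κ` and `s' κ` are related by `t = x + y`, and the
total series of `s` and the series `T` have the same sum, then `T = s'`. -/
theorem laurent_eq_of_fiberwise {ι : Type*} [Fintype ι] (s s' T : (ι → ℤ) → ℤ × ℤ → ℂ)
    (hT : ∀ x y : ℂ, 2 * ‖y‖ < ‖x‖ → 0 < ‖y‖ → ∃ o : ι → ℂ, (∀ i, o i ≠ 0) ∧
      Summable fun q : (ι → ℤ) × (ℤ × ℤ) =>
        T q.1 q.2 * (x ^ q.2.1 * y ^ q.2.2) * ∏ i, o i ^ q.1 i)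
    (hTs : ∀ x y : ℂ, 2 * ‖y‖ < ‖x‖ → 0 < ‖y‖ → ‖x + y‖ < ‖x‖ → ∃ r : ι → ℝ, (∀ i, 0 < r i) ∧
      ∀ o : ι → ℂ, (∀ i, ‖o i‖ = r i) → ∃ v,
      HasSum (fun q : (ι → ℤ) × (ℤ × ℤ) =>
        T q.1 q.2 * (x ^ q.2.1 * y ^ q.2.2) * ∏ i, o i ^ q.1 i) v ∧
      HasSum (fun q : (ι → ℤ) × (ℤ × ℤ) =>
        s q.1 q.2 * (x ^ q.2.1 * (x + y) ^ q.2.2) * ∏ i, o i ^ q.1 i) v)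
    (hs : ∀ κ, ∀ x y : ℂ, 2 * ‖y‖ < ‖x‖ → 0 < ‖y‖ →
      Summable fun k : ℤ × ℤ => s' κ k * (x ^ k.1 * y ^ k.2))
    (hss : ∀ κ, ∀ x y : ℂ, 2 * ‖y‖ < ‖x‖ → 0 < ‖y‖ → ‖x + y‖ < ‖x‖ → ∃ v,
      HasSum (fun k : ℤ × ℤ => s κ k * (x ^ k.1 * (x + y) ^ k.2)) v ∧
      HasSum (fun k : ℤ × ℤ => s' κ k * (x ^ k.1 * y ^ k.2)) v) :
    T = s' := by
  have hTsum : ∀ κ, ∀ x y : ℂ, 2 * ‖y‖ < ‖x‖ → 0 < ‖y‖ →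
      Summable fun k : ℤ × ℤ => T κ k * (x ^ k.1 * y ^ k.2) := by
    intro κ x y h1 h2
    obtain ⟨o, ho, hsum⟩ := hT x y h1 h2
    -- Fixing `κ` leaves a subfamily that carries one constant nonzero factor in `o`, which can be
    -- cancelled.
    have := hsum.prod_factor κ
    have hne : ∏ i, o i ^ κ i ≠ 0 := Finset.prod_ne_zero_iff.mpr fun i _ => zpow_ne_zero _ (ho i)
    exact (summable_mul_right_iff hne).mp this
  funext κ
  refine laurent_two_eq_of_open _ _ (hTsum κ) (hs κ) fun x y h1 h2 h3 => ?_
  obtain ⟨r, hr, hro⟩ := hTs x y h1 h2 h3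
  -- With `x` and `y` fixed, both totals are Laurent series in `o` on a common torus, so they agree
  -- exponent by exponent in `κ`.
  have := laurent_eq_of_torus (fun κ => ∑' k : ℤ × ℤ, T κ k * (x ^ k.1 * y ^ k.2))
    (fun κ => ∑' k : ℤ × ℤ, s κ k * (x ^ k.1 * (x + y) ^ k.2)) r hr fun o ho => by
      obtain ⟨v, hv1, hv2⟩ := hro o ho
      refine ⟨v, ?_, ?_⟩
      · refine hv1.prod_fiberwise fun κ => ?_
        exact (hTsum κ x y h1 h2).hasSum.mul_right (∏ i, o i ^ κ i)
      · refine hv2.prod_fiberwise fun κ => ?_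
        obtain ⟨w, hw, -⟩ := hss κ x y h1 h2 h3
        exact hw.summable.hasSum.mul_right (∏ i, o i ^ κ i)
  rw [congrFun this κ]
  obtain ⟨v, hv1, hv2⟩ := hss κ x y h1 h2 h3
  rw [hv1.tsum_eq, hv2.tsum_eq]

end LaurentSeries

/-! ## Rational functions with diagonal poles -/

section DiagonalRational

variable {α β : Type*}

/-- The multiplicative set generated by `-1`, the variables and their differences. -/
noncomputable def diagonalDenominators (α : Type*) : Submonoid (MvPolynomial α ℂ) :=
  Submonoid.closure {h | h = -1 ∨ (∃ a, h = MvPolynomial.X a) ∨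
    ∃ a b, a ≠ b ∧ h = MvPolynomial.X a - MvPolynomial.X b}

theorem X_mem_diagonalDenominators (a : α) : MvPolynomial.X a ∈ diagonalDenominators α :=
  Submonoid.subset_closure (Or.inr (Or.inl ⟨a, rfl⟩))

theorem X_sub_X_mem_diagonalDenominators {a b : α} (h : a ≠ b) :
    MvPolynomial.X a - MvPolynomial.X b ∈ diagonalDenominators α :=
  Submonoid.subset_closure (Or.inr (Or.inr ⟨a, b, h, rfl⟩))

theorem neg_mem_diagonalDenominators {h : MvPolynomial α ℂ} (hh : h ∈ diagonalDenominators α) :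
    -h ∈ diagonalDenominators α := by
  rw [← neg_one_mul]
  exact mul_mem (Submonoid.subset_closure (Or.inl rfl)) hh

theorem neg_X_sub_sub_mem_diagonalDenominators (a b : α) :
    -MvPolynomial.X a - (MvPolynomial.X b - MvPolynomial.X a) ∈ diagonalDenominators α := by
  rw [neg_sub_left, sub_add_cancel]
  exact neg_mem_diagonalDenominators (X_mem_diagonalDenominators b)

theorem eval_diagonalDenominators_ne_zero {h : MvPolynomial α ℂ}
    (hh : h ∈ diagonalDenominators α) {z : α → ℂ} (h0 : ∀ a, z a ≠ 0)
    (hz : Function.Injective z) : MvPolynomial.eval z h ≠ 0 := by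
  induction hh using Submonoid.closure_induction with
  | mem x hx =>
    rcases hx with rfl | ⟨a, rfl⟩ | ⟨a, b, hab, rfl⟩
    · simp
    · simpa using h0 a
    · simpa [sub_eq_zero] using hz.ne hab
  | one => simp
  | mul x y _ _ hx hy => simpa using ⟨hx, hy⟩

/-- Rational functions with the only possible poles at `z_a = 0` and `z_a = z_b`. -/
def IsDiagonalRational (f : (α → ℂ) → ℂ) : Prop :=
  ∃ g : MvPolynomial α ℂ, ∃ h ∈ diagonalDenominators α, ∀ z : α → ℂ, (∀ a, z a ≠ 0) →
    Function.Injective z → f z = MvPolynomial.eval z g / MvPolynomial.eval z h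

theorem IsDiagonalRational.eval (g : MvPolynomial α ℂ) :
    IsDiagonalRational fun z => MvPolynomial.eval z g :=
  ⟨g, 1, one_mem _, fun z _ _ => by simp⟩

theorem IsDiagonalRational.mul {f₁ f₂ : (α → ℂ) → ℂ} (h₁ : IsDiagonalRational f₁)
    (h₂ : IsDiagonalRational f₂) : IsDiagonalRational fun z => f₁ z * f₂ z := by
  obtain ⟨g, h, hh, hf⟩ := h₁
  obtain ⟨g', h', hh', hf'⟩ := h₂
  refine ⟨g * g', h * h', mul_mem hh hh', fun z h0 hz => ?_⟩
  simp only
  rw [hf z h0 hz, hf' z h0 hz, map_mul, map_mul, div_mul_div_comm]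

theorem IsDiagonalRational.add {f₁ f₂ : (α → ℂ) → ℂ} (h₁ : IsDiagonalRational f₁)
    (h₂ : IsDiagonalRational f₂) : IsDiagonalRational fun z => f₁ z + f₂ z := by
  obtain ⟨g, h, hh, hf⟩ := h₁
  obtain ⟨g', h', hh', hf'⟩ := h₂
  refine ⟨g * h' + h * g', h * h', mul_mem hh hh', fun z h0 hz => ?_⟩
  simp only
  rw [hf z h0 hz, hf' z h0 hz, div_add_div _ _ (eval_diagonalDenominators_ne_zero hh h0 hz)
    (eval_diagonalDenominators_ne_zero hh' h0 hz)]
  simp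

theorem IsDiagonalRational.sum {ι : Type*} (s : Finset ι) {f : ι → (α → ℂ) → ℂ}
    (h : ∀ i ∈ s, IsDiagonalRational (f i)) : IsDiagonalRational fun z => ∑ i ∈ s, f i z := by
  classical
  induction s using Finset.induction_on with
  | empty => simpa using IsDiagonalRational.eval (0 : MvPolynomial α ℂ)
  | insert a s ha ih =>
    simp only [Finset.sum_insert ha]
    exact (h a (Finset.mem_insert_self a s)).add
      (ih fun i hi => h i (Finset.mem_insert_of_mem hi))

theorem diagonal_substitution_mem {L : α → MvPolynomial β ℂ}
    (hL : ∀ a, L a ∈ diagonalDenominators β)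
    (hL' : ∀ a b, a ≠ b → L a - L b ∈ diagonalDenominators β) {h : MvPolynomial α ℂ}
    (hh : h ∈ diagonalDenominators α) : MvPolynomial.bind₁ L h ∈ diagonalDenominators β := by
  induction hh using Submonoid.closure_induction with
  | mem x hx =>
    rcases hx with rfl | ⟨a, rfl⟩ | ⟨a, b, hab, rfl⟩
    · simpa using neg_mem_diagonalDenominators (one_mem (diagonalDenominators β))
    · simpa using hL a
    · simpa using hL' a b hab
  | one => simp
  | mul x y _ _ hx hy => simpa using mul_mem hx hy

/-- Requiring the `L a` and their differences to be admissible denominators pulls denominators back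
to denominators. It also keeps the substituted points nonzero and distinct. -/
theorem IsDiagonalRational.comp {f : (α → ℂ) → ℂ} (hf : IsDiagonalRational f)
    {L : α → MvPolynomial β ℂ} (hL : ∀ a, L a ∈ diagonalDenominators β)
    (hL' : ∀ a b, a ≠ b → L a - L b ∈ diagonalDenominators β) :
    IsDiagonalRational fun z => f fun a => MvPolynomial.eval z (L a) := by
  obtain ⟨g, h, hh, hfz⟩ := hf
  refine ⟨MvPolynomial.bind₁ L g, MvPolynomial.bind₁ L h,
    diagonal_substitution_mem hL hL' hh, fun z h0 hz => ?_⟩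
  have hb : ∀ p, MvPolynomial.eval z (MvPolynomial.bind₁ L p) =
      MvPolynomial.eval (fun a => MvPolynomial.eval z (L a)) p := fun p =>
    MvPolynomial.eval₂Hom_bind₁ _ _ _ _
  rw [hb, hb]
  refine hfz _ (fun a => eval_diagonalDenominators_ne_zero (hL a) h0 hz) fun a b hab => ?_
  by_contra hne
  apply eval_diagonalDenominators_ne_zero (hL' a b hne) h0 hz
  simpa [sub_eq_zero] using hab

theorem IsDiagonalRational.reindex {f : (α → ℂ) → ℂ} (hf : IsDiagonalRational f) {e : α → β}
    (he : Function.Injective e) : IsDiagonalRational fun z : β → ℂ => f (z ∘ e) := by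
  have := hf.comp (L := fun a => MvPolynomial.X (e a)) (fun a => X_mem_diagonalDenominators _)
    fun a b hab => X_sub_X_mem_diagonalDenominators (he.ne hab)
  simpa [Function.comp_def] using this

theorem diagonalDenominators_fin {n : ℕ} {h : MvPolynomial (Fin n) ℂ}
    (hh : h ∈ diagonalDenominators (Fin n)) :
    ∃ (c : ℂ) (p : Fin n → ℕ) (q : Fin n → Fin n → ℕ), c ≠ 0 ∧ ∀ z : Fin n → ℂ,
      MvPolynomial.eval z h =
        c * ((∏ i, z i ^ p i) * ∏ i, ∏ j ∈ Finset.Ioi i, (z i - z j) ^ q i j) := by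
  -- The normal form contains only differences with `i < j`; the opposite order costs a sign,
  -- collected in `c`.
  have hdiff : ∀ a b : Fin n, a < b → ∀ z : Fin n → ℂ,
      ∏ i, ∏ j ∈ Finset.Ioi i, (z i - z j) ^ (if i = a ∧ j = b then 1 else 0) = z a - z b := by
    intro a b hab z
    rw [Finset.prod_eq_single a, Finset.prod_eq_single b]
    · simp
    · intro j _ hj; simp [hj]
    · intro hb; simp [hab] at hb
    · intro i _ hi; simp [hi]
    · simp
  induction hh using Submonoid.closure_induction with
  | mem x hx =>
    rcases hx with rfl | ⟨a, rfl⟩ | ⟨a, b, hab, rfl⟩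
    · exact ⟨-1, 0, 0, by simp, fun z => by simp⟩
    · refine ⟨1, Pi.single a 1, 0, by simp, fun z => ?_⟩
      rw [Finset.prod_eq_single a]
      · simp
      · intro i _ hi; simp [hi]
      · simp
    · rcases lt_or_gt_of_ne hab with hlt | hlt
      · exact ⟨1, 0, fun i j => if i = a ∧ j = b then 1 else 0, by simp, fun z => by
          rw [hdiff a b hlt z]; simp⟩
      · exact ⟨-1, 0, fun i j => if i = b ∧ j = a then 1 else 0, by simp, fun z => by
          rw [hdiff b a hlt z]; simp⟩
  | one => exact ⟨1, 0, 0, by simp, fun z => by simp⟩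
  | mul x y _ _ hx hy =>
    obtain ⟨c, p, q, hc, hx⟩ := hx
    obtain ⟨c', p', q', hc', hy⟩ := hy
    refine ⟨c * c', p + p', q + q', mul_ne_zero hc hc', fun z => ?_⟩
    rw [map_mul, hx, hy]
    simp only [Pi.add_apply, pow_add, Finset.prod_mul_distrib]
    ring

theorem isDiagonalRational_iff {n : ℕ} {f : (Fin n → ℂ) → ℂ} :
    IsDiagonalRational f ↔ RationalWithDiagonalPoles f := by
  constructor
  · rintro ⟨g, h, hh, hf⟩
    obtain ⟨c, p, q, hc, hpq⟩ := diagonalDenominators_fin hh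
    refine ⟨MvPolynomial.C c⁻¹ * g, p, q, fun z h0 hz => ?_⟩
    rw [hf z h0 hz, hpq, map_mul, MvPolynomial.eval_C, div_mul_eq_div_div, inv_mul_eq_div]
  · rintro ⟨g, p, q, hf⟩
    refine ⟨g, (∏ i, MvPolynomial.X i ^ p i) *
      ∏ i, ∏ j ∈ Finset.Ioi i, (MvPolynomial.X i - MvPolynomial.X j) ^ q i j, ?_,
      fun z h0 hz => ?_⟩
    · refine mul_mem (prod_mem fun i _ => pow_mem (X_mem_diagonalDenominators i) _)
        (prod_mem fun i _ => prod_mem fun j hj => pow_mem (X_sub_X_mem_diagonalDenominators ?_) _)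
      exact (Finset.mem_Ioi.mp hj).ne
    · rw [hf z h0 hz]
      simp

end DiagonalRational

/-! ## Functions with an absolutely convergent Laurent expansion on a region -/

section LaurentExpandable

variable {E K : Type*}

/-- `χ z` is a character of the group of exponents for each `z ∈ Ω`. -/
structure IsMonomialSystem [AddCommGroup K] (Ω : Set E) (χ : E → K → ℂ) : Prop where
  zero : ∀ z ∈ Ω, χ z 0 = 1
  add : ∀ z ∈ Ω, ∀ k l, χ z (k + l) = χ z k * χ z l

/-- `F` is on `Ω` the sum of an absolutely convergent series of multiples of monomials. -/
def LaurentExpandable (Ω : Set E) (χ : E → K → ℂ) (F : E → ℂ) : Prop :=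
  ∃ (J : Type) (φ : J → K) (c : J → ℂ), ∀ z ∈ Ω, HasSum (fun j => c j * χ z (φ j)) (F z)

variable {Ω : Set E} {χ : E → K → ℂ}

theorem LaurentExpandable.congr {F G : E → ℂ} (hF : LaurentExpandable Ω χ F)
    (h : ∀ z ∈ Ω, G z = F z) : LaurentExpandable Ω χ G := by
  obtain ⟨J, φ, c, hc⟩ := hF
  exact ⟨J, φ, c, fun z hz => h z hz ▸ hc z hz⟩

theorem LaurentExpandable.monomial (a : ℂ) (k : K) :
    LaurentExpandable Ω χ fun z => a * χ z k :=
  ⟨Unit, fun _ => k, fun _ => a, fun z _ => by simp⟩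

theorem LaurentExpandable.add {F G : E → ℂ} (hF : LaurentExpandable Ω χ F)
    (hG : LaurentExpandable Ω χ G) : LaurentExpandable Ω χ fun z => F z + G z := by
  obtain ⟨J, φ, c, hc⟩ := hF
  obtain ⟨J', φ', c', hc'⟩ := hG
  exact ⟨J ⊕ J', Sum.elim φ φ', Sum.elim c c', fun z hz =>
    HasSum.sum (f := fun j => Sum.elim c c' j * χ z (Sum.elim φ φ' j)) (hc z hz) (hc' z hz)⟩

variable [AddCommGroup K]

theorem IsMonomialSystem.ne_zero (h : IsMonomialSystem Ω χ) {z : E} (hz : z ∈ Ω) (k : K) :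
    χ z k ≠ 0 := fun h0 => by
  have := h.add z hz k (-k)
  rw [add_neg_cancel, h.zero z hz, h0, zero_mul] at this
  exact one_ne_zero this

theorem IsMonomialSystem.neg (h : IsMonomialSystem Ω χ) {z : E} (hz : z ∈ Ω) (k : K) :
    χ z (-k) = (χ z k)⁻¹ := by
  refine eq_inv_of_mul_eq_one_left ?_
  rw [← h.add z hz, neg_add_cancel, h.zero z hz]

theorem IsMonomialSystem.nsmul (h : IsMonomialSystem Ω χ) {z : E} (hz : z ∈ Ω) (k : K) (n : ℕ) :
    χ z (n • k) = χ z k ^ n := by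
  induction n with
  | zero => simp [h.zero z hz]
  | succ n ih => rw [succ_nsmul, h.add z hz, ih, pow_succ]

theorem LaurentExpandable.const (h : IsMonomialSystem Ω χ) (a : ℂ) :
    LaurentExpandable Ω χ fun _ => a :=
  (LaurentExpandable.monomial a 0).congr fun z hz => by rw [h.zero z hz, mul_one]

theorem HasSum.mul_complex {J J' : Type*} {f : J → ℂ} {g : J' → ℂ} {a b : ℂ} (hf : HasSum f a)
    (hg : HasSum g b) : HasSum (fun j : J × J' => f j.1 * g j.2) (a * b) := by
  have hs : Summable fun j : J × J' => f j.1 * g j.2 :=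
    summable_mul_of_summable_norm hf.summable.norm hg.summable.norm
  exact hf.mul hg hs

theorem LaurentExpandable.mul (h : IsMonomialSystem Ω χ) {F G : E → ℂ}
    (hF : LaurentExpandable Ω χ F) (hG : LaurentExpandable Ω χ G) :
    LaurentExpandable Ω χ fun z => F z * G z := by
  obtain ⟨J, φ, c, hc⟩ := hF
  obtain ⟨J', φ', c', hc'⟩ := hG
  refine ⟨J × J', fun j => φ j.1 + φ' j.2, fun j => c j.1 * c' j.2, fun z hz => ?_⟩
  refine ((hc z hz).mul_complex (hc' z hz)).congr_fun fun j => ?_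
  rw [h.add z hz]
  ring

/-- Summing over the exponent of `u` gives `v^k / (1 - u)^(k+1)`, and what remains is geometric in
`v / (1 - u)`. The same computation with norms gives absolute convergence exactly from `‖u‖ + ‖v‖ <
1`. -/
theorem hasSum_inv_one_sub_sub {u v : ℂ} (h : ‖u‖ + ‖v‖ < 1) :
    HasSum (fun q : ℕ × ℕ => ((q.2 + q.1).choose q.1 : ℂ) * u ^ q.2 * v ^ q.1)
      (1 - u - v)⁻¹ := by
  have hu : ‖u‖ < 1 := lt_of_le_of_lt (le_add_of_nonneg_right (norm_nonneg v)) h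
  have key : ∀ {𝕜 : Type} [RCLike 𝕜] (u v : 𝕜), ‖u‖ < 1 → ∀ k : ℕ,
      HasSum (fun l : ℕ => ((l + k).choose k : 𝕜) * u ^ l * v ^ k)
        ((1 - u)⁻¹ * (v / (1 - u)) ^ k) := by
    intro 𝕜 _ u v hu k
    have := (hasSum_choose_mul_geometric_of_norm_lt_one k hu).mul_right (v ^ k)
    have e : 1 / (1 - u) ^ (k + 1) * v ^ k = (1 - u)⁻¹ * (v / (1 - u)) ^ k := by
      rw [div_pow, pow_succ]
      field_simp
    exact e ▸ this
  have hs : Summable fun q : ℕ × ℕ => ((q.2 + q.1).choose q.1 : ℂ) * u ^ q.2 * v ^ q.1 := by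
    refine Summable.of_norm ?_
    rw [summable_prod_of_nonneg fun _ => norm_nonneg _]
    have hk : ∀ k : ℕ, HasSum (fun l : ℕ => ‖((l + k).choose k : ℂ) * u ^ l * v ^ k‖)
        ((1 - ‖u‖)⁻¹ * (‖v‖ / (1 - ‖u‖)) ^ k) := fun k => by
      have := key (𝕜 := ℝ) ‖u‖ ‖v‖ (by simpa using hu) k
      refine this.congr_fun fun l => ?_
      simp
    refine ⟨fun k => (hk k).summable, ?_⟩
    have h1 : (fun k : ℕ => ∑' l : ℕ, ‖((l + k).choose k : ℂ) * u ^ l * v ^ k‖) =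
        fun k => (1 - ‖u‖)⁻¹ * (‖v‖ / (1 - ‖u‖)) ^ k := funext fun k => (hk k).tsum_eq
    have h2 : 0 < 1 - ‖u‖ := by linarith
    simp only at h1 ⊢
    rw [h1]
    exact (summable_geometric_of_lt_one (by positivity)
      ((div_lt_one h2).mpr (by linarith))).mul_left _
  have h1u : 1 - u ≠ 0 := sub_ne_zero.mpr fun h1 => by rw [← h1, norm_one] at hu; exact hu.false
  have hv : ‖v / (1 - u)‖ < 1 := by
    have : 1 - ‖u‖ ≤ ‖1 - u‖ := by simpa using norm_sub_norm_le (1 : ℂ) u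
    rw [norm_div, div_lt_one (norm_pos_iff.mpr h1u)]
    linarith
  have h2 : HasSum (fun k : ℕ => (1 - u)⁻¹ * (v / (1 - u)) ^ k) (1 - u - v)⁻¹ := by
    have e : (1 - u)⁻¹ * (1 - v / (1 - u))⁻¹ = (1 - u - v)⁻¹ := by
      rw [← mul_inv]
      congr 1
      field_simp
    exact e ▸ (hasSum_geometric_of_norm_lt_one hv).mul_left (1 - u)⁻¹
  obtain ⟨w, hw⟩ := hs
  exact (hw.prod_fiberwise fun k => key u v hu k).unique h2 ▸ hw

/-- Factoring out the dominant monomial leaves `(1 - u - v)⁻¹`, whose double series consists of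
monomials again. Two lesser terms suffice for every factor met below. -/
theorem LaurentExpandable.inv (h : IsMonomialSystem Ω χ) (a b d : K) (r s t : ℂ) (hr : r ≠ 0)
    (hdom : ∀ z ∈ Ω, ‖s * χ z b‖ + ‖t * χ z d‖ < ‖r * χ z a‖) :
    LaurentExpandable Ω χ fun z => (r * χ z a + s * χ z b + t * χ z d)⁻¹ := by
  refine ⟨ℕ × ℕ, fun q => -a + (q.2 • (b + -a) + q.1 • (d + -a)),
    fun q => r⁻¹ * (((q.2 + q.1).choose q.1 : ℂ) * (-s / r) ^ q.2 * (-t / r) ^ q.1),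
    fun z hz => ?_⟩
  have ha : χ z a ≠ 0 := h.ne_zero hz a
  have hra : 0 < ‖r * χ z a‖ := norm_pos_iff.mpr (mul_ne_zero hr ha)
  have := (hasSum_inv_one_sub_sub (u := -(s * χ z b) / (r * χ z a))
    (v := -(t * χ z d) / (r * χ z a)) (by
      rw [norm_div, norm_div, norm_neg, norm_neg, ← add_div, div_lt_one hra]
      exact hdom z hz)).mul_left (r * χ z a)⁻¹
  have e : (r * χ z a)⁻¹ * (1 - -(s * χ z b) / (r * χ z a) - -(t * χ z d) / (r * χ z a))⁻¹ =
      (r * χ z a + s * χ z b + t * χ z d)⁻¹ := by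
    rw [← mul_inv]
    congr 1
    field_simp
    ring
  rw [e] at this
  refine this.congr_fun fun q => ?_
  · rw [h.add z hz, h.add z hz, h.nsmul hz, h.nsmul hz, h.add z hz, h.add z hz, h.neg hz,
      show -(s * χ z b) / (r * χ z a) = (-s / r) * (χ z b * (χ z a)⁻¹) by field_simp,
      show -(t * χ z d) / (r * χ z a) = (-t / r) * (χ z d * (χ z a)⁻¹) by field_simp,
      mul_pow _ _ q.1, mul_pow _ _ q.2, mul_inv]
    ring

/-- Terms with equal exponent are collected only here. The free index type in `LaurentExpandable`
makes sums and products immediate, without convolution of coefficients. -/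
theorem LaurentExpandable.exists_coeff (h : IsMonomialSystem Ω χ) {F : E → ℂ}
    (hF : LaurentExpandable Ω χ F) :
    ∃ T : K → ℂ, ∀ z ∈ Ω, HasSum (fun k => T k * χ z k) (F z) := by
  obtain ⟨J, φ, c, hc⟩ := hF
  refine ⟨fun k => ∑' j : {j // φ j = k}, c j, fun z hz => ?_⟩
  have h1 := (Equiv.sigmaFiberEquiv φ).hasSum_iff.mpr (hc z hz)
  refine h1.sigma fun k => ?_
  have h2 : Summable fun j : {j // φ j = k} => c j * χ z k := by
    refine ((hc z hz).summable.subtype {j | φ j = k}).congr fun j => ?_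
    have : φ j.1 = k := j.2
    simp [this]
  have h3 := ((summable_mul_right_iff (h.ne_zero hz k)).mp h2).hasSum.mul_right (χ z k)
  refine h3.congr_fun fun j => ?_
  have : φ j = k := j.2
  simp [this, Equiv.sigmaFiberEquiv]

theorem IsDiagonalRational.laurentExpandable (h : IsMonomialSystem Ω χ) {α : Type*}
    {f : (α → ℂ) → ℂ} (hf : IsDiagonalRational f) (L : E → α → ℂ)
    (h0 : ∀ z ∈ Ω, ∀ a, L z a ≠ 0) (hinj : ∀ z ∈ Ω, Function.Injective (L z))
    (hL : ∀ a, LaurentExpandable Ω χ fun z => L z a)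
    (hLi : ∀ a, LaurentExpandable Ω χ fun z => (L z a)⁻¹)
    (hLs : ∀ a b, a ≠ b → LaurentExpandable Ω χ fun z => (L z a - L z b)⁻¹) :
    LaurentExpandable Ω χ fun z => f (L z) := by
  obtain ⟨p, q, hq, hpq⟩ := hf
  have hp : LaurentExpandable Ω χ fun z => MvPolynomial.eval (L z) p := by
    clear hpq
    induction p using MvPolynomial.induction_on with
    | C a => simpa using LaurentExpandable.const h a
    | add p p' hp hp' => simpa using hp.add hp'
    | mul_X p a hp => simpa using hp.mul h (hL a)
  have hqi : LaurentExpandable Ω χ fun z => (MvPolynomial.eval (L z) q)⁻¹ := by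
    clear hpq hp
    induction hq using Submonoid.closure_induction with
    | mem x hx =>
      rcases hx with rfl | ⟨a, rfl⟩ | ⟨a, b, hab, rfl⟩
      · simpa using LaurentExpandable.const h (-1)⁻¹
      · simpa using hLi a
      · simpa using hLs a b hab
    | one => simpa using LaurentExpandable.const h 1
    | mul x y _ _ hx hy =>
      refine (hx.mul h hy).congr fun z _ => ?_
      rw [map_mul, mul_inv]
  refine (hp.mul h hqi).congr fun z hz => ?_
  rw [hpq _ (h0 z hz) (hinj z hz), div_eq_mul_inv]

end LaurentExpandable

/-! ## Integer binomial expansions -/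

section Binomial

/-- The binomial coefficient of an integer and a natural number. -/
noncomputable def intChoose (n : ℤ) (k : ℕ) : ℂ := (∏ j ∈ Finset.range k, ((n : ℂ) - j)) / k.factorial

theorem intChoose_zero (n : ℤ) : intChoose n 0 = 1 := by simp [intChoose]

theorem intChoose_succ (n : ℤ) (k : ℕ) :
    intChoose n (k + 1) * ((k : ℂ) + 1) = intChoose n k * (n - k) := by
  have h1 : (k.factorial : ℂ) ≠ 0 := by exact_mod_cast k.factorial_ne_zero
  have h2 : (k : ℂ) + 1 ≠ 0 := by exact_mod_cast k.succ_ne_zero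
  rw [intChoose, intChoose, Finset.prod_range_succ, Nat.factorial_succ]
  push_cast
  field_simp

theorem intChoose_natCast (n k : ℕ) : intChoose n k = (n.choose k : ℂ) := by
  induction k with
  | zero => simp [intChoose_zero]
  | succ k ih =>
    have h2 : (k : ℂ) + 1 ≠ 0 := by exact_mod_cast k.succ_ne_zero
    apply mul_right_cancel₀ h2
    rw [intChoose_succ, ih]
    rcases le_or_gt k n with h | h
    · have := congrArg (Nat.cast : ℕ → ℂ) (Nat.choose_succ_right_eq n k)
      push_cast [Nat.cast_sub h] at this
      rw [this]
      simp
    · simp [Nat.choose_eq_zero_of_lt h, Nat.choose_eq_zero_of_lt (Nat.lt_succ_of_lt h)]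

theorem intChoose_neg (n k : ℕ) :
    intChoose (-(n + 1 : ℕ)) k = (-1) ^ k * ((k + n).choose n : ℂ) := by
  induction k with
  | zero => simp [intChoose_zero]
  | succ k ih =>
    have h2 : (k : ℂ) + 1 ≠ 0 := by exact_mod_cast k.succ_ne_zero
    apply mul_right_cancel₀ h2
    have h3 : (k + 1 + n).choose n * (k + 1) = (k + n).choose n * (k + n + 1) := by
      rw [Nat.choose_mul_succ_eq, Nat.add_right_comm k 1 n, show k + n + 1 - n = k + 1 by omega]
    have h4 := congrArg (Nat.cast : ℕ → ℂ) h3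
    push_cast at h4
    rw [intChoose_succ, ih, mul_assoc ((-1 : ℂ) ^ (k + 1)), h4]
    push_cast
    ring

/-- The sum of norms is `(|x| + |y|)^n` for `n ≥ 0` and `(|x| - |y|)^n` for `n < 0`. Bounding it by
both together gives one estimate for all `n`. -/
theorem hasSum_norm_intChoose (n : ℤ) {x y : ℂ} (h : ‖y‖ < ‖x‖) :
    ∃ b : ℝ, b ≤ (‖x‖ + ‖y‖) ^ n + (‖x‖ - ‖y‖) ^ n ∧
      HasSum (fun k : ℕ => ‖intChoose n k * x ^ (n - k) * y ^ k‖) b := by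
  have hx : 0 < ‖x‖ := lt_of_le_of_lt (norm_nonneg y) h
  have h1 : 0 < ‖x‖ + ‖y‖ := by positivity
  have h2 : 0 < ‖x‖ - ‖y‖ := by linarith
  obtain ⟨m, rfl | rfl⟩ : ∃ m : ℕ, n = m ∨ n = -(m + 1 : ℕ) := by
    rcases n with m | m
    · exact ⟨m, Or.inl rfl⟩
    · exact ⟨m, Or.inr rfl⟩
  · refine ⟨(‖x‖ + ‖y‖) ^ (m : ℤ), by linarith [zpow_pos h2 (m : ℤ)], ?_⟩
    have e : (‖x‖ + ‖y‖) ^ (m : ℤ) =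
        ∑ k ∈ Finset.range (m + 1), ‖intChoose m k * x ^ ((m : ℤ) - k) * y ^ k‖ := by
      rw [zpow_natCast, add_comm, add_pow]
      refine Finset.sum_congr rfl fun k hk => ?_
      have hk' : k ≤ m := Nat.lt_succ_iff.mp (Finset.mem_range.mp hk)
      rw [intChoose_natCast, ← Nat.cast_sub hk', zpow_natCast]
      simp
      ring
    rw [e]
    refine hasSum_sum_of_ne_finset_zero fun k hk => ?_
    have hk' : m < k := by simpa using hk
    simp [intChoose_natCast, Nat.choose_eq_zero_of_lt hk']
  · refine ⟨(‖x‖ - ‖y‖) ^ (-(m + 1 : ℕ) : ℤ), by linarith [zpow_pos h1 (-(m + 1 : ℕ) : ℤ)], ?_⟩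
    have hr : ‖(‖y‖ / ‖x‖ : ℝ)‖ < 1 := by
      rw [Real.norm_of_nonneg (by positivity)]
      exact (div_lt_one hx).mpr h
    have := (hasSum_choose_mul_geometric_of_norm_lt_one m hr).mul_left
      (‖x‖ ^ (-(m + 1 : ℕ) : ℤ))
    have e : ‖x‖ ^ (-(m + 1 : ℕ) : ℤ) * (1 / (1 - ‖y‖ / ‖x‖) ^ (m + 1)) =
        (‖x‖ - ‖y‖) ^ (-(m + 1 : ℕ) : ℤ) := by
      rw [zpow_neg, zpow_neg, zpow_natCast, zpow_natCast, one_div, ← mul_inv, ← mul_pow]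
      congr 2
      field_simp
    rw [e] at this
    refine this.congr_fun fun k => ?_
    rw [intChoose_neg, norm_mul, norm_mul, norm_mul, norm_pow, norm_pow, norm_neg, norm_one,
      norm_zpow, zpow_sub₀ hx.ne', zpow_natCast, div_pow]
    simp
    ring

theorem hasSum_intChoose (n : ℤ) {x y : ℂ} (h : ‖y‖ < ‖x‖) :
    HasSum (fun k : ℕ => intChoose n k * x ^ (n - k) * y ^ k) ((x + y) ^ n) := by
  have hx : x ≠ 0 := norm_pos_iff.mp (lt_of_le_of_lt (norm_nonneg y) h)
  obtain ⟨m, rfl | rfl⟩ : ∃ m : ℕ, n = m ∨ n = -(m + 1 : ℕ) := by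
    rcases n with m | m
    · exact ⟨m, Or.inl rfl⟩
    · exact ⟨m, Or.inr rfl⟩
  · have e : (x + y) ^ (m : ℤ) =
        ∑ k ∈ Finset.range (m + 1), intChoose m k * x ^ ((m : ℤ) - k) * y ^ k := by
      rw [zpow_natCast, add_comm, add_pow]
      refine Finset.sum_congr rfl fun k hk => ?_
      have hk' : k ≤ m := Nat.lt_succ_iff.mp (Finset.mem_range.mp hk)
      rw [intChoose_natCast, ← Nat.cast_sub hk', zpow_natCast]
      ring
    rw [e]
    refine hasSum_sum_of_ne_finset_zero fun k hk => ?_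
    have hk' : m < k := by simpa using hk
    simp [intChoose_natCast, Nat.choose_eq_zero_of_lt hk']
  · have hr : ‖-y / x‖ < 1 := by
      rw [norm_div, norm_neg]
      exact (div_lt_one (norm_pos_iff.mpr hx)).mpr h
    have := (hasSum_choose_mul_geometric_of_norm_lt_one m hr).mul_left (x ^ (-(m + 1 : ℕ) : ℤ))
    have e : x ^ (-(m + 1 : ℕ) : ℤ) * (1 / (1 - -y / x) ^ (m + 1)) =
        (x + y) ^ (-(m + 1 : ℕ) : ℤ) := by
      rw [zpow_neg, zpow_neg, zpow_natCast, zpow_natCast, one_div, ← mul_inv, ← mul_pow]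
      congr 2
      field_simp
      ring
    rw [e] at this
    refine this.congr_fun fun k => ?_
    rw [intChoose_neg, zpow_sub₀ hx, zpow_natCast, div_pow, neg_pow]
    ring

/-- The coefficients of the expansion of `∑ a (n, l) (x + y) ^ n y ^ l` in powers of `x` and `y`,
with nonnegative powers of `y` in the expansion of `(x + y) ^ n`. -/
noncomputable def shiftCoeff (a : ℤ × ℤ → ℂ) (e : ℤ × ℤ) : ℂ :=
  ∑ᶠ k : ℕ, intChoose (e.1 + k) k * a (e.1 + k, e.2 - k)

theorem shiftCoeff_support_finite {a : ℤ × ℤ → ℂ} {N : ℤ} (hN : ∀ l < N, ∀ n, a (n, l) = 0)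
    (e : ℤ × ℤ) :
    (Function.support fun k : ℕ => intChoose (e.1 + k) k * a (e.1 + k, e.2 - k)).Finite := by
  refine (Set.finite_Iic (e.2 - N).toNat).subset fun k hk => ?_
  by_contra h
  apply hk
  have : a (e.1 + k, e.2 - k) = 0 := hN _ (by simp only [Set.mem_Iic, not_le] at h; omega) _
  simp [this]

/-- The shift `((n, l), k) ↦ ((n - k, l + k), k)` of exponents. -/
def shiftEquiv : (ℤ × ℤ) × ℕ ≃ (ℤ × ℤ) × ℕ where
  toFun q := ((q.1.1 + q.2, q.1.2 - q.2), q.2)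
  invFun q := ((q.1.1 - q.2, q.1.2 + q.2), q.2)
  left_inv q := by simp
  right_inv q := by simp

/-- The binomial expansion of every `(x + y)^n` is inserted and the triple series rearranged. Its
norms are dominated by the original series at `u = |x| + |y|` and `u = |x| - |y|`; the second needs
`|u| > |y|`, hence the condition `2‖y‖ < ‖x‖`. -/
theorem hasSum_shiftCoeff {a : ℤ × ℤ → ℂ} {N : ℤ} (hN : ∀ l < N, ∀ n, a (n, l) = 0) {x y : ℂ}
    (hxy : 2 * ‖y‖ < ‖x‖) (hy : 0 < ‖y‖)
    (h : ∀ u : ℂ, ‖y‖ < ‖u‖ → Summable fun k : ℤ × ℤ => a k * (u ^ k.1 * y ^ k.2)) :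
    HasSum (fun e => shiftCoeff a e * (x ^ e.1 * y ^ e.2))
      (∑' k : ℤ × ℤ, a k * ((x + y) ^ k.1 * y ^ k.2)) := by
  have hy0 : y ≠ 0 := norm_pos_iff.mp hy
  have hlt : ‖y‖ < ‖x‖ := by linarith
  let t : (ℤ × ℤ) × ℕ → ℂ := fun q =>
    a q.1 * y ^ q.1.2 * (intChoose q.1.1 q.2 * x ^ (q.1.1 - q.2) * y ^ q.2)
  have ht : ∀ k : ℤ × ℤ, HasSum (fun m => t (k, m)) (a k * ((x + y) ^ k.1 * y ^ k.2)) := fun k => by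
    have := (hasSum_intChoose k.1 hlt).mul_left (a k * y ^ k.2)
    rw [show a k * ((x + y) ^ k.1 * y ^ k.2) = a k * y ^ k.2 * (x + y) ^ k.1 by ring]
    exact this
  have hsum : Summable t := by
    refine Summable.of_norm ?_
    rw [summable_prod_of_nonneg fun _ => norm_nonneg _]
    choose b hb hbs using fun n : ℤ => hasSum_norm_intChoose n hlt
    have hn : ∀ k : ℤ × ℤ, HasSum (fun m => ‖t (k, m)‖) (‖a k * y ^ k.2‖ * b k.1) := fun k =>
      ((hbs k.1).mul_left ‖a k * y ^ k.2‖).congr_fun fun m => by simp only [t, norm_mul]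
    refine ⟨fun k => (hn k).summable, ?_⟩
    have e : (fun k : ℤ × ℤ => ∑' m, ‖t (k, m)‖) = fun k => ‖a k * y ^ k.2‖ * b k.1 :=
      funext fun k => (hn k).tsum_eq
    rw [e]
    have hu : ∀ u : ℝ, ‖y‖ < u → Summable fun k : ℤ × ℤ => ‖a k * y ^ k.2‖ * u ^ k.1 := by
      intro u hu
      have hu0 : 0 ≤ u := (norm_nonneg y).trans hu.le
      refine (h u (by rwa [Complex.norm_real, Real.norm_of_nonneg hu0])).norm.congr fun k => ?_
      rw [norm_mul, norm_mul, norm_mul, norm_zpow (u : ℂ), Complex.norm_real,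
        Real.norm_of_nonneg hu0]
      ring
    refine Summable.of_nonneg_of_le (fun k => ?_) (fun k => ?_)
      ((hu (‖x‖ + ‖y‖) (by linarith)).add (hu (‖x‖ - ‖y‖) (by linarith)))
    · exact (hn k).nonneg fun _ => norm_nonneg _
    · rw [← mul_add]
      exact mul_le_mul_of_nonneg_left (hb k.1) (norm_nonneg _)
  have htot : HasSum t (∑' k : ℤ × ℤ, a k * ((x + y) ^ k.1 * y ^ k.2)) := by
    obtain ⟨v, hv⟩ := hsum
    rw [(hv.prod_fiberwise ht).tsum_eq]
    exact hv
  refine (shiftEquiv.hasSum_iff.mpr htot).prod_fiberwise fun e => ?_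
  have hx0 : x ≠ 0 := norm_pos_iff.mp (hy.trans hlt)
  have hfin := shiftCoeff_support_finite hN e
  have hs : HasSum (fun k : ℕ => intChoose (e.1 + k) k * a (e.1 + k, e.2 - k))
      (shiftCoeff a e) := by
    rw [shiftCoeff, finsum_eq_sum _ hfin]
    exact hasSum_sum_of_ne_finset_zero fun k hk => by simpa [or_iff_not_imp_left] using hk
  refine (hs.mul_right (x ^ e.1 * y ^ e.2)).congr_fun fun k => ?_
  simp only [t, shiftEquiv, Function.comp_apply, Equiv.coe_fn_mk, add_sub_cancel_right]
  rw [zpow_sub₀ hy0, zpow_natCast]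
  field_simp

/-- Multiplication of a family of series by the exponential polynomial `∑_{k < K} z ^ k / k!`
with the substitution `z ↦ -z`. -/
theorem hasSum_exp_subNeg {κ : Type*} (K : ℕ) (c : ℕ → ℤ → κ → ℂ) (w : κ → ℂ) {z : ℂ}
    (hz : z ≠ 0) (G : ℕ → ℂ)
    (h : ∀ k < K, HasSum (fun q : ℤ × κ => c k q.1 q.2 * ((-z) ^ q.1 * w q.2)) (G k)) :
    HasSum (fun q : ℤ × κ => (∑ k ∈ Finset.range K,
      ((k.factorial : ℂ)⁻¹) * ((-1) ^ (q.1 - k) * c k (q.1 - k) q.2)) * (z ^ q.1 * w q.2))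
      (∑ k ∈ Finset.range K, ((k.factorial : ℂ)⁻¹) * (z ^ k * G k)) := by
  simp only [Finset.sum_mul]
  refine hasSum_sum fun k hk => ?_
  let e : ℤ × κ ≃ ℤ × κ := (Equiv.subRight (k : ℤ)).prodCongr (Equiv.refl κ)
  have := ((e.hasSum_iff.mpr (h k (Finset.mem_range.mp hk))).mul_left (z ^ k)).mul_left
    ((k.factorial : ℂ)⁻¹)
  refine this.congr_fun fun q => ?_
  simp only [e, Function.comp_apply, Equiv.prodCongr_apply, Prod.map, Equiv.subRight_apply,
    Equiv.refl_apply]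
  rw [neg_eq_neg_one_mul z, mul_zpow, zpow_sub₀ hz, zpow_natCast]
  field_simp

end Binomial

/-! ## Coefficients of skew-symmetry opposite vertex operators -/

section Coefficients

variable {A B P M : Type*}
  [AddCommGroup A] [Module ℂ A] [AddCommGroup B] [Module ℂ B]
  [AddCommGroup P] [Module ℂ P] [AddCommGroup M] [Module ℂ M]

namespace BiSeries

/-- The formal derivative as a linear map. -/
def derivLinear (M : Type*) [AddCommGroup M] [Module ℂ M] : Module.End ℂ (BiSeries M) where
  toFun := deriv
  map_add' f g := by funext i; simp [deriv]
  map_smul' c f := by funext i; simp [deriv, smul_comm c]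

/-- Application of a linear map to the coefficients, as a linear map. -/
def mapLinear (T : M →ₗ[ℂ] M) : Module.End ℂ (BiSeries M) where
  toFun := map T
  map_add' f g := by funext i; simp [map]
  map_smul' c f := by funext i; simp [map]

theorem derivLinear_pow (k : ℕ) (f : BiSeries M) (i : ℤ) :
    (derivLinear M ^ k) f i = ((k.factorial : ℂ) * intChoose (i + k) k) • f (i + k) := by
  induction k generalizing i with
  | zero => simp [intChoose_zero]
  | succ k ih =>
    rw [pow_succ', Module.End.mul_apply]
    change ((i : ℂ) + 1) • (derivLinear M ^ k) f (i + 1) = _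
    rw [ih, smul_smul, show i + 1 + (k : ℤ) = i + (k + 1 : ℕ) by push_cast; ring]
    congr 1
    have := intChoose_succ (i + (k + 1 : ℕ)) k
    rw [Nat.factorial_succ]
    push_cast at this ⊢
    linear_combination (-(k.factorial : ℂ)) * this

theorem mapLinear_pow (T : M →ₗ[ℂ] M) (k : ℕ) (f : BiSeries M) (i : ℤ) :
    (mapLinear T ^ k) f i = (T ^ k) (f i) := by
  induction k generalizing i with
  | zero => simp
  | succ k ih =>
    rw [pow_succ', pow_succ', Module.End.mul_apply, Module.End.mul_apply, ← ih]
    rfl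

theorem commute_mapLinear_derivLinear (T : M →ₗ[ℂ] M) :
    Commute (mapLinear T) (derivLinear M) := by
  refine LinearMap.ext fun f => funext fun i => ?_
  exact map_smul T _ _

/-- The coefficients of `e^{xD} f(-x)` under a linear functional. -/
theorem apply_exp_subNeg (D : M →ₗ[ℂ] M) {f : BiSeries M} (hf : LowerTruncated f)
    (φ : Module.Dual ℂ M) (i : ℤ) :
    φ (exp D (subNeg f) i) = ∑ᶠ k : ℕ, ((k.factorial : ℂ)⁻¹) *
      ((-1) ^ (i - k) * φ ((D ^ k) (f (i - k)))) := by
  have := AddMonoidHom.map_finsum φ.toAddMonoidHom (exp_support_finite D hf.subNeg i)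
  refine Eq.trans this (finsum_congr fun k => ?_)
  simp [subNeg]

end BiSeries

/-- Under `m'` the exponential stops at `K`, so the skewed operator is a finite combination of
ordinary ones paired with the functionals `m' ∘ D^k`. -/
theorem dual_apply_skew_of_nilpotent {Y : VertexMap A B M} (hY : Y.Truncated) {D : M →ₗ[ℂ] M}
    {m' : Module.Dual ℂ M} {K : ℕ} (hK : m' ∘ₗ D ^ K = 0) (a : A) (b : B) (i : ℤ) :
    m' (VertexMap.skew D Y hY b a i) = ∑ k ∈ Finset.range K, ((k.factorial : ℂ)⁻¹) *
      ((-1) ^ (i - k) * (m' ∘ₗ D ^ k) (Y a b (i - k))) := by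
  refine (BiSeries.apply_exp_subNeg D (hY a b) m' i).trans ?_
  refine finsum_eq_sum_of_support_subset _ fun k hk => ?_
  by_contra hkK
  apply hk
  have hle : K ≤ k := by simpa using hkK
  have : m' ((D ^ k) (Y a b (i - k))) = 0 := by
    rw [← Nat.add_sub_cancel' hle, pow_add]
    exact LinearMap.congr_fun hK _
  simp [this]

theorem vertexMap_D_pow {Y : VertexMap A P M} {DA : A →ₗ[ℂ] A}
    (h : ∀ a p, BiSeries.deriv (Y a p) = Y (DA a) p) (k : ℕ) (a : A) (p : P) :
    Y ((DA ^ k) a) p = (BiSeries.derivLinear M ^ k) (Y a p) := by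
  induction k with
  | zero => simp
  | succ k ih =>
    rw [pow_succ', pow_succ', Module.End.mul_apply, Module.End.mul_apply, ← ih]
    exact (h _ _).symm

/-- The commutator axiom reads `Y(a, x) D_P = (D - d/dx) Y(a, x)`. The two operators on the right
commute, so the powers expand binomially. -/
theorem vertexMap_apply_D_pow {Y : VertexMap A P M} {DP : P →ₗ[ℂ] P} {D : M →ₗ[ℂ] M}
    (h : ∀ a p, BiSeries.deriv (Y a p) = BiSeries.map D (Y a p) - Y a (DP p))
    (k : ℕ) (a : A) (p : P) :
    Y a ((DP ^ k) p) =
      ((BiSeries.mapLinear D + (-1 : ℂ) • BiSeries.derivLinear M) ^ k : Module.End ℂ (BiSeries M))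
        (Y a p) := by
  induction k with
  | zero => simp
  | succ k ih =>
    rw [pow_succ', pow_succ', Module.End.mul_apply, Module.End.mul_apply, ← ih]
    have := h a ((DP ^ k) p)
    change _ = BiSeries.map D _ + (-1 : ℂ) • BiSeries.deriv _
    rw [this]
    module

theorem vertexMap_apply_D_pow_coeff {Y : VertexMap A P M} {DP : P →ₗ[ℂ] P} {D : M →ₗ[ℂ] M}
    (h : ∀ a p, BiSeries.deriv (Y a p) = BiSeries.map D (Y a p) - Y a (DP p))
    (k : ℕ) (a : A) (p : P) (i : ℤ) :
    ((k.factorial : ℂ)⁻¹) • Y a ((DP ^ k) p) i = ∑ q ∈ Finset.HasAntidiagonal.antidiagonal k,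
      ((q.1.factorial : ℂ)⁻¹ * ((-1) ^ q.2 * intChoose (i + q.2) q.2)) •
        (D ^ q.1) (Y a p (i + q.2)) := by
  rw [vertexMap_apply_D_pow h,
    ((BiSeries.commute_mapLinear_derivLinear D).smul_right (-1 : ℂ)).add_pow', LinearMap.sum_apply,
    Finset.sum_apply, Finset.smul_sum]
  refine Finset.sum_congr rfl fun q hq => ?_
  have hq' : q.1 + q.2 = k := Finset.HasAntidiagonal.mem_antidiagonal.mp hq
  have h1 : (k.factorial : ℂ) ≠ 0 := by exact_mod_cast k.factorial_ne_zero
  have h2 : (k.choose q.1 : ℂ) * q.1.factorial * q.2.factorial = k.factorial := by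
    rw [← hq']
    rw [Nat.choose_symm_add]
    exact_mod_cast Nat.add_choose_mul_factorial_mul_factorial q.1 q.2
  have h3 : (q.1.factorial : ℂ) ≠ 0 := by exact_mod_cast q.1.factorial_ne_zero
  rw [smul_pow, LinearMap.smul_apply, Module.End.mul_apply, Pi.smul_apply,
    BiSeries.mapLinear_pow, LinearMap.smul_apply, Pi.smul_apply, BiSeries.derivLinear_pow,
    map_smul, map_smul, smul_smul,
    ← Nat.cast_smul_eq_nsmul ℂ, smul_smul, smul_smul]
  congr 1
  field_simp
  rw [← h2]
  ring

/-- This is the coefficient form of `Y₁(e^{yD_A} Y₄(a, -y) b, x) = Y₁(Y₄(a, -y) b, x + y)`: powers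
of `D_A` become derivatives in `x`, whose Taylor series is the binomial shift. -/
theorem dual_vertexMap_skew_left {Y₁ : VertexMap A P M} {Y₄ : VertexMap A B A}
    (hY₄ : Y₄.Truncated) {DA : A →ₗ[ℂ] A}
    (h : ∀ a p, BiSeries.deriv (Y₁ a p) = Y₁ (DA a) p) (m' : Module.Dual ℂ M) (a : A) (b : B)
    (p : P) (e : ℤ × ℤ) :
    m' (Y₁ (VertexMap.skew DA Y₄ hY₄ b a e.2) p e.1) =
      shiftCoeff (fun k => (-1) ^ k.2 * m' (Y₁ (Y₄ a b k.2) p k.1)) e := by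
  refine (BiSeries.apply_exp_subNeg DA (hY₄ a b)
    (m' ∘ₗ LinearMap.proj e.1 ∘ₗ Y₁.flip p) e.2).trans (finsum_congr fun k => ?_)
  have h1 : (k.factorial : ℂ) ≠ 0 := by exact_mod_cast k.factorial_ne_zero
  simp only [LinearMap.comp_apply, LinearMap.proj_apply, LinearMap.flip_apply]
  rw [vertexMap_D_pow h, BiSeries.derivLinear_pow, map_smul, smul_eq_mul]
  field_simp

theorem finsum_sum_antidiagonal {g : ℕ × ℕ → ℂ} (hg : (Function.support g).Finite) :
    ∑ᶠ k, ∑ q ∈ Finset.HasAntidiagonal.antidiagonal k, g q = ∑ᶠ i, ∑ᶠ j, g (i, j) := by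
  rw [← finsum_curry g hg]
  have hs : HasSum g (∑ᶠ q, g q) := by
    rw [finsum_eq_sum g hg]
    exact hasSum_sum_of_ne_finset_zero fun k hk => by simpa [-mul_eq_zero] using hk
  have h1 := (Finset.HasAntidiagonal.sigmaAntidiagonalEquivProd (A := ℕ)).hasSum_iff.mpr hs
  have h2 := h1.sigma fun k => by
    simpa using hasSum_fintype (fun q : Finset.HasAntidiagonal.antidiagonal k => g q)
  have hfin : (Function.support fun k => ∑ q ∈ Finset.HasAntidiagonal.antidiagonal k, g q).Finite := by
    refine (hg.image fun q => q.1 + q.2).subset fun k hk => ?_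
    obtain ⟨q, hq, hq0⟩ := Finset.exists_ne_zero_of_sum_ne_zero hk
    exact ⟨q, hq0, Finset.HasAntidiagonal.mem_antidiagonal.mp hq⟩
  have h3 : HasSum (fun k => ∑ q ∈ Finset.HasAntidiagonal.antidiagonal k, g q)
      (∑ᶠ k, ∑ q ∈ Finset.HasAntidiagonal.antidiagonal k, g q) := by
    rw [finsum_eq_sum _ hfin]
    exact hasSum_sum_of_ne_finset_zero fun k hk => by simpa [-mul_eq_zero] using hk
  refine h3.unique (h2.congr_fun fun k => ?_)
  exact (Finset.sum_coe_sort (Finset.HasAntidiagonal.antidiagonal k) g).symm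

/-- This is the coefficient form of `Y₁(a, x) e^{yD_P} Y₂(b, -y) p = e^{yD} Y₁(a, x - y) Y₂(b, -y)
p`, with `e^{yD}` cut off by `m'`. -/
theorem dual_vertexMap_skew_right {Y₁ : VertexMap A P M} {Y₂ : VertexMap B P P}
    (hY₂ : Y₂.Truncated) {DP : P →ₗ[ℂ] P} {D : M →ₗ[ℂ] M}
    (h : ∀ a p, BiSeries.deriv (Y₁ a p) = BiSeries.map D (Y₁ a p) - Y₁ a (DP p))
    {m' : Module.Dual ℂ M} {K : ℕ} (hK : m' ∘ₗ D ^ K = 0) (a : A) (b : B) (p : P) (i j : ℤ) :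
    m' (Y₁ a (VertexMap.skew DP Y₂ hY₂ p b j) i) =
      ∑ k ∈ Finset.range K, ((k.factorial : ℂ)⁻¹) * ((-1) ^ (j - k) *
        shiftCoeff (fun q => (m' ∘ₗ D ^ k) (Y₁ a (Y₂ b p q.2) q.1)) (i, j - k)) := by
  obtain ⟨N, hN⟩ := hY₂ b p
  have hnil : ∀ k, K ≤ k → ∀ m, m' ((D ^ k) m) = 0 := fun k hk m => by
    rw [← Nat.add_sub_cancel' hk, pow_add]
    exact LinearMap.congr_fun hK _
  -- `q.1` counts the powers of `D` and `q.2` the derivatives in `x`. The former are bounded by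
  -- nilpotency and the latter by lower truncation.
  let g : ℕ × ℕ → ℂ := fun q => ((q.1.factorial : ℂ)⁻¹) * ((-1) ^ (j - q.1) *
    (intChoose (i + q.2) q.2 *
      (m' ∘ₗ D ^ q.1) (Y₁ a (Y₂ b p (j - q.1 - q.2)) (i + q.2))))
  have hg : (Function.support g).Finite := by
    refine ((Set.finite_Iio K).prod (Set.finite_Iic (j - N).toNat)).subset fun q hq => ?_
    simp only [Set.mem_prod, Set.mem_Iio, Set.mem_Iic]
    by_contra hcon
    apply hq
    rcases le_or_gt K q.1 with h1 | h1
    · simp [g, hnil q.1 h1]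
    · have : Y₂ b p (j - q.1 - q.2) = 0 := hN _ (by
        have : ¬ q.2 ≤ (j - N).toNat := fun h2 => hcon ⟨h1, h2⟩
        omega)
      simp [g, this]
  refine (BiSeries.apply_exp_subNeg DP ⟨N, hN⟩ (m' ∘ₗ LinearMap.proj i ∘ₗ Y₁ a) j).trans ?_
  have h1 : ∀ k : ℕ, ((k.factorial : ℂ)⁻¹) * ((-1) ^ (j - k) *
      (m' ∘ₗ LinearMap.proj i ∘ₗ Y₁ a) ((DP ^ k) (Y₂ b p (j - k)))) =
      ∑ q ∈ Finset.HasAntidiagonal.antidiagonal k, g q := by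
    intro k
    have := congrArg m' (vertexMap_apply_D_pow_coeff h k a (Y₂ b p (j - k)) i)
    rw [map_smul, map_sum, smul_eq_mul] at this
    rw [mul_left_comm]
    change _ * (_ * m' (Y₁ a ((DP ^ k) (Y₂ b p (j - k))) i)) = _
    rw [this, Finset.mul_sum]
    refine Finset.sum_congr rfl fun q hq => ?_
    have hq' : (k : ℤ) = q.1 + q.2 := by
      rw [← Finset.HasAntidiagonal.mem_antidiagonal.mp hq]; push_cast; ring
    have hs : ((-1 : ℂ) ^ (j - k)) * (-1) ^ q.2 = (-1) ^ (j - q.1) := by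
      rw [← zpow_natCast, ← zpow_add₀ (by norm_num), hq']
      congr 1
      ring
    simp only [g, ← hs, map_smul, smul_eq_mul, LinearMap.comp_apply, hq', sub_sub]
    ring
  rw [finsum_congr h1, finsum_sum_antidiagonal hg]
  rw [finsum_eq_sum_of_support_subset (s := Finset.range K)]
  · refine Finset.sum_congr rfl fun k _ => ?_
    rw [shiftCoeff, mul_finsum, mul_finsum]
  · intro k hk
    by_contra hkK
    apply hk
    have hle : K ≤ k := by simpa using hkK
    simp [g, hnil k hle]

end Coefficients

/-! ## Correlation functions of nested opposite vertex operators -/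

section NestedRegion

variable {m k : ℕ}

/-- The points `(x, y, t)` with `|x| > |y_0| > ⋯ > 0`, `|x| > |t_0| > ⋯ > 0` and
`|x| > |y_i| + |t_j|`. -/
def nestedRegion (m k : ℕ) : Set (ℂ × (Fin m → ℂ) × (Fin k → ℂ)) :=
  {z | (z.1 ≠ 0 ∧ (∀ i, z.2.1 i ≠ 0) ∧ ∀ j, z.2.2 j ≠ 0) ∧
    StrictAnti (fun i => ‖z.2.1 i‖) ∧ StrictAnti (fun j => ‖z.2.2 j‖) ∧
    (∀ i, ‖z.2.1 i‖ < ‖z.1‖) ∧ (∀ j, ‖z.2.2 j‖ < ‖z.1‖) ∧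
    ∀ i j, ‖z.2.1 i‖ + ‖z.2.2 j‖ < ‖z.1‖}

/-- The monomials in `(x, y, t)`. -/
noncomputable def nestedMonomial (z : ℂ × (Fin m → ℂ) × (Fin k → ℂ))
    (q : ℤ × (Fin m → ℤ) × (Fin k → ℤ)) : ℂ :=
  z.1 ^ q.1 * ((∏ i, z.2.1 i ^ q.2.1 i) * ∏ j, z.2.2 j ^ q.2.2 j)

/-- The points `x`, `x + y_i`, `t_j`. -/
def nestedPoint (z : ℂ × (Fin m → ℂ) × (Fin k → ℂ)) : Option (Fin m ⊕ Fin k) → ℂ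
  | none => z.1
  | some (Sum.inl i) => z.1 + z.2.1 i
  | some (Sum.inr j) => z.2.2 j

theorem isMonomialSystem_nestedMonomial :
    IsMonomialSystem (nestedRegion m k) (nestedMonomial (m := m) (k := k)) where
  zero z _ := by simp [nestedMonomial]
  add z hz q q' := by
    obtain ⟨⟨h1, h2, h3⟩, -⟩ := hz
    simp only [nestedMonomial, Prod.fst_add, Prod.snd_add, Pi.add_apply, zpow_add₀ h1,
      zpow_add₀ (h2 _), zpow_add₀ (h3 _), Finset.prod_mul_distrib]
    ring

theorem LaurentExpandable.inv_of_dominant {E K : Type*} [AddCommGroup K] {Ω : Set E}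
    {χ : E → K → ℂ} (h : IsMonomialSystem Ω χ) {F : E → ℂ} (a b d : K) (r s t : ℂ) (hr : r ≠ 0)
    (hF : ∀ z ∈ Ω, F z = r * χ z a + s * χ z b + t * χ z d)
    (hdom : ∀ z ∈ Ω, ‖s * χ z b‖ + ‖t * χ z d‖ < ‖r * χ z a‖) :
    (∀ z ∈ Ω, F z ≠ 0) ∧ LaurentExpandable Ω χ fun z => (F z)⁻¹ := by
  refine ⟨fun z hz h0 => ?_, (LaurentExpandable.inv h a b d r s t hr hdom).congr fun z hz => by
    rw [hF z hz]⟩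
  have h1 := hdom z hz
  have h2 : r * χ z a = -(s * χ z b + t * χ z d) := by
    rw [← sub_eq_zero, ← h0, hF z hz]; ring
  rw [h2, norm_neg] at h1
  exact (norm_add_le _ _).not_gt h1

theorem nestedMonomial_x (z : ℂ × (Fin m → ℂ) × (Fin k → ℂ)) :
    nestedMonomial z (1, 0, 0) = z.1 := by simp [nestedMonomial]

theorem prod_zpow_single {n : ℕ} (y : Fin n → ℂ) (i : Fin n) :
    ∏ j, y j ^ (Pi.single i 1 : Fin n → ℤ) j = y i := by
  rw [Finset.prod_eq_single i]
  · simp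
  · intro j _ hj; simp [hj]
  · simp

theorem nestedMonomial_y (z : ℂ × (Fin m → ℂ) × (Fin k → ℂ)) (i : Fin m) :
    nestedMonomial z (0, Pi.single i 1, 0) = z.2.1 i := by
  simp [nestedMonomial, prod_zpow_single]

theorem nestedMonomial_t (z : ℂ × (Fin m → ℂ) × (Fin k → ℂ)) (j : Fin k) :
    nestedMonomial z (0, 0, Pi.single j 1) = z.2.2 j := by
  simp [nestedMonomial, prod_zpow_single]

/-- Each difference of points has a monomial that dominates the others on the region. The only
three-term case is `x + y_i - t_j`, for which the region requires `|y_i| + |t_j| < |x|`. -/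
theorem nestedPoint_sub_expandable (a b : Option (Fin m ⊕ Fin k)) (hab : a ≠ b) :
    (∀ z ∈ nestedRegion m k, nestedPoint z a - nestedPoint z b ≠ 0) ∧
    LaurentExpandable (nestedRegion m k) nestedMonomial
      fun z => (nestedPoint z a - nestedPoint z b)⁻¹ := by
  have H := @LaurentExpandable.inv_of_dominant _ _ _ _ _
    (isMonomialSystem_nestedMonomial (m := m) (k := k))
  rcases a with _ | i | j <;> rcases b with _ | i' | j'
  · exact absurd rfl hab
  · refine H (0, Pi.single i' 1, 0) 0 0 (-1) 0 0 (by simp) (fun z hz => ?_) fun z hz => ?_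
    · simp [nestedPoint, nestedMonomial_y]
    · simpa [nestedMonomial_y] using hz.1.2.1 i'
  · refine H (1, 0, 0) (0, 0, Pi.single j' 1) 0 1 (-1) 0 (by simp) (fun z hz => ?_)
      fun z hz => ?_
    · simp [nestedPoint, nestedMonomial_x, nestedMonomial_t]; ring
    · simpa [nestedMonomial_x, nestedMonomial_t] using hz.2.2.2.2.1 j'
  · refine H (0, Pi.single i 1, 0) 0 0 1 0 0 (by simp) (fun z hz => ?_) fun z hz => ?_
    · simp [nestedPoint, nestedMonomial_y]
    · simpa [nestedMonomial_y] using hz.1.2.1 i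
  · have hne : i ≠ i' := fun h => hab (by rw [h])
    rcases lt_or_gt_of_ne hne with hlt | hlt
    · refine H (0, Pi.single i 1, 0) (0, Pi.single i' 1, 0) 0 1 (-1) 0 (by simp)
        (fun z hz => ?_) fun z hz => ?_
      · simp [nestedPoint, nestedMonomial_y]; ring
      · simpa [nestedMonomial_y] using hz.2.1 hlt
    · refine H (0, Pi.single i' 1, 0) (0, Pi.single i 1, 0) 0 (-1) 1 0 (by simp)
        (fun z hz => ?_) fun z hz => ?_
      · simp [nestedPoint, nestedMonomial_y]; ring
      · simpa [nestedMonomial_y] using hz.2.1 hlt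
  · refine H (1, 0, 0) (0, Pi.single i 1, 0) (0, 0, Pi.single j' 1) 1 1 (-1) (by simp)
      (fun z hz => ?_) fun z hz => ?_
    · simp [nestedPoint, nestedMonomial_x, nestedMonomial_y, nestedMonomial_t]; ring
    · simpa [nestedMonomial_x, nestedMonomial_y, nestedMonomial_t] using hz.2.2.2.2.2 i j'
  · refine H (1, 0, 0) (0, 0, Pi.single j 1) 0 (-1) 1 0 (by simp) (fun z hz => ?_)
      fun z hz => ?_
    · simp [nestedPoint, nestedMonomial_x, nestedMonomial_t]; ring
    · simpa [nestedMonomial_x, nestedMonomial_t] using hz.2.2.2.2.1 j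
  · refine H (1, 0, 0) (0, Pi.single i' 1, 0) (0, 0, Pi.single j 1) (-1) (-1) 1 (by simp)
      (fun z hz => ?_) fun z hz => ?_
    · simp [nestedPoint, nestedMonomial_x, nestedMonomial_y, nestedMonomial_t]; ring
    · simpa [nestedMonomial_x, nestedMonomial_y, nestedMonomial_t] using hz.2.2.2.2.2 i' j
  · have hne : j ≠ j' := fun h => hab (by rw [h])
    rcases lt_or_gt_of_ne hne with hlt | hlt
    · refine H (0, 0, Pi.single j 1) (0, 0, Pi.single j' 1) 0 1 (-1) 0 (by simp)
        (fun z hz => ?_) fun z hz => ?_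
      · simp [nestedPoint, nestedMonomial_t]; ring
      · simpa [nestedMonomial_t] using hz.2.2.1 hlt
    · refine H (0, 0, Pi.single j' 1) (0, 0, Pi.single j 1) 0 (-1) 1 0 (by simp)
        (fun z hz => ?_) fun z hz => ?_
      · simp [nestedPoint, nestedMonomial_t]; ring
      · simpa [nestedMonomial_t] using hz.2.2.1 hlt

theorem nestedPoint_inv_expandable (a : Option (Fin m ⊕ Fin k)) :
    (∀ z ∈ nestedRegion m k, nestedPoint z a ≠ 0) ∧
    LaurentExpandable (nestedRegion m k) nestedMonomial fun z => (nestedPoint z a)⁻¹ := by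
  have H := @LaurentExpandable.inv_of_dominant _ _ _ _ _
    (isMonomialSystem_nestedMonomial (m := m) (k := k))
  rcases a with _ | i | j
  · refine H (1, 0, 0) 0 0 1 0 0 (by simp) (fun z hz => ?_) fun z hz => ?_
    · simp [nestedPoint, nestedMonomial_x]
    · simpa [nestedMonomial_x] using hz.1.1
  · refine H (1, 0, 0) (0, Pi.single i 1, 0) 0 1 1 0 (by simp) (fun z hz => ?_) fun z hz => ?_
    · simp [nestedPoint, nestedMonomial_x, nestedMonomial_y]
    · simpa [nestedMonomial_x, nestedMonomial_y] using hz.2.2.2.1 i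
  · refine H (0, 0, Pi.single j 1) 0 0 1 0 0 (by simp) (fun z hz => ?_) fun z hz => ?_
    · simp [nestedPoint, nestedMonomial_t]
    · simpa [nestedMonomial_t] using hz.1.2.2 j

theorem nestedPoint_expandable (a : Option (Fin m ⊕ Fin k)) :
    LaurentExpandable (nestedRegion m k) nestedMonomial fun z => nestedPoint z a := by
  rcases a with _ | i | j
  · exact (LaurentExpandable.monomial 1 (1, 0, 0)).congr fun z _ => by
      simp [nestedPoint, nestedMonomial_x]
  · exact ((LaurentExpandable.monomial 1 (1, 0, 0)).add
      (LaurentExpandable.monomial 1 (0, Pi.single i 1, 0))).congr fun z _ => by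
        simp [nestedPoint, nestedMonomial_x, nestedMonomial_y]
  · exact (LaurentExpandable.monomial 1 (0, 0, Pi.single j 1)).congr fun z _ => by
      simp [nestedPoint, nestedMonomial_t]

theorem IsDiagonalRational.exists_nested_coeff {f : (Option (Fin m ⊕ Fin k) → ℂ) → ℂ}
    (hf : IsDiagonalRational f) : ∃ T : ℤ × (Fin m → ℤ) × (Fin k → ℤ) → ℂ,
      ∀ z ∈ nestedRegion m k, HasSum (fun q => T q * nestedMonomial z q) (f (nestedPoint z)) := by
  refine LaurentExpandable.exists_coeff isMonomialSystem_nestedMonomial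
    (hf.laurentExpandable isMonomialSystem_nestedMonomial nestedPoint ?_ ?_ nestedPoint_expandable
      (fun a => (nestedPoint_inv_expandable a).2)
      (fun a b hab => (nestedPoint_sub_expandable a b hab).2))
  · exact fun z hz a => (nestedPoint_inv_expandable a).1 z hz
  · intro z hz a b hab
    by_contra hne
    exact (nestedPoint_sub_expandable a b hne).1 z hz (sub_eq_zero.mpr hab)

/-- Separation of the exponents of `x` and `y_0` from the others. -/
def nestedEquivY (m k : ℕ) :
    (Fin m ⊕ Fin k → ℤ) × (ℤ × ℤ) ≃ ℤ × (Fin (m + 1) → ℤ) × (Fin k → ℤ) where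
  toFun q := (q.2.1, Fin.cons q.2.2 (q.1 ∘ Sum.inl), q.1 ∘ Sum.inr)
  invFun q := (Sum.elim (Fin.tail q.2.1) q.2.2, (q.1, q.2.1 0))
  left_inv q := by simp
  right_inv q := by simp

/-- Separation of the exponents of `x` and `t_0` from the others. -/
def nestedEquivT (m k : ℕ) :
    (Fin m ⊕ Fin k → ℤ) × (ℤ × ℤ) ≃ ℤ × (Fin m → ℤ) × (Fin (k + 1) → ℤ) where
  toFun q := (q.2.1, q.1 ∘ Sum.inl, Fin.cons q.2.2 (q.1 ∘ Sum.inr))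
  invFun q := (Sum.elim q.2.1 (Fin.tail q.2.2), (q.1, q.2.2 0))
  left_inv q := by simp
  right_inv q := by simp

theorem nestedMonomial_equivY (x y : ℂ) (o : Fin m ⊕ Fin k → ℂ)
    (q : (Fin m ⊕ Fin k → ℤ) × (ℤ × ℤ)) :
    nestedMonomial (x, (Fin.cons y (o ∘ Sum.inl) : Fin (m + 1) → ℂ), o ∘ Sum.inr)
      (nestedEquivY m k q) = x ^ q.2.1 * y ^ q.2.2 * ∏ i, o i ^ q.1 i := by
  simp [nestedMonomial, nestedEquivY, Fin.prod_univ_succ, Fintype.prod_sum_type]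
  ring

theorem nestedMonomial_equivT (x t : ℂ) (o : Fin m ⊕ Fin k → ℂ)
    (q : (Fin m ⊕ Fin k → ℤ) × (ℤ × ℤ)) :
    nestedMonomial (x, o ∘ Sum.inl, (Fin.cons t (o ∘ Sum.inr) : Fin (k + 1) → ℂ))
      (nestedEquivT m k q) = x ^ q.2.1 * t ^ q.2.2 * ∏ i, o i ^ q.1 i := by
  simp [nestedMonomial, nestedEquivT, Fin.prod_univ_succ, Fintype.prod_sum_type]
  ring

theorem strictAnti_cons {n : ℕ} {a : ℝ} {v : Fin n → ℝ} (hv : StrictAnti v) (ha : ∀ i, v i < a) :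
    StrictAnti (Fin.cons a v : Fin (n + 1) → ℝ) := by
  intro i j hij
  rcases Fin.eq_zero_or_eq_succ j with rfl | ⟨j, rfl⟩
  · exact absurd hij (Fin.not_lt_zero i)
  · rcases Fin.eq_zero_or_eq_succ i with rfl | ⟨i, rfl⟩
    · simpa using ha j
    · simpa using hv (Fin.succ_lt_succ_iff.mp hij)

/-- Radii of the remaining variables that lie in both nested regions. -/
theorem exists_nested_radii (m k : ℕ) {x y : ℂ} (hxy : 2 * ‖y‖ < ‖x‖) (hy : 0 < ‖y‖) :
    ∃ r : Fin m ⊕ Fin k → ℝ, (∀ i, 0 < r i) ∧ ∀ o : Fin m ⊕ Fin k → ℂ, (∀ i, ‖o i‖ = r i) →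
      (x, (Fin.cons y (o ∘ Sum.inl) : Fin (m + 1) → ℂ), o ∘ Sum.inr) ∈ nestedRegion (m + 1) k ∧
      (‖x + y‖ < ‖x‖ →
        (x, o ∘ Sum.inl, (Fin.cons (x + y) (o ∘ Sum.inr) : Fin (k + 1) → ℂ)) ∈
          nestedRegion m (k + 1)) := by
  -- All remaining variables are taken of size at most `ε`, with radii `ε / (i + 1)`. Then `ε < |y|`
  -- orders them below `y` and `x + y`, and `ε < |x| - |x + y|` gives `|y_i| + |x + y| < |x|`.
  obtain ⟨ε, hε, hεy, hεx⟩ : ∃ ε : ℝ, 0 < ε ∧ ε < ‖y‖ ∧ (‖x + y‖ < ‖x‖ → ε < ‖x‖ - ‖x + y‖) := by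
    by_cases h : ‖x + y‖ < ‖x‖
    · have h1 : 0 < min ‖y‖ (‖x‖ - ‖x + y‖) := lt_min hy (by linarith)
      refine ⟨min ‖y‖ (‖x‖ - ‖x + y‖) / 2, by positivity, ?_, fun _ => ?_⟩
      · linarith [min_le_left ‖y‖ (‖x‖ - ‖x + y‖)]
      · linarith [min_le_right ‖y‖ (‖x‖ - ‖x + y‖)]
    · exact ⟨‖y‖ / 2, by positivity, by linarith, fun h' => absurd h' h⟩
  have hanti : ∀ n : ℕ, StrictAnti fun i : Fin n => ε / ((i : ℝ) + 1) := fun n i j hij => by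
    have : (i : ℝ) < j := by exact_mod_cast hij
    exact div_lt_div_of_pos_left hε (by positivity) (by linarith)
  have hle : ∀ n : ℕ, ∀ i : Fin n, ε / ((i : ℝ) + 1) ≤ ε := fun n i =>
    div_le_self hε.le (by linarith [Nat.cast_nonneg (α := ℝ) i])
  have hpos : ∀ n : ℕ, ∀ i : Fin n, 0 < ε / ((i : ℝ) + 1) := fun n i => by positivity
  have hxynorm : ‖x‖ - ‖y‖ ≤ ‖x + y‖ := by
    have := norm_sub_norm_le x (-y)
    rwa [norm_neg, sub_neg_eq_add] at this
  refine ⟨Sum.elim (fun i => ε / ((i : ℝ) + 1)) fun i => ε / ((i : ℝ) + 1), ?_, fun o ho => ?_⟩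
  · rintro (i | i)
    · exact hpos m i
    · exact hpos k i
  have hl : ∀ i : Fin m, ‖o (Sum.inl i)‖ = ε / ((i : ℝ) + 1) := fun i => ho _
  have hr : ∀ i : Fin k, ‖o (Sum.inr i)‖ = ε / ((i : ℝ) + 1) := fun i => ho _
  have hl0 : ∀ i : Fin m, o (Sum.inl i) ≠ 0 := fun i => norm_pos_iff.mp (hl i ▸ hpos m i)
  have hr0 : ∀ i : Fin k, o (Sum.inr i) ≠ 0 := fun i => norm_pos_iff.mp (hr i ▸ hpos k i)
  have hl1 : ∀ i : Fin m, ‖o (Sum.inl i)‖ ≤ ε := fun i => hl i ▸ hle m i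
  have hr1 : ∀ i : Fin k, ‖o (Sum.inr i)‖ ≤ ε := fun i => hr i ▸ hle k i
  have hla : StrictAnti fun i : Fin m => ‖o (Sum.inl i)‖ := by simpa only [hl] using hanti m
  have hra : StrictAnti fun i : Fin k => ‖o (Sum.inr i)‖ := by simpa only [hr] using hanti k
  have hx0 : x ≠ 0 := norm_pos_iff.mp (by linarith)
  have hcons : ∀ (n : ℕ) (w : ℂ) (v : Fin n → ℂ), (fun i => ‖(Fin.cons w v : Fin (n + 1) → ℂ) i‖) =
      (Fin.cons ‖w‖ fun i => ‖v i‖ : Fin (n + 1) → ℝ) := fun n w v => by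
    funext i
    refine Fin.cases ?_ (fun i => ?_) i <;> simp
  refine ⟨⟨⟨hx0, ?_, hr0⟩, ?_, hra, ?_, ?_, ?_⟩, fun h => ⟨⟨hx0, hl0, ?_⟩, hla, ?_, ?_, ?_, ?_⟩⟩
  · exact Fin.cases (by simpa using hy) (by simpa using hl0)
  · simp only [hcons]
    exact strictAnti_cons hla fun i => (hl1 i).trans_lt hεy
  · refine Fin.cases ?_ fun i => ?_
    · simp only [Fin.cons_zero]; linarith
    · simp only [Fin.cons_succ, Function.comp_apply]; linarith [hl1 i]
  · intro j
    simp only [Function.comp_apply]; linarith [hr1 j]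
  · refine Fin.cases (fun j => ?_) fun i j => ?_
    · simp only [Fin.cons_zero, Function.comp_apply]; linarith [hr1 j]
    · simp only [Fin.cons_succ, Function.comp_apply]; linarith [hl1 i, hr1 j]
  · refine Fin.cases ?_ (by simpa using hr0)
    simp only [Fin.cons_zero]
    exact norm_pos_iff.mp (by linarith)
  · simp only [hcons]
    exact strictAnti_cons hra fun i => (hr1 i).trans_lt (by linarith)
  · intro i
    simp only [Function.comp_apply]; linarith [hl1 i]
  · refine Fin.cases ?_ fun j => ?_
    · simpa only [Fin.cons_zero] using h
    · simp only [Fin.cons_succ, Function.comp_apply]; linarith [hr1 j]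
  · intro i
    refine Fin.cases ?_ fun j => ?_
    · simp only [Fin.cons_zero, Function.comp_apply]; linarith [hl1 i, hεx h]
    · simp only [Fin.cons_succ, Function.comp_apply]; linarith [hl1 i, hr1 j]

end NestedRegion

/-! ## Skew-symmetry opposites of associative vertex operator maps -/

section VertexSystem

variable {ι A B P M : Type*}
  [AddCommGroup A] [Module ℂ A] [AddCommGroup B] [Module ℂ B]
  [AddCommGroup P] [Module ℂ P] [AddCommGroup M] [Module ℂ M]

/-- Vertex operator maps with rational products `Y₁(a, x) Y₂(b, y) p` and iterates
`Y₁(Y₄(a, x) b, y) p` that agree, together with compatible derivations. -/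
structure IsVertexSystem (gr : ι → Submodule ℂ M) (Y₁ : VertexMap A P M) (Y₂ : VertexMap B P P)
    (Y₄ : VertexMap A B A) (DA : A →ₗ[ℂ] A) (DP : P →ₗ[ℂ] P) (D : M →ₗ[ℂ] M) : Prop where
  truncated₁ : Y₁.Truncated
  truncated₂ : Y₂.Truncated
  truncated₄ : Y₄.Truncated
  D_derivative : ∀ a p, BiSeries.deriv (Y₁ a p) = Y₁ (DA a) p
  D_commutator : ∀ a p, BiSeries.deriv (Y₁ a p) = BiSeries.map D (Y₁ a p) - Y₁ a (DP p)
  dual_pow : ∀ m' ∈ gradedDual gr, ∀ k, m' ∘ₗ D ^ k ∈ gradedDual gr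
  dual_nilpotent : ∀ m' ∈ gradedDual gr, ∃ K, m' ∘ₗ D ^ K = 0
  products_rational : ProductsRational gr Y₁ Y₂
  iterates_rational : IteratesRational gr Y₁ Y₄
  associativity : VertexAssociativity gr Y₁ Y₂ Y₁ Y₄

namespace IsVertexSystem

variable {gr : ι → Submodule ℂ M} {Y₁ : VertexMap A P M} {Y₂ : VertexMap B P P}
  {Y₄ : VertexMap A B A} {DA : A →ₗ[ℂ] A} {DP : P →ₗ[ℂ] P} {D : M →ₗ[ℂ] M}

/-- The point of evaluation is `z₀ = x`, `z₁ = x + y`, so that `z₀ - z₁ = -y` is the argument of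
`Y₄` inside the skew. -/
theorem iterate_skew (S : IsVertexSystem gr Y₁ Y₂ Y₄ DA DP D) {m' : Module.Dual ℂ M}
    (hm' : m' ∈ gradedDual gr) (a : A) (b : B) (p : P) {x y : ℂ} (hxy : 2 * ‖y‖ < ‖x‖)
    (hy : 0 < ‖y‖) :
    HasSum (fun e : ℤ × ℤ => m' (Y₁ (VertexMap.skew DA Y₄ S.truncated₄ b a e.2) p e.1) *
        (x ^ e.1 * y ^ e.2))
      (∑' k, iterateTerm Y₁ Y₄ m' a b p ![x, x + y] k) := by
  simp only [dual_vertexMap_skew_left S.truncated₄ S.D_derivative]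
  obtain ⟨N, hN⟩ := S.truncated₄ a b
  have := hasSum_shiftCoeff (a := fun k => (-1) ^ k.2 * m' (Y₁ (Y₄ a b k.2) p k.1)) (N := N)
    (fun l hl n => by simp [hN l hl]) hxy hy fun u hu => by
      obtain ⟨f, -, hf⟩ := S.iterates_rational a b p m' hm'
      have h1 := (Equiv.prodComm ℤ ℤ).summable_iff.mpr
        (hf ![u - y, u] (by simpa using hu) (by simpa using hy)).summable
      refine h1.congr fun k => ?_
      simp only [iterateTerm, Function.comp_apply, Equiv.prodComm_apply, Prod.fst_swap,
        Prod.snd_swap, Matrix.cons_val_zero, Matrix.cons_val_one]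
      rw [show u - y - u = (-1) * y by ring, mul_zpow]
      ring
  convert this using 1
  rw [← (Equiv.prodComm ℤ ℤ).tsum_eq]
  refine tsum_congr fun k => ?_
  simp only [iterateTerm, Equiv.prodComm_apply, Prod.fst_swap,
    Prod.snd_swap, Matrix.cons_val_zero, Matrix.cons_val_one]
  rw [show x - (x + y) = (-1) * y by ring, mul_zpow]
  ring

/-- The condition `2‖y‖ < ‖x‖` forces `‖y‖ < ‖x + y‖`, so associativity applies at `(x, x + y)`.
This is the one move that extracts `b` from the inner operator. -/
theorem product_eq_iterate_skew (S : IsVertexSystem gr Y₁ Y₂ Y₄ DA DP D) {m' : Module.Dual ℂ M}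
    (hm' : m' ∈ gradedDual gr) (a : A) (b : B) (p : P) {x y : ℂ} (hxy : 2 * ‖y‖ < ‖x‖)
    (hy : 0 < ‖y‖) (hlt : ‖x + y‖ < ‖x‖) :
    ∃ v, HasSum (fun k : ℤ × ℤ => m' (Y₁ a (Y₂ b p k.2) k.1) * (x ^ k.1 * (x + y) ^ k.2)) v ∧
      HasSum (fun k : ℤ × ℤ => m' (Y₁ (VertexMap.skew DA Y₄ S.truncated₄ b a k.2) p k.1) *
        (x ^ k.1 * y ^ k.2)) v := by
  have hle : ‖x‖ - ‖y‖ ≤ ‖x + y‖ := by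
    have := norm_sub_norm_le x (-y)
    rwa [norm_neg, sub_neg_eq_add] at this
  obtain ⟨v, hv1, hv2⟩ := S.associativity a b p m' hm' ![x, x + y] (by simpa using hlt)
    (by simpa using (by linarith : ‖y‖ < ‖x + y‖)) (by simpa using hy)
  refine ⟨v, hv1.congr_fun fun k => by simp [productTerm], ?_⟩
  rw [← hv2.tsum_eq]
  exact S.iterate_skew hm' a b p hxy hy

theorem nested_base (S : IsVertexSystem gr Y₁ Y₂ Y₄ DA DP D) {m' : Module.Dual ℂ M}
    (hm' : m' ∈ gradedDual gr) (a : A) (p : P) {k : ℕ} (b : Fin 0 → B) (c : Fin k → B) :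
    ∃ f : (Option (Fin 0 ⊕ Fin k) → ℂ) → ℂ, IsDiagonalRational f ∧ ∀ z ∈ nestedRegion 0 k,
      HasSum (fun q => m' (Y₁ (productCoeff (VertexMap.skew DA Y₄ S.truncated₄) b q.2.1 a)
        (productCoeff Y₂ c q.2.2 p) q.1) * nestedMonomial z q) (f (nestedPoint z)) := by
  obtain ⟨f, hf, hsum⟩ := S.products_rational k a c p m' hm'
  let e : Fin (k + 1) → Option (Fin 0 ⊕ Fin k) := Fin.cases none fun j => some (Sum.inr j)
  have he : Function.Injective e := by
    intro i j
    refine Fin.cases ?_ (fun i => ?_) i <;> refine Fin.cases ?_ (fun j => ?_) j <;> simp [e]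
  refine ⟨fun ζ => f (ζ ∘ e), (isDiagonalRational_iff.mpr hf).reindex he, fun z hz => ?_⟩
  have hz' : nestedPoint z ∘ e = (Fin.cons z.1 z.2.2 : Fin (k + 1) → ℂ) := by
    funext i
    refine Fin.cases ?_ (fun i => ?_) i <;> simp [e, nestedPoint]
  have hcons : (fun i => ‖(Fin.cons z.1 z.2.2 : Fin (k + 1) → ℂ) i‖) =
      (Fin.cons ‖z.1‖ fun i => ‖z.2.2 i‖ : Fin (k + 1) → ℝ) := by
    funext i
    refine Fin.cases ?_ (fun i => ?_) i <;> simp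
  have h1 := hsum (Fin.cons z.1 z.2.2)
    (hcons ▸ strictAnti_cons hz.2.2.1 hz.2.2.2.2.1)
    (Fin.cases (by simpa using hz.1.1) fun i => by simpa using hz.1.2.2 i)
  -- Without inner operators the nested series is an ordinary product series in `x, t_0, …,
  -- t_{k-1}`.
  let E : ℤ × (Fin 0 → ℤ) × (Fin k → ℤ) ≃ (Fin (k + 1) → ℤ) :=
    { toFun := fun q => Fin.cons q.1 q.2.2
      invFun := fun q => (q 0, Fin.elim0, Fin.tail q)
      left_inv := fun q => by
        refine Prod.ext (by simp) (Prod.ext (Subsingleton.elim _ _) (by simp))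
      right_inv := fun q => by simp }
  have h2 := E.hasSum_iff.mpr h1
  simp only [hz']
  refine h2.congr_fun fun q => ?_
  simp [E, productCoeff, nestedMonomial, Fin.prod_univ_succ]

/-- The variable `t_0` becomes `x + y_0`. -/
def nestedReindex (m k : ℕ) : Option (Fin m ⊕ Fin (k + 1)) → Option (Fin (m + 1) ⊕ Fin k)
  | none => none
  | some (Sum.inl i) => some (Sum.inl i.succ)
  | some (Sum.inr j) => Fin.cases (some (Sum.inl 0)) (fun j => some (Sum.inr j)) j

theorem nestedReindex_injective (m k : ℕ) : Function.Injective (nestedReindex m k) := by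
  rintro (_ | i | j) (_ | i' | j')
  · simp
  · simp [nestedReindex]
  · refine Fin.cases ?_ (fun j' => ?_) j' <;> simp [nestedReindex]
  · simp [nestedReindex]
  · simp [nestedReindex]
  · refine Fin.cases ?_ (fun j' => ?_) j' <;> simp [nestedReindex]
  · refine Fin.cases ?_ (fun j => ?_) j <;> simp [nestedReindex]
  · refine Fin.cases ?_ (fun j => ?_) j <;> simp [nestedReindex, eq_comm]
  · refine Fin.cases ?_ (fun j => ?_) j <;> refine Fin.cases ?_ (fun j' => ?_) j' <;>
      simp [nestedReindex]

theorem nestedPoint_reindex {m k : ℕ} (x y : ℂ) (v : Fin m → ℂ) (w : Fin k → ℂ) :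
    nestedPoint (x, (Fin.cons y v : Fin (m + 1) → ℂ), w) ∘ nestedReindex m k =
      nestedPoint (x, v, (Fin.cons (x + y) w : Fin (k + 1) → ℂ)) := by
  funext a
  rcases a with _ | i | j
  · rfl
  · simp [nestedReindex, nestedPoint]
  · refine Fin.cases ?_ (fun j => ?_) j <;> simp [nestedReindex, nestedPoint]

/-- The outermost inner operator `b 0` becomes the first of the `Y₂`'s, at the point `x + y_0`. The
two series are not compared termwise: the expansion `T` of the rational function on the new region
is matched with the desired coefficients through points lying in both regions. -/
theorem nested_step (S : IsVertexSystem gr Y₁ Y₂ Y₄ DA DP D) {m' : Module.Dual ℂ M}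
    (hm' : m' ∈ gradedDual gr) (a : A) (p : P) {m k : ℕ} (b : Fin (m + 1) → B) (c : Fin k → B)
    {f : (Option (Fin m ⊕ Fin (k + 1)) → ℂ) → ℂ} (hf : IsDiagonalRational f)
    (hsum : ∀ z ∈ nestedRegion m (k + 1),
      HasSum (fun q => m' (Y₁ (productCoeff (VertexMap.skew DA Y₄ S.truncated₄) (Fin.tail b)
        q.2.1 a) (productCoeff Y₂ (Fin.cons (b 0) c : Fin (k + 1) → B) q.2.2 p) q.1) *
          nestedMonomial z q) (f (nestedPoint z))) :
    ∀ z ∈ nestedRegion (m + 1) k,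
      HasSum (fun q => m' (Y₁ (productCoeff (VertexMap.skew DA Y₄ S.truncated₄) b q.2.1 a)
        (productCoeff Y₂ c q.2.2 p) q.1) * nestedMonomial z q)
        (f (nestedPoint z ∘ nestedReindex m k)) := by
  obtain ⟨T, hT⟩ := (hf.reindex (nestedReindex_injective m k)).exists_nested_coeff
  intro z hz
  -- The exponents `κ` belong to the spectator variables. For fixed `κ` only two operators are
  -- exchanged, so the two-point associativity suffices.
  have key := laurent_eq_of_fiberwise
    (fun κ q => m' (Y₁ (productCoeff (VertexMap.skew DA Y₄ S.truncated₄) (Fin.tail b)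
      (nestedEquivT m k (κ, q)).2.1 a) (productCoeff Y₂ (Fin.cons (b 0) c : Fin (k + 1) → B)
        (nestedEquivT m k (κ, q)).2.2 p) (nestedEquivT m k (κ, q)).1))
    (fun κ q => m' (Y₁ (productCoeff (VertexMap.skew DA Y₄ S.truncated₄) b
      (nestedEquivY m k (κ, q)).2.1 a) (productCoeff Y₂ c
        (nestedEquivY m k (κ, q)).2.2 p) (nestedEquivY m k (κ, q)).1))
    (fun κ q => T (nestedEquivY m k (κ, q))) ?_ ?_ ?_ ?_
  · refine (hT z hz).congr_fun fun q => ?_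
    have := congrFun (congrFun key ((nestedEquivY m k).symm q).1) ((nestedEquivY m k).symm q).2
    simp only [Prod.mk.eta, Equiv.apply_symm_apply] at this
    rw [this]
  · intro x y hxy hy
    obtain ⟨r, hr, hro⟩ := exists_nested_radii m k hxy hy
    obtain ⟨o, ho⟩ : ∃ o : Fin m ⊕ Fin k → ℂ, ∀ i, ‖o i‖ = r i := ⟨fun i => r i, fun i => by
      rw [Complex.norm_real, Real.norm_of_nonneg (hr i).le]⟩
    refine ⟨o, fun i => norm_pos_iff.mp (ho i ▸ hr i), ?_⟩
    refine ((nestedEquivY m k).summable_iff.mpr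
      (hT _ (hro o ho).1).summable).congr fun q => ?_
    simp only [Function.comp_apply, nestedMonomial_equivY, mul_assoc]
  · intro x y hxy hy hlt
    obtain ⟨r, hr, hro⟩ := exists_nested_radii m k hxy hy
    refine ⟨r, hr, fun o ho => ⟨_, ((nestedEquivY m k).hasSum_iff.mpr
      (hT _ (hro o ho).1)).congr_fun fun q => ?_, ?_⟩⟩
    · simp only [Function.comp_apply, nestedMonomial_equivY, mul_assoc]
    · rw [nestedPoint_reindex]
      refine ((nestedEquivT m k).hasSum_iff.mpr
        (hsum _ ((hro o ho).2 hlt))).congr_fun fun q => ?_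
      simp only [Function.comp_apply, nestedMonomial_equivT, mul_assoc]
  · intro κ x y hxy hy
    refine (S.iterate_skew hm' (productCoeff (VertexMap.skew DA Y₄ S.truncated₄) (Fin.tail b)
      (κ ∘ Sum.inl) a) (b 0) (productCoeff Y₂ c (κ ∘ Sum.inr) p) hxy hy).summable.congr
      fun q => ?_
    simp [nestedEquivY, productCoeff]
  · intro κ x y hxy hy hlt
    obtain ⟨v, hv1, hv2⟩ := S.product_eq_iterate_skew hm'
      (productCoeff (VertexMap.skew DA Y₄ S.truncated₄) (Fin.tail b) (κ ∘ Sum.inl) a) (b 0)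
      (productCoeff Y₂ c (κ ∘ Sum.inr) p) hxy hy hlt
    refine ⟨v, hv1.congr_fun fun q => ?_, hv2.congr_fun fun q => ?_⟩
    · simp [nestedEquivT, productCoeff]
    · simp [nestedEquivY, productCoeff]

/-- The nested correlation functions
`⟨m', Y₁(Y₄ˢ(b_0, y_0) ⋯ Y₄ˢ(b_{m-1}, y_{m-1}) a, x) Y₂(c_0, t_0) ⋯ Y₂(c_{k-1}, t_{k-1}) p⟩`
converge to rational functions of `x`, `x + y_i`, `t_j`. -/
theorem nested_rational (S : IsVertexSystem gr Y₁ Y₂ Y₄ DA DP D) {m' : Module.Dual ℂ M}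
    (hm' : m' ∈ gradedDual gr) (a : A) (p : P) (m : ℕ) {k : ℕ} (b : Fin m → B) (c : Fin k → B) :
    ∃ f : (Option (Fin m ⊕ Fin k) → ℂ) → ℂ, IsDiagonalRational f ∧ ∀ z ∈ nestedRegion m k,
      HasSum (fun q => m' (Y₁ (productCoeff (VertexMap.skew DA Y₄ S.truncated₄) b q.2.1 a)
        (productCoeff Y₂ c q.2.2 p) q.1) * nestedMonomial z q) (f (nestedPoint z)) := by
  induction m generalizing k with
  | zero => exact S.nested_base hm' a p b c
  | succ m ih =>
    obtain ⟨f, hf, hsum⟩ := ih (Fin.tail b) (Fin.cons (b 0) c : Fin (k + 1) → B)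
    exact ⟨_, hf.reindex (nestedReindex_injective m k), S.nested_step hm' a p b c hf hsum⟩

end IsVertexSystem

end VertexSystem

/-! ### Convergence and associativity of the skewed operators -/

section VertexSystem

variable {ι A B P M : Type*}
  [AddCommGroup A] [Module ℂ A] [AddCommGroup B] [Module ℂ B]
  [AddCommGroup P] [Module ℂ P] [AddCommGroup M] [Module ℂ M]

/-- The rational function has its own expansion on all of `|x| > |y| > 0`. Coefficients are unique
on one torus inside `|x| > 2|y|`, so that expansion is the given series. -/
theorem IsDiagonalRational.hasSum_extend {c : ℤ × ℤ → ℂ} {f : (Fin 2 → ℂ) → ℂ}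
    (hf : IsDiagonalRational f) (h : ∀ x y : ℂ, 2 * ‖y‖ < ‖x‖ → 0 < ‖y‖ →
      HasSum (fun k => c k * (x ^ k.1 * y ^ k.2)) (f ![x, y])) {x y : ℂ} (hxy : ‖y‖ < ‖x‖)
    (hy : 0 < ‖y‖) : HasSum (fun k => c k * (x ^ k.1 * y ^ k.2)) (f ![x, y]) := by
  let e : Fin 2 → Option (Fin 0 ⊕ Fin 1) := ![none, some (Sum.inr 0)]
  have he : Function.Injective e := by
    intro i j
    fin_cases i <;> fin_cases j <;> simp [e]
  obtain ⟨T, hT⟩ := (hf.reindex he).exists_nested_coeff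
  let E : ℤ × ℤ ≃ ℤ × (Fin 0 → ℤ) × (Fin 1 → ℤ) :=
    { toFun := fun q => (q.1, Fin.elim0, fun _ => q.2)
      invFun := fun q => (q.1, q.2.2 0)
      left_inv := fun q => rfl
      right_inv := fun q => Prod.ext rfl (Prod.ext (Subsingleton.elim _ _) (by
        funext i; rw [Subsingleton.elim i 0])) }
  have hT' : ∀ x y : ℂ, ‖y‖ < ‖x‖ → 0 < ‖y‖ →
      HasSum (fun k => T (E k) * (x ^ k.1 * y ^ k.2)) (f ![x, y]) := by
    intro x y hxy hy
    have hmem : ((x, Fin.elim0, fun _ => y) : ℂ × (Fin 0 → ℂ) × (Fin 1 → ℂ)) ∈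
        nestedRegion 0 1 := by
      refine ⟨⟨norm_pos_iff.mp (hy.trans hxy), fun i => i.elim0, fun _ => norm_pos_iff.mp hy⟩,
        fun i => i.elim0, fun i j hij => absurd hij (by simp [Subsingleton.elim i j]),
        fun i => i.elim0, fun _ => hxy, fun i => i.elim0⟩
    have hpt : nestedPoint ((x, Fin.elim0, fun _ => y) : ℂ × (Fin 0 → ℂ) × (Fin 1 → ℂ)) ∘ e =
        ![x, y] := by
      funext i
      fin_cases i <;> simp [e, nestedPoint]
    have := E.hasSum_iff.mpr (hT _ hmem)
    rw [hpt] at this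
    refine this.congr_fun fun q => ?_
    simp [E, nestedMonomial]
  have : c = fun k => T (E k) := laurent_two_eq_of_torus _ _ 3 1 (by norm_num) (by norm_num)
    fun x y hx hy => ⟨_, h x y (by rw [hx, hy]; norm_num) (by rw [hy]; norm_num),
      hT' x y (by rw [hx, hy]; norm_num) (by rw [hy]; norm_num)⟩
  rw [this]
  exact hT' x y hxy hy

/-- This is `e^{xD} e^{yD} = e^{(x+y)D}` as seen by a functional, with `h n` standing for the value
involving `D^n`. Vanishing of `h` from `K` on makes the square cutoff harmless. -/
theorem sum_exp_mul_exp {K : ℕ} (h : ℕ → ℂ) (hK : ∀ n, K ≤ n → h n = 0) (x y : ℂ) :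
    ∑ k ∈ Finset.range K, ((k.factorial : ℂ)⁻¹) * (x ^ k *
      ∑ l ∈ Finset.range K, ((l.factorial : ℂ)⁻¹) * (y ^ l * h (k + l))) =
    ∑ n ∈ Finset.range K, ((n.factorial : ℂ)⁻¹) * ((x + y) ^ n * h n) := by
  let g : ℕ × ℕ → ℂ := fun q =>
    ((q.1.factorial : ℂ)⁻¹) * (x ^ q.1 * (((q.2.factorial : ℂ)⁻¹) * (y ^ q.2 * h (q.1 + q.2))))
  have hz : ∀ q : ℕ × ℕ, K ≤ q.1 + q.2 → g q = 0 := fun q hq => by simp [g, hK _ hq]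
  have hg : (Function.support g).Finite := by
    refine ((Set.finite_Iio K).prod (Set.finite_Iio K)).subset fun q hq => ?_
    simp only [Set.mem_prod, Set.mem_Iio]
    by_contra hcon
    exact hq (hz q (by omega))
  have h1 := finsum_sum_antidiagonal hg
  rw [finsum_eq_sum_of_support_subset (s := Finset.range K),
    finsum_eq_sum_of_support_subset (s := Finset.range K)] at h1
  · calc _ = ∑ k ∈ Finset.range K, ∑ᶠ l, g (k, l) := by
          refine Finset.sum_congr rfl fun k _ => ?_
          rw [finsum_eq_sum_of_support_subset (s := Finset.range K), Finset.mul_sum,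
            Finset.mul_sum]
          intro l hl
          by_contra hlK
          exact hl (hz _ (le_add_left (by simpa using hlK)))
      _ = _ := by
          rw [← h1]
          refine Finset.sum_congr rfl fun n _ => ?_
          rw [(Commute.all x y).add_pow', Finset.sum_mul, Finset.mul_sum]
          refine Finset.sum_congr rfl fun q hq => ?_
          have hq' : q.1 + q.2 = n := Finset.HasAntidiagonal.mem_antidiagonal.mp hq
          have h2 : (n.choose q.1 : ℂ) * q.1.factorial * q.2.factorial = n.factorial := by
            rw [← hq', Nat.choose_symm_add]
            exact_mod_cast Nat.add_choose_mul_factorial_mul_factorial q.1 q.2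
          have h3 : (q.1.factorial : ℂ) ≠ 0 := by exact_mod_cast q.1.factorial_ne_zero
          have h4 : (q.2.factorial : ℂ) ≠ 0 := by exact_mod_cast q.2.factorial_ne_zero
          have h5 : (n.factorial : ℂ) ≠ 0 := by exact_mod_cast n.factorial_ne_zero
          simp only [g, hq', nsmul_eq_mul]
          field_simp
          rw [← h2]
          ring
  · intro k hk
    by_contra hkK
    apply hk
    have hle : K ≤ k := by simpa using hkK
    simp [hz (k, _) (le_add_right hle)]
  · intro n hn
    by_contra hnK
    apply hn
    have hle : K ≤ n := by simpa using hnK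
    exact Finset.sum_eq_zero fun q hq => hz q (by
      rw [Finset.HasAntidiagonal.mem_antidiagonal.mp hq]; exact hle)

namespace IsVertexSystem

variable {gr : ι → Submodule ℂ M} {Y₁ : VertexMap A P M} {Y₂ : VertexMap B P P}
  {Y₄ : VertexMap A B A} {DA : A →ₗ[ℂ] A} {DP : P →ₗ[ℂ] P} {D : M →ₗ[ℂ] M}

theorem comp_pow_eq_zero {m' : Module.Dual ℂ M} {K : ℕ} (hK : m' ∘ₗ D ^ K = 0) {k : ℕ}
    (hk : K ≤ k) : m' ∘ₗ D ^ k = 0 := by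
  rw [← Nat.add_sub_cancel' hk, pow_add]
  refine LinearMap.ext fun v => ?_
  exact LinearMap.congr_fun hK _

theorem comp_pow_comp_pow (m' : Module.Dual ℂ M) (k l : ℕ) :
    (m' ∘ₗ D ^ k) ∘ₗ D ^ l = m' ∘ₗ D ^ (k + l) := by
  rw [pow_add]; rfl

theorem skew_products_rational (S : IsVertexSystem gr Y₁ Y₂ Y₄ DA DP D) :
    ProductsRational gr (VertexMap.skew D Y₁ S.truncated₁)
      (VertexMap.skew DA Y₄ S.truncated₄) := by
  intro n p b a m' hm'
  obtain ⟨K, hK⟩ := S.dual_nilpotent m' hm'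
  choose f hf hsum using fun k => S.nested_rational (S.dual_pow m' hm' k) a p n (k := 0) b Fin.elim0
  -- The skewed product is the nested function at `x = -z_0`, `y_i = z_{i+1}`, whose points are
  -- `-z_0` and `z_{i+1} - z_0`. Their differences are again variables or differences of variables,
  -- up to sign.
  let L : Option (Fin n ⊕ Fin 0) → MvPolynomial (Fin (n + 1)) ℂ
    | none => -MvPolynomial.X 0
    | some (Sum.inl i) => MvPolynomial.X i.succ - MvPolynomial.X 0
    | some (Sum.inr j) => j.elim0
  have hL : ∀ z : Fin (n + 1) → ℂ, (fun o => MvPolynomial.eval z (L o)) =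
      nestedPoint (-z 0, Fin.tail z, Fin.elim0) := by
    intro z
    funext o
    rcases o with _ | i | j
    · simp [L, nestedPoint]
    · simp [L, nestedPoint, Fin.tail]; ring
    · exact j.elim0
  refine ⟨fun z => ∑ k ∈ Finset.range K, ((k.factorial : ℂ)⁻¹) *
    (z 0 ^ k * f k (nestedPoint (-z 0, Fin.tail z, Fin.elim0))), ?_, fun z hz hz0 => ?_⟩
  · refine isDiagonalRational_iff.mp (IsDiagonalRational.sum _ fun k _ => ?_)
    have h1 := (hf k).comp (L := L) ?_ ?_
    · simp only [hL] at h1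
      have h2 := ((IsDiagonalRational.eval (MvPolynomial.C ((k.factorial : ℂ)⁻¹))).mul
        ((IsDiagonalRational.eval (MvPolynomial.X (0 : Fin (n + 1)) ^ k)).mul h1))
      simpa using h2
    · rintro (_ | i | j)
      · exact neg_mem_diagonalDenominators (X_mem_diagonalDenominators _)
      · exact X_sub_X_mem_diagonalDenominators (Fin.succ_ne_zero i)
      · exact j.elim0
    · rintro (_ | i | j) (_ | i' | j') hab
      · exact absurd rfl hab
      · exact neg_X_sub_sub_mem_diagonalDenominators 0 i'.succ
      · exact j'.elim0
      · simpa [L] using X_mem_diagonalDenominators i.succ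
      · simpa [L] using X_sub_X_mem_diagonalDenominators (a := i.succ) (b := i'.succ)
          fun h => hab (by rw [Fin.succ_injective _ h])
      · exact j'.elim0
      · exact j.elim0
      · exact j.elim0
      · exact j.elim0
  · have hz00 : z 0 ≠ 0 := norm_pos_iff.mp (hz0 0)
    have hmem : (-z 0, Fin.tail z, Fin.elim0) ∈ nestedRegion n 0 := by
      refine ⟨⟨neg_ne_zero.mpr hz00, fun i => norm_pos_iff.mp (hz0 i.succ), fun j => j.elim0⟩,
        fun i j hij => hz (Fin.succ_lt_succ_iff.mpr hij), fun j => j.elim0, fun i => ?_,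
        fun j => j.elim0, fun _ j => j.elim0⟩
      rw [norm_neg]
      exact hz (Fin.succ_pos i)
    let E : ℤ × (Fin n → ℤ) ≃ ℤ × (Fin n → ℤ) × (Fin 0 → ℤ) :=
      { toFun := fun q => (q.1, q.2, Fin.elim0)
        invFun := fun q => (q.1, q.2.1)
        left_inv := fun q => rfl
        right_inv := fun q => Prod.ext rfl (Prod.ext rfl (Subsingleton.elim _ _)) }
    have h1 := hasSum_exp_subNeg K (fun k i (q : Fin n → ℤ) => (m' ∘ₗ D ^ k)
      (Y₁ (productCoeff (VertexMap.skew DA Y₄ S.truncated₄) b q a) p i))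
      (fun q => ∏ i, z (Fin.succ i) ^ q i) hz00 (fun k => f k (nestedPoint (-z 0, Fin.tail z, Fin.elim0)))
      fun k _ => by
        refine (E.hasSum_iff.mpr (hsum k _ hmem)).congr_fun fun q => ?_
        simp [E, nestedMonomial, productCoeff, Fin.tail]
    have h2 := ((Fin.consEquiv fun _ : Fin (n + 1) => ℤ).symm.hasSum_iff).mpr h1
    refine h2.congr_fun fun q => ?_
    rw [dual_apply_skew_of_nilpotent S.truncated₁ hK]
    simp [Fin.consEquiv, Fin.prod_univ_succ, Fin.tail]

/-- The two-point correlation functions of products, and their expansion for nested operators. -/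
theorem two_point_rational (S : IsVertexSystem gr Y₁ Y₂ Y₄ DA DP D) {m' : Module.Dual ℂ M}
    (hm' : m' ∈ gradedDual gr) (a : A) (b : B) (p : P) :
    ∃ f : (Fin 2 → ℂ) → ℂ, IsDiagonalRational f ∧
      (∀ x t : ℂ, ‖t‖ < ‖x‖ → 0 < ‖t‖ → HasSum (fun k : ℤ × ℤ =>
        m' (Y₁ a (Y₂ b p k.2) k.1) * (x ^ k.1 * t ^ k.2)) (f ![x, t])) ∧
      (∀ x y : ℂ, ‖y‖ < ‖x‖ → 0 < ‖y‖ → HasSum (fun k : ℤ × ℤ =>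
        m' (Y₁ (VertexMap.skew DA Y₄ S.truncated₄ b a k.2) p k.1) * (x ^ k.1 * y ^ k.2))
          (f ![x, x + y])) := by
  obtain ⟨f, hf, hsum⟩ := S.nested_base hm' a p (k := 1) Fin.elim0 ![b]
  let e : Option (Fin 0 ⊕ Fin 1) → Fin 2
    | none => 0
    | some _ => 1
  have he : Function.Injective e := by
    rintro (_ | i | j) (_ | i' | j')
    · simp
    · exact i'.elim0
    · simp [e]
    · exact i.elim0
    · exact i.elim0
    · exact i.elim0
    · simp [e]
    · exact i'.elim0
    · simp [Subsingleton.elim j j']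
  have hpt : ∀ x t : ℂ, nestedPoint ((x, Fin.elim0, fun _ => t) :
      ℂ × (Fin 0 → ℂ) × (Fin 1 → ℂ)) = ![x, t] ∘ e := by
    intro x t
    funext o
    rcases o with _ | i | j
    · simp [e, nestedPoint]
    · exact i.elim0
    · simp [e, nestedPoint]
  refine ⟨fun ζ => f (ζ ∘ e), hf.reindex he, fun x t hxt ht => ?_, fun x y hxy hy => ?_⟩
  · have hmem : ((x, Fin.elim0, fun _ => t) : ℂ × (Fin 0 → ℂ) × (Fin 1 → ℂ)) ∈
        nestedRegion 0 1 := by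
      refine ⟨⟨norm_pos_iff.mp (ht.trans hxt), fun i => i.elim0, fun _ => norm_pos_iff.mp ht⟩,
        fun i => i.elim0, fun i j hij => absurd hij (by simp [Subsingleton.elim i j]),
        fun i => i.elim0, fun _ => hxt, fun i => i.elim0⟩
    let E : ℤ × ℤ ≃ ℤ × (Fin 0 → ℤ) × (Fin 1 → ℤ) :=
      { toFun := fun q => (q.1, Fin.elim0, fun _ => q.2)
        invFun := fun q => (q.1, q.2.2 0)
        left_inv := fun q => rfl
        right_inv := fun q => Prod.ext rfl (Prod.ext (Subsingleton.elim _ _) (by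
          funext i; rw [Subsingleton.elim i 0])) }
    have := E.hasSum_iff.mpr (hsum _ hmem)
    rw [hpt] at this
    refine this.congr_fun fun q => ?_
    simp [E, nestedMonomial, productCoeff]
  · have hmem : ((x, fun _ => y, Fin.elim0) : ℂ × (Fin 1 → ℂ) × (Fin 0 → ℂ)) ∈
        nestedRegion 1 0 := by
      refine ⟨⟨norm_pos_iff.mp (hy.trans hxy), fun _ => norm_pos_iff.mp hy, fun i => i.elim0⟩,
        fun i j hij => absurd hij (by simp [Subsingleton.elim i j]), fun i => i.elim0,
        fun _ => hxy, fun i => i.elim0, fun _ i => i.elim0⟩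
    let E : ℤ × ℤ ≃ ℤ × (Fin 1 → ℤ) × (Fin 0 → ℤ) :=
      { toFun := fun q => (q.1, fun _ => q.2, Fin.elim0)
        invFun := fun q => (q.1, q.2.1 0)
        left_inv := fun q => rfl
        right_inv := fun q => Prod.ext rfl (Prod.ext (by
          funext i; rw [Subsingleton.elim i 0]) (Subsingleton.elim _ _)) }
    -- One application of the induction step shows that the same rational function governs the
    -- nested series.
    have h1 := S.nested_step hm' a p (m := 0) (k := 0) ![b] Fin.elim0 hf (fun z hz => by
      refine (hsum z hz).congr_fun fun q => ?_
      congr 5) _ hmem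
    have h2 := E.hasSum_iff.mpr h1
    have h3 : nestedPoint ((x, fun _ => y, Fin.elim0) : ℂ × (Fin 1 → ℂ) × (Fin 0 → ℂ)) ∘
        nestedReindex 0 0 = ![x, x + y] ∘ e := by
      funext o
      rcases o with _ | i | j
      · simp [e, nestedPoint, nestedReindex]
      · exact i.elim0
      · rw [show j = 0 from Subsingleton.elim (α := Fin 1) j 0]
        simp [e, nestedPoint, nestedReindex]
    rw [h3] at h2
    refine h2.congr_fun fun q => ?_
    simp [E, nestedMonomial, productCoeff]

/-- The shift `x ↦ x - y` is justified directly only for `2‖y‖ < ‖x‖`. Rationality of the sum then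
extends it to `‖y‖ < ‖x‖`, as needed for iterates on their full domain. -/
theorem hasSum_product_skew (S : IsVertexSystem gr Y₁ Y₂ Y₄ DA DP D) {m' : Module.Dual ℂ M}
    {K : ℕ} (hK : m' ∘ₗ D ^ K = 0) (a : A) (b : B) (p : P) {f : ℕ → (Fin 2 → ℂ) → ℂ}
    (hf : ∀ k, IsDiagonalRational (f k))
    (hsum : ∀ k, ∀ x t : ℂ, ‖t‖ < ‖x‖ → 0 < ‖t‖ → HasSum (fun q : ℤ × ℤ =>
      (m' ∘ₗ D ^ k) (Y₁ a (Y₂ b p q.2) q.1) * (x ^ q.1 * t ^ q.2)) (f k ![x, t]))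
    {x y : ℂ} (hxy : ‖y‖ < ‖x‖) (hy : 0 < ‖y‖) :
    HasSum (fun q : ℤ × ℤ => m' (Y₁ a (VertexMap.skew DP Y₂ S.truncated₂ p b q.2) q.1) *
      (x ^ q.1 * y ^ q.2))
      (∑ k ∈ Finset.range K, ((k.factorial : ℂ)⁻¹) * (y ^ k * f k ![x - y, -y])) := by
  let F : (Fin 2 → ℂ) → ℂ := fun z =>
    ∑ k ∈ Finset.range K, ((k.factorial : ℂ)⁻¹) * (z 1 ^ k * f k ![z 0 - z 1, -z 1])
  have hF : IsDiagonalRational F := by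
    refine IsDiagonalRational.sum _ fun k _ => ?_
    let L : Fin 2 → MvPolynomial (Fin 2) ℂ :=
      ![MvPolynomial.X 0 - MvPolynomial.X 1, -MvPolynomial.X 1]
    have hL : ∀ z : Fin 2 → ℂ, (fun o => MvPolynomial.eval z (L o)) = ![z 0 - z 1, -z 1] := by
      intro z
      funext i
      fin_cases i <;> simp [L]
    have h1 := (hf k).comp (L := L) ?_ ?_
    · simp only [hL] at h1
      have h2 := ((IsDiagonalRational.eval (MvPolynomial.C ((k.factorial : ℂ)⁻¹))).mul
        ((IsDiagonalRational.eval (MvPolynomial.X (1 : Fin 2) ^ k)).mul h1))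
      simpa using h2
    · intro i
      fin_cases i
      · exact X_sub_X_mem_diagonalDenominators (by simp)
      · exact neg_mem_diagonalDenominators (X_mem_diagonalDenominators _)
    · intro i j hij
      fin_cases i <;> fin_cases j
      · exact absurd rfl hij
      · simpa [L] using X_mem_diagonalDenominators (0 : Fin 2)
      · exact neg_X_sub_sub_mem_diagonalDenominators (1 : Fin 2) 0
      · exact absurd rfl hij
  refine hF.hasSum_extend (fun x y hxy hy => ?_) hxy hy
  obtain ⟨N, hN⟩ := S.truncated₂ b p
  have hy0 : y ≠ 0 := norm_pos_iff.mp hy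
  have h1 := hasSum_exp_subNeg K (fun k j (i : ℤ) =>
    shiftCoeff (fun q => (m' ∘ₗ D ^ k) (Y₁ a (Y₂ b p q.2) q.1)) (i, j)) (fun i => x ^ i) hy0
    (fun k => f k ![x - y, -y]) fun k _ => by
      have h2 := hasSum_shiftCoeff (a := fun q => (m' ∘ₗ D ^ k) (Y₁ a (Y₂ b p q.2) q.1))
        (N := N) (fun l hl n => by simp [hN l hl]) (x := x) (y := -y) (by rwa [norm_neg])
        (by rwa [norm_neg]) fun u hu => (hsum k u (-y) hu (by rwa [norm_neg])).summable
      rw [← sub_eq_add_neg, (hsum k (x - y) (-y) (by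
        rw [norm_neg]; linarith [norm_sub_norm_le x y]) (by rwa [norm_neg])).tsum_eq] at h2
      refine ((Equiv.prodComm ℤ ℤ).hasSum_iff.mpr h2).congr_fun fun q => ?_
      simp only [Function.comp_apply, Equiv.prodComm_apply, Prod.swap]
      ring
  refine ((Equiv.prodComm ℤ ℤ).hasSum_iff.mpr h1).congr_fun fun q => ?_
  rw [dual_vertexMap_skew_right S.truncated₂ S.D_commutator hK]
  simp only [Function.comp_apply, Equiv.prodComm_apply, Prod.fst_swap, Prod.snd_swap]
  ring

/-- Both series come from `e^{z₀D} Y₁(a, -z₀) Y₂(b, z₁ - z₀) p`. A single rational function serving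
both regions yields rationality of iterates and associativity at once. -/
theorem skew_two_point (S : IsVertexSystem gr Y₁ Y₂ Y₄ DA DP D) {m' : Module.Dual ℂ M}
    (hm' : m' ∈ gradedDual gr) (p : P) (b : B) (a : A) :
    ∃ R : (Fin 2 → ℂ) → ℂ, RationalWithDiagonalPoles R ∧
      (∀ z : Fin 2 → ℂ, ‖z 1‖ < ‖z 0‖ → 0 < ‖z 1‖ → HasSum (productTerm
        (VertexMap.skew D Y₁ S.truncated₁) (VertexMap.skew DA Y₄ S.truncated₄) m' p b a z) (R z)) ∧
      (∀ z : Fin 2 → ℂ, ‖z 0 - z 1‖ < ‖z 1‖ → 0 < ‖z 0 - z 1‖ → HasSum (iterateTerm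
        (VertexMap.skew D Y₁ S.truncated₁) (VertexMap.skew DP Y₂ S.truncated₂) m' p b a z)
          (R z)) := by
  obtain ⟨K, hK⟩ := S.dual_nilpotent m' hm'
  obtain ⟨f, hf, hf0, hprod, hnest⟩ : ∃ f : ℕ → (Fin 2 → ℂ) → ℂ,
      (∀ k, IsDiagonalRational (f k)) ∧ (∀ k, K ≤ k → f k = 0) ∧
      (∀ k, ∀ x t : ℂ, ‖t‖ < ‖x‖ → 0 < ‖t‖ → HasSum (fun q : ℤ × ℤ =>
        (m' ∘ₗ D ^ k) (Y₁ a (Y₂ b p q.2) q.1) * (x ^ q.1 * t ^ q.2)) (f k ![x, t])) ∧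
      (∀ k, ∀ x y : ℂ, ‖y‖ < ‖x‖ → 0 < ‖y‖ → HasSum (fun q : ℤ × ℤ =>
        (m' ∘ₗ D ^ k) (Y₁ (VertexMap.skew DA Y₄ S.truncated₄ b a q.2) p q.1) *
          (x ^ q.1 * y ^ q.2)) (f k ![x, x + y])) := by
    choose f hf hprod hnest using fun k => S.two_point_rational (S.dual_pow m' hm' k) a b p
    -- The chosen functions for `k ≥ K` represent zero series but need not vanish at every point.
    -- They are replaced by `0` so that the exponentials can be multiplied pointwise.
    refine ⟨fun k => if K ≤ k then 0 else f k, fun k => ?_, fun k hk => by simp [hk],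
      fun k x t h1 h2 => ?_, fun k x t h1 h2 => ?_⟩
    · by_cases hk : K ≤ k
      · simp only [hk, if_true]
        exact IsDiagonalRational.sum (f := fun _ : ℕ => f k) ∅ (by simp)
      · simpa only [hk, if_false] using hf k
    · by_cases hk : K ≤ k
      · simp [comp_pow_eq_zero hK hk, hk]
      · simpa only [hk, if_false] using hprod k x t h1 h2
    · by_cases hk : K ≤ k
      · simp [comp_pow_eq_zero hK hk, hk]
      · simpa only [hk, if_false] using hnest k x t h1 h2
  refine ⟨fun z => ∑ k ∈ Finset.range K, ((k.factorial : ℂ)⁻¹) *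
    (z 0 ^ k * f k ![-z 0, z 1 - z 0]), ?_, fun z h1 h2 => ?_, fun z h1 h2 => ?_⟩
  · refine isDiagonalRational_iff.mp (IsDiagonalRational.sum _ fun k _ => ?_)
    let L : Fin 2 → MvPolynomial (Fin 2) ℂ :=
      ![-MvPolynomial.X 0, MvPolynomial.X 1 - MvPolynomial.X 0]
    have hL : ∀ z : Fin 2 → ℂ, (fun o => MvPolynomial.eval z (L o)) = ![-z 0, z 1 - z 0] := by
      intro z
      funext i
      fin_cases i <;> simp [L]
    have h1 := (hf k).comp (L := L) ?_ ?_
    · simp only [hL] at h1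
      have h2 := ((IsDiagonalRational.eval (MvPolynomial.C ((k.factorial : ℂ)⁻¹))).mul
        ((IsDiagonalRational.eval (MvPolynomial.X (0 : Fin 2) ^ k)).mul h1))
      simpa using h2
    · intro i
      fin_cases i
      · exact neg_mem_diagonalDenominators (X_mem_diagonalDenominators _)
      · exact X_sub_X_mem_diagonalDenominators (by simp)
    · intro i j hij
      fin_cases i <;> fin_cases j
      · exact absurd rfl hij
      · exact neg_X_sub_sub_mem_diagonalDenominators (0 : Fin 2) 1
      · simpa [L] using X_mem_diagonalDenominators (1 : Fin 2)
      · exact absurd rfl hij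
  · have hz0 : z 0 ≠ 0 := norm_pos_iff.mp (h2.trans h1)
    have h3 := hasSum_exp_subNeg K (fun k i (j : ℤ) =>
      (m' ∘ₗ D ^ k) (Y₁ (VertexMap.skew DA Y₄ S.truncated₄ b a j) p i)) (fun j => z 1 ^ j) hz0
      (fun k => f k ![-z 0, z 1 - z 0]) fun k _ => by
        have := hnest k (-z 0) (z 1) (by rwa [norm_neg]) h2
        rwa [show -z 0 + z 1 = z 1 - z 0 by ring] at this
    refine h3.congr_fun fun q => ?_
    rw [productTerm, dual_apply_skew_of_nilpotent S.truncated₁ hK]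
  · have hz1 : z 1 ≠ 0 := norm_pos_iff.mp (h2.trans h1)
    have h3 := hasSum_exp_subNeg K (fun k i (j : ℤ) =>
      (m' ∘ₗ D ^ k) (Y₁ a (VertexMap.skew DP Y₂ S.truncated₂ p b j) i))
      (fun j => (z 0 - z 1) ^ j) hz1
      (fun k => ∑ l ∈ Finset.range K, ((l.factorial : ℂ)⁻¹) *
        ((z 0 - z 1) ^ l * f (k + l) ![-z 0, z 1 - z 0])) fun k _ => by
        have := S.hasSum_product_skew (m' := m' ∘ₗ D ^ k) (K := K)
          (by rw [comp_pow_comp_pow]; exact comp_pow_eq_zero hK (Nat.le_add_left K k)) a b p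
          (f := fun l => f (k + l)) (fun l => hf _)
          (fun l => by rw [comp_pow_comp_pow]; exact hprod (k + l))
          (x := -z 1) (y := z 0 - z 1) (by rwa [norm_neg]) h2
        rwa [show -z 1 - (z 0 - z 1) = -z 0 by ring, neg_sub] at this
    -- This is `e^{z₁D} e^{(z₀ - z₁)D} = e^{z₀D}`.
    have h4 := sum_exp_mul_exp (K := K) (fun n => f n ![-z 0, z 1 - z 0])
      (fun n hn => by rw [hf0 n hn]; rfl) (z 1) (z 0 - z 1)
    rw [add_sub_cancel] at h4
    rw [h4] at h3
    refine ((Equiv.prodComm ℤ ℤ).hasSum_iff.mpr h3).congr_fun fun q => ?_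
    rw [iterateTerm, dual_apply_skew_of_nilpotent S.truncated₁ hK]
    simp only [Function.comp_apply, Equiv.prodComm_apply, Prod.fst_swap, Prod.snd_swap]
    ring

theorem skew_iterates_rational (S : IsVertexSystem gr Y₁ Y₂ Y₄ DA DP D) :
    IteratesRational gr (VertexMap.skew D Y₁ S.truncated₁)
      (VertexMap.skew DP Y₂ S.truncated₂) := fun p b a _ hm' => by
  obtain ⟨R, hR, -, h⟩ := S.skew_two_point hm' p b a
  exact ⟨R, hR, h⟩

theorem skew_associativity (S : IsVertexSystem gr Y₁ Y₂ Y₄ DA DP D) :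
    VertexAssociativity gr (VertexMap.skew D Y₁ S.truncated₁)
      (VertexMap.skew DA Y₄ S.truncated₄) (VertexMap.skew D Y₁ S.truncated₁)
      (VertexMap.skew DP Y₂ S.truncated₂) := fun p b a _ hm' z h1 h2 h3 => by
  obtain ⟨R, -, hp, hi⟩ := S.skew_two_point hm' p b a
  exact ⟨R z, hp z h1 (h3.trans h2), hi z h2 h3⟩

end IsVertexSystem

end VertexSystem

/-! ## Formal properties of the exponential and of skew-symmetry opposites -/

namespace BiSeries

variable {M : Type*} [AddCommGroup M] [Module ℂ M]

theorem exp_eq_sum (D : M →ₗ[ℂ] M) {f : BiSeries M} {N : ℤ} (hN : ∀ i < N, f i = 0) (i : ℤ)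
    (n : ℕ) (hn : i - N < n) :
    exp D f i = ∑ k ∈ Finset.range n, ((k.factorial : ℂ)⁻¹) • (D ^ k) (f (i - k)) := by
  refine finsum_eq_sum_of_support_subset _ fun k hk => ?_
  by_contra h
  apply hk
  have h' : n ≤ k := by simpa using h
  have : f (i - k) = 0 := hN _ (by omega)
  simp [this]

theorem map_exp (D : M →ₗ[ℂ] M) {f : BiSeries M} (hf : LowerTruncated f) :
    map D (exp D f) = exp D (map D f) := by
  funext i
  refine (AddMonoidHom.map_finsum D.toAddMonoidHom (exp_support_finite D hf i)).trans
    (finsum_congr fun k => ?_)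
  change D (_ • (D ^ k) (f (i - k))) = _ • (D ^ k) (D (f (i - k)))
  rw [map_smul, ← Module.End.mul_apply, ← Module.End.mul_apply, ← pow_succ, ← pow_succ']

theorem LowerTruncated.map {N : Type*} [AddCommGroup N] [Module ℂ N] (T : M →ₗ[ℂ] N)
    {f : BiSeries M} (hf : LowerTruncated f) : LowerTruncated (map T f) := by
  obtain ⟨K, hK⟩ := hf
  exact ⟨K, fun i hi => by simp [BiSeries.map, hK i hi]⟩

theorem LowerTruncated.deriv {f : BiSeries M} (hf : LowerTruncated f) :
    LowerTruncated (deriv f) := by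
  obtain ⟨K, hK⟩ := hf
  exact ⟨K - 1, fun i hi => by simp [BiSeries.deriv, hK (i + 1) (by omega)]⟩

theorem deriv_exp (D : M →ₗ[ℂ] M) {f : BiSeries M} (hf : LowerTruncated f) :
    deriv (exp D f) = map D (exp D f) + exp D (deriv f) := by
  obtain ⟨N, hN⟩ := hf
  funext i
  obtain ⟨n, hn⟩ : ∃ n : ℕ, i - N < n := ⟨(i - N).toNat + 1, by omega⟩
  have h1 := exp_eq_sum D hN (i + 1) (n + 1) (by push_cast; omega)
  have h2 := exp_eq_sum D hN i n hn
  have h3 := exp_eq_sum D (f := deriv f) (N := N - 1)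
    (fun j hj => by simp [deriv, hN (j + 1) (by omega)]) i (n + 1) (by push_cast; omega)
  change ((i : ℂ) + 1) • exp D f (i + 1) = D (exp D f i) + exp D (deriv f) i
  rw [h1, h2, h3, map_sum, Finset.smul_sum]
  have h4 : ∀ k ∈ Finset.range (n + 1),
      ((i : ℂ) + 1) • ((k.factorial : ℂ)⁻¹) • (D ^ k) (f (i + 1 - k)) =
      ((k : ℂ) * (k.factorial : ℂ)⁻¹) • (D ^ k) (f (i + 1 - k)) +
        ((k.factorial : ℂ)⁻¹) • (D ^ k) (deriv f (i - k)) := fun k _ => by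
    rw [deriv, show i - (k : ℤ) + 1 = i + 1 - k by ring, map_smul]
    push_cast
    module
  -- The `k = 0` term carries the factor `k = 0`; shifting the index in the rest produces `D e^{xD}
  -- f`. This is why one sum runs to `n + 1` and the other to `n`.
  rw [Finset.sum_congr rfl h4, Finset.sum_add_distrib, Finset.sum_range_succ']
  simp only [Nat.cast_zero, zero_mul, zero_smul, add_zero]
  congr 1
  refine Finset.sum_congr rfl fun k _ => ?_
  have h5 : ((k + 1 : ℕ) : ℂ) * ((k + 1).factorial : ℂ)⁻¹ = (k.factorial : ℂ)⁻¹ := by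
    have h6 : ((k + 1 : ℕ) : ℂ) ≠ 0 := by exact_mod_cast k.succ_ne_zero
    rw [Nat.factorial_succ, Nat.cast_mul, mul_inv, mul_inv_cancel_left₀ h6]
  rw [h5, map_smul, pow_succ', Module.End.mul_apply]
  congr 4
  push_cast
  ring

/-- Since `[d, D] = D`, both `d` and `x d/dx` pick up the same extra term `xD` when moved past
`e^{xD}`, so their difference commutes with it. -/
theorem weight_exp {d D : M →ₗ[ℂ] M} (hdD : ∀ m, d (D m) = D (d m) + D m) {f : BiSeries M}
    (hf : LowerTruncated f) :
    map d (exp D f) - xderiv (exp D f) = exp D (map d f - xderiv f) := by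
  have hk : ∀ (k : ℕ) (m : M), d ((D ^ k) m) = (D ^ k) (d m) + (k : ℂ) • (D ^ k) m := by
    intro k m
    induction k with
    | zero => simp
    | succ k ih =>
      rw [pow_succ', Module.End.mul_apply, Module.End.mul_apply, hdD, ih, map_add, map_smul]
      push_cast
      module
  obtain ⟨N, hN⟩ := hf
  funext i
  obtain ⟨n, hn⟩ : ∃ n : ℕ, i - N < n := ⟨(i - N).toNat + 1, by omega⟩
  have h1 := exp_eq_sum D hN i n hn
  have h2 := exp_eq_sum D (f := map d f - xderiv f) (N := N)
    (fun j hj => by simp [map, xderiv, hN j hj]) i n hn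
  change d (exp D f i) - (i : ℂ) • exp D f i = _
  rw [h1, h2, map_sum, Finset.smul_sum, ← Finset.sum_sub_distrib]
  refine Finset.sum_congr rfl fun k _ => ?_
  rw [map_smul, hk, Pi.sub_apply, map_sub, xderiv, map_smul, map]
  push_cast
  module

/-- This is `e^{xD} e^{-xD} f(x) = f(x)`, the source of the inverse statements. It is checked under
all functionals, one coefficient at a time, so that the scalar identity `sum_exp_mul_exp` applies.
-/
theorem exp_subNeg_exp_subNeg (D : M →ₗ[ℂ] M) {f : BiSeries M} (hf : LowerTruncated f) :
    exp D (subNeg (exp D (subNeg f))) = f := by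
  funext i
  rw [← sub_eq_zero, ← Module.forall_dual_apply_eq_zero_iff ℂ]
  intro φ
  rw [map_sub, sub_eq_zero, apply_exp_subNeg D (hf.subNeg.exp D)]
  obtain ⟨N, hN⟩ := id hf
  set K : ℕ := (i - N).toNat + 1
  -- At a fixed total degree `i` the exponentials are used at the numbers `1` and `-1`. Only the `n
  -- = 0` term of `(1 - 1)^n` survives.
  let h : ℕ → ℂ := fun n => φ ((D ^ n) (f (i - n)))
  have hK : ∀ n, K ≤ n → h n = 0 := fun n hn => by
    have : f (i - n) = 0 := hN _ (by omega)
    simp [h, this]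
  have h1 : ∀ k : ℕ, ((k.factorial : ℂ)⁻¹) * ((-1) ^ (i - k) *
      φ ((D ^ k) (exp D (subNeg f) (i - k)))) = ((k.factorial : ℂ)⁻¹) * (1 ^ k *
      ∑ l ∈ Finset.range K, ((l.factorial : ℂ)⁻¹) * ((-1) ^ l * h (k + l))) := by
    intro k
    have h2 := apply_exp_subNeg D hf (φ ∘ₗ D ^ k) (i - k)
    rw [LinearMap.comp_apply] at h2
    have h3 : ∀ l : ℕ, (φ ∘ₗ D ^ k) ((D ^ l) (f (i - k - l))) = h (k + l) := fun l => by
      simp only [h, LinearMap.comp_apply, pow_add, Module.End.mul_apply]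
      congr 4
      push_cast
      ring
    simp only [h3] at h2
    rw [h2, one_pow, one_mul, finsum_eq_sum_of_support_subset (s := Finset.range K),
      Finset.mul_sum]
    · congr 1
      refine Finset.sum_congr rfl fun l _ => ?_
      have h4 : ((-1 : ℂ) ^ (i - k)) * (-1) ^ (i - k - l) = (-1) ^ l := by
        rw [← zpow_add₀ (by norm_num), show i - k + (i - k - l) = 2 * (i - k - l) + l by ring,
          zpow_add₀ (by norm_num), zpow_mul]
        norm_num
      rw [← h4]
      ring
    · intro l hl
      by_contra hlK
      apply hl
      have hle : K ≤ l := by simpa using hlK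
      simp [hK (k + l) (le_add_left hle)]
  rw [finsum_congr h1, finsum_eq_sum_of_support_subset (s := Finset.range K),
    sum_exp_mul_exp h hK, Finset.sum_eq_single 0]
  · simp [h]
  · intro n _ hn
    simp [hn]
  · intro h0
    exact absurd (Finset.mem_range.mpr (Nat.succ_pos _)) h0
  · intro k hk
    by_contra hkK
    apply hk
    have hle : K ≤ k := by simpa using hkK
    have : ∀ l, h (k + l) = 0 := fun l => hK _ (le_add_right hle)
    simp [this]

theorem subNeg_const (m : M) : subNeg (const m) = const m := by
  funext i
  by_cases hi : i = 0
  · subst hi; simp [subNeg]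
  · simp [subNeg, const, hi]

theorem lowerTruncated_const {M : Type*} [AddCommGroup M] (m : M) : LowerTruncated (const m) :=
  ⟨0, fun i hi => by simp [const, hi.ne]⟩

theorem deriv_subNeg (f : BiSeries M) : deriv (subNeg f) = -subNeg (deriv f) := by
  funext i
  simp only [deriv, subNeg, Pi.neg_apply, zpow_add₀ (by norm_num : (-1 : ℂ) ≠ 0), zpow_one]
  module

theorem xderiv_subNeg (f : BiSeries M) : xderiv (subNeg f) = subNeg (xderiv f) := by
  funext i
  exact smul_comm _ _ _

theorem map_subNeg (T : M →ₗ[ℂ] M) (f : BiSeries M) : map T (subNeg f) = subNeg (map T f) := by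
  funext i
  simp [map, subNeg]

theorem subNeg_sub (f g : BiSeries M) : subNeg (f - g) = subNeg f - subNeg g := by
  funext i
  simp [subNeg, smul_sub]

theorem exp_const_natCast (D : M →ₗ[ℂ] M) (m : M) (n : ℕ) :
    exp D (const m) n = ((n.factorial : ℂ)⁻¹) • (D ^ n) m := by
  rw [exp, finsum_eq_single _ n]
  · simp [const]
  · intro k hk
    have : ((n : ℤ) - k) ≠ 0 := by omega
    simp [const, this]

theorem exp_const_neg (D : M →ₗ[ℂ] M) (m : M) {i : ℤ} (hi : i < 0) : exp D (const m) i = 0 := by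
  rw [exp, finsum_eq_zero_of_forall_eq_zero]
  intro k
  have : i - k ≠ 0 := by omega
  simp [const, this]

/-- A power series with `f' = D f` is `e^{xD} f(0)`. -/
theorem eq_exp_const {D : M →ₗ[ℂ] M} {f : BiSeries M} {m : M} (hneg : ∀ i < 0, f i = 0)
    (h0 : f 0 = m) (hD : deriv f = map D f) : f = exp D (const m) := by
  funext i
  rcases lt_or_ge i 0 with hi | hi
  · rw [hneg i hi, exp_const_neg D m hi]
  · lift i to ℕ using hi
    rw [exp_const_natCast]
    induction i with
    | zero => simpa using h0
    | succ n ih =>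
      have h1 : ((n : ℤ) + 1 : ℂ) • f ((n : ℤ) + 1) = D (f n) := congrFun hD n
      have h2 : ((n : ℂ) + 1) ≠ 0 := by exact_mod_cast n.succ_ne_zero
      have h3 : f ((n : ℤ) + 1) = ((n : ℂ) + 1)⁻¹ • D (f n) := by
        rw [← h1, smul_smul]
        push_cast
        rw [inv_mul_cancel₀ h2, one_smul]
      push_cast
      rw [h3, ih, map_smul, smul_smul, pow_succ', Module.End.mul_apply, Nat.factorial_succ]
      push_cast
      rw [mul_inv]

end BiSeries

section SkewFormal

variable {A B M : Type*} [AddCommGroup A] [Module ℂ A] [AddCommGroup B] [Module ℂ B]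
  [AddCommGroup M] [Module ℂ M] {Y : VertexMap A B M} {D : M →ₗ[ℂ] M}

theorem VertexMap.skew_apply (hY : Y.Truncated) (a : A) (b : B) :
    VertexMap.skew D Y hY b a = BiSeries.exp D (BiSeries.subNeg (Y a b)) := rfl

theorem VertexMap.skew_skew (hY : Y.Truncated) (h : (VertexMap.skew D Y hY).Truncated) :
    VertexMap.skew D (VertexMap.skew D Y hY) h = Y :=
  LinearMap.ext₂ fun a b => BiSeries.exp_subNeg_exp_subNeg D (hY a b)

theorem VertexMap.skew_d_commutator (hY : Y.Truncated) {d : M →ₗ[ℂ] M} {dA : A →ₗ[ℂ] A}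
    {dB : B →ₗ[ℂ] B} (hdD : ∀ m, d (D m) = D (d m) + D m)
    (h : ∀ a b, BiSeries.map d (Y a b) - Y a (dB b) = Y (dA a) b + BiSeries.xderiv (Y a b))
    (b : B) (a : A) :
    BiSeries.map d (VertexMap.skew D Y hY b a) - VertexMap.skew D Y hY b (dA a) =
      VertexMap.skew D Y hY (dB b) a + BiSeries.xderiv (VertexMap.skew D Y hY b a) := by
  have h1 := BiSeries.weight_exp hdD (hY a b).subNeg
  have h2 : BiSeries.map d (Y a b) - BiSeries.xderiv (Y a b) = Y (dA a) b + Y a (dB b) := by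
    rw [sub_eq_iff_eq_add.mp (h a b)]
    abel
  rw [BiSeries.map_subNeg, BiSeries.xderiv_subNeg, ← BiSeries.subNeg_sub, h2, BiSeries.subNeg_add,
    BiSeries.exp_add D (hY _ _).subNeg (hY _ _).subNeg] at h1
  simp only [VertexMap.skew_apply]
  rw [sub_eq_iff_eq_add.mp h1]
  abel

theorem VertexMap.skew_D_derivative (hY : Y.Truncated) {DB : B →ₗ[ℂ] B}
    (h : ∀ a b, BiSeries.deriv (Y a b) = BiSeries.map D (Y a b) - Y a (DB b)) (b : B) (a : A) :
    BiSeries.deriv (VertexMap.skew D Y hY b a) = VertexMap.skew D Y hY (DB b) a := by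
  simp only [VertexMap.skew_apply]
  rw [BiSeries.deriv_exp D (hY a b).subNeg, BiSeries.map_exp D (hY a b).subNeg,
    ← BiSeries.exp_add D ((hY a b).subNeg.map D) (hY a b).subNeg.deriv, BiSeries.deriv_subNeg, h,
    BiSeries.map_subNeg, BiSeries.subNeg_sub]
  congr 1
  abel

theorem VertexMap.skew_D_commutator (hY : Y.Truncated) {DA : A →ₗ[ℂ] A}
    (h : ∀ a b, BiSeries.deriv (Y a b) = Y (DA a) b) (b : B) (a : A) :
    BiSeries.deriv (VertexMap.skew D Y hY b a) =
      BiSeries.map D (VertexMap.skew D Y hY b a) - VertexMap.skew D Y hY b (DA a) := by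
  simp only [VertexMap.skew_apply]
  rw [BiSeries.deriv_exp D (hY a b).subNeg, BiSeries.deriv_subNeg, h,
    ← neg_one_smul ℂ (BiSeries.subNeg _), BiSeries.exp_smul D _ (hY _ _).subNeg, neg_one_smul,
    sub_eq_add_neg]

end SkewFormal

/-! ## Gradings and graded duals -/

section Gradings

variable {ι M : Type*} [AddCommGroup M] [Module ℂ M] {gr : ι → Submodule ℂ M} {D d : M →ₗ[ℂ] M}
  {s : ι → ι}

theorem induction_on_grading [DecidableEq ι] (h : DirectSum.IsInternal gr) {p : M → Prop}
    (h0 : p 0) (hadd : ∀ x y, p x → p y → p (x + y)) (hmem : ∀ i, ∀ m ∈ gr i, p m) (m : M) :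
    p m := by
  have hm : m ∈ ⨆ i, gr i := by rw [h.submodule_iSup_eq_top]; trivial
  induction hm using Submodule.iSup_induction' with
  | zero => exact h0
  | add x y _ _ hx hy => exact hadd x y hx hy
  | mem i x hx => exact hmem i x hx

/-- If `m' ∘ D` is nonzero on piece `i`, then `m'` is nonzero on piece `s i`; injectivity of `s`
leaves finitely many such `i`. -/
theorem gradedDual_comp_pow (hs : Function.Injective s) (hD : ∀ i, ∀ m ∈ gr i, D m ∈ gr (s i))
    {m' : Module.Dual ℂ M} (hm' : m' ∈ gradedDual gr) (k : ℕ) :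
    m' ∘ₗ D ^ k ∈ gradedDual gr := by
  induction k with
  | zero => exact hm'
  | succ k ih =>
    refine Set.Finite.subset (Set.Finite.preimage (f := s) hs.injOn ih) ?_
    rintro i ⟨m, hm, hne⟩
    exact ⟨D m, hD i m hm, by rwa [pow_succ] at hne⟩

/-- The functional sees finitely many weights, all at most some `R`, while nonzero vectors have
weight at least `L`. Any `K > R - L` therefore pushes every vector past the support of `m'`. -/
theorem gradedDual_comp_pow_eq_zero [DecidableEq ι] (h : DirectSum.IsInternal gr)
    (hD : ∀ i, ∀ m ∈ gr i, D m ∈ gr (s i)) (ρ : ι → ℝ) (hρ : ∀ i, ρ (s i) = ρ i + 1)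
    (hL : ∃ L : ℝ, ∀ i, ρ i < L → gr i = ⊥) {m' : Module.Dual ℂ M} (hm' : m' ∈ gradedDual gr) :
    ∃ K, m' ∘ₗ D ^ K = 0 := by
  obtain ⟨L, hL⟩ := hL
  obtain ⟨R, hR⟩ : BddAbove (ρ '' {i | ∃ m ∈ gr i, m' m ≠ 0}) := (hm'.image ρ).bddAbove
  obtain ⟨K, hK⟩ := exists_nat_gt (R - L)
  have hpow : ∀ (k : ℕ) (i : ι) (m : M), m ∈ gr i →
      ∃ j, ρ j = ρ i + k ∧ (D ^ k) m ∈ gr j := by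
    intro k i m hm
    induction k with
    | zero => exact ⟨i, by simp, by simpa using hm⟩
    | succ k ih =>
      obtain ⟨j, hj, hmem⟩ := ih
      refine ⟨s j, by rw [hρ, hj]; push_cast; ring, ?_⟩
      rw [pow_succ', Module.End.mul_apply]
      exact hD j _ hmem
  refine ⟨K, LinearMap.ext fun m => ?_⟩
  refine induction_on_grading h (p := fun m => (m' ∘ₗ D ^ K) m = 0) (by simp)
    (fun x y hx hy => by rw [map_add, hx, hy, add_zero]) (fun i m hm => ?_) m
  obtain ⟨j, hj, hmem⟩ := hpow K i m hm
  by_contra hne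
  have h1 : ρ j ≤ R := hR ⟨j, ⟨_, hmem, hne⟩, rfl⟩
  have h2 : m = 0 := by
    have := hL i (by linarith)
    rw [this] at hm
    simpa using hm
  exact hne (by rw [h2, map_zero])

theorem commutator_of_grading [DecidableEq ι] (h : DirectSum.IsInternal gr) (wt : ι → ℂ)
    (hd : ∀ i, ∀ m ∈ gr i, d m = wt i • m) (hD : ∀ i, ∀ m ∈ gr i, D m ∈ gr (s i))
    (hs : ∀ i, wt (s i) = wt i + 1) (m : M) : d (D m) = D (d m) + D m := by
  refine induction_on_grading h (p := fun m => d (D m) = D (d m) + D m) (by simp)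
    (fun x y hx hy => by simp only [map_add, hx, hy]; abel) (fun i m hm => ?_) m
  rw [hd (s i) _ (hD i m hm), hd i m hm, map_smul, hs]
  module

/-- For distinct weights an eigenvector of `d` has no component outside the corresponding piece. It
is used to show that `D_V` raises weight by one, which is an axiom for modules but not for the
algebra. -/
theorem mem_of_weight [DecidableEq ι] (h : DirectSum.IsInternal gr) {wt : ι → ℂ}
    (hwt : Function.Injective wt) (hd : ∀ i, ∀ m ∈ gr i, d m = wt i • m) {m : M} {n : ι}
    (hm : d m = wt n • m) : m ∈ gr n := by
  classical
  let := h.chooseDecomposition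
  have h1 : ∀ (m : M) (i : ι), (DirectSum.decompose gr (d m) i : M) =
      wt i • (DirectSum.decompose gr m i : M) := by
    intro m i
    refine induction_on_grading h (p := fun m => (DirectSum.decompose gr (d m) i : M) =
      wt i • (DirectSum.decompose gr m i : M)) (by simp) (fun x y hx hy => ?_)
      (fun j m hm => ?_) m
    · simp only [map_add, DirectSum.decompose_add, DirectSum.add_apply, Submodule.coe_add, hx, hy,
        smul_add]
    · rw [hd j m hm, DirectSum.decompose_smul]
      change wt j • (DirectSum.decompose gr m i : M) = _
      by_cases hij : j = i
      · rw [hij]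
      · rw [DirectSum.decompose_of_mem_ne gr hm hij, smul_zero, smul_zero]
  have h2 : ∀ i, i ≠ n → (DirectSum.decompose gr m i : M) = 0 := by
    intro i hi
    have h3 := h1 m i
    rw [hm, DirectSum.decompose_smul] at h3
    change wt n • (DirectSum.decompose gr m i : M) = _ at h3
    by_contra hne
    exact hi (hwt (smul_left_injective ℂ hne h3)).symm
  rw [← DirectSum.sum_support_decompose gr m]
  refine Submodule.sum_mem _ fun i _ => ?_
  by_cases hi : i = n
  · rw [← hi]; exact SetLike.coe_mem _
  · rw [h2 i hi]; exact Submodule.zero_mem _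

end Gradings

/-! ## Opposites of algebras and modules -/

section Opposite

variable {V W : Type*} [AddCommGroup V] [Module ℂ V] [AddCommGroup W] [Module ℂ W]
  {A : VertexData V}

namespace IsMOSVA

theorem d_vac (hA : IsMOSVA A) : A.d A.vac = 0 := by
  -- The constant term of the commutator formula at `(1, 1)` reads `d1 - d1 = d1`.
  have h := congrFun (hA.d_commutator A.vac A.vac) 0
  simp only [hA.identity, Pi.sub_apply, Pi.add_apply, BiSeries.map, BiSeries.xderiv,
    BiSeries.const, Pi.single_eq_same, (hA.creation (A.d A.vac)).2, sub_self, Int.cast_zero,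
    zero_smul, zero_add] at h
  exact h.symm

theorem D_vac (hA : IsMOSVA A) : A.D A.vac = 0 := by
  change A.Y A.vac A.vac 1 = 0
  rw [hA.identity]
  simp [BiSeries.const]

theorem D_mem (hA : IsMOSVA A) (n : ℤ) (v : V) (hv : v ∈ A.gr n) : A.D v ∈ A.gr (n + 1) := by
  refine mem_of_weight A.internal (wt := fun n : ℤ => (n : ℂ)) Int.cast_injective A.d_of_mem ?_
  have h := congrFun (hA.d_commutator v A.vac) 1
  simp only [hA.d_vac, map_zero, sub_zero, A.d_of_mem n v hv, map_smul, Pi.add_apply,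
    LinearMap.smul_apply, Pi.smul_apply, BiSeries.map, BiSeries.xderiv] at h
  change A.d (A.Y v A.vac 1) = _ • A.Y v A.vac 1
  rw [h]
  push_cast
  module

theorem d_D (hA : IsMOSVA A) (v : V) : A.d (A.D v) = A.D (A.d v) + A.D v :=
  commutator_of_grading A.internal (fun n : ℤ => (n : ℂ)) A.d_of_mem hA.D_mem
    (fun n => by push_cast; ring) v

/-- By the identity property `Yˢ(v, x) 1 = e^{xD} v`, and its coefficient of `x` is `D v`. -/
theorem op_D (hA : IsMOSVA A) : hA.op.D = A.D := by
  refine LinearMap.ext fun v => ?_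
  change BiSeries.exp A.D (BiSeries.subNeg (A.Y A.vac v)) 1 = A.D v
  rw [hA.identity, BiSeries.subNeg_const]
  simpa using BiSeries.exp_const_natCast A.D v 1

theorem skew_op (hA : IsMOSVA A) (h : hA.op.Y.Truncated) :
    VertexMap.skew hA.op.D hA.op.Y h = A.Y := by
  have : ∀ (E : V →ₗ[ℂ] V), E = A.D → VertexMap.skew E hA.op.Y h = A.Y := by
    rintro E rfl
    exact VertexMap.skew_skew hA.truncated h
  exact this _ hA.op_D

theorem vertexSystem (hA : IsMOSVA A) : IsVertexSystem A.gr A.Y A.Y A.Y A.D A.D A.D where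
  truncated₁ := hA.truncated
  truncated₂ := hA.truncated
  truncated₄ := hA.truncated
  D_derivative := hA.D_derivative
  D_commutator := hA.D_commutator
  dual_pow _ hm' k := gradedDual_comp_pow (add_left_injective 1) hA.D_mem hm' k
  dual_nilpotent _ hm' := by
    obtain ⟨N, hN⟩ := hA.lowerBound
    exact gradedDual_comp_pow_eq_zero A.internal hA.D_mem (fun n : ℤ => (n : ℝ))
      (fun n => by push_cast; ring) ⟨N, fun i hi => hN i (by exact_mod_cast hi)⟩ hm'
  products_rational := hA.products_rational
  iterates_rational := hA.iterates_rational
  associativity := hA.associativity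

/-- `Y(v, x) 1` solves `f' = D f` because `D 1 = 0`. Skewing turns this into the identity property
of the opposite. -/
theorem creation_eq_exp (hA : IsMOSVA A) (v : V) :
    A.Y v A.vac = BiSeries.exp A.D (BiSeries.const v) :=
  BiSeries.eq_exp_const (hA.creation v).1 (hA.creation v).2 (by
    rw [hA.D_commutator, hA.D_vac, map_zero, sub_zero])

theorem isMOSVA_op (hA : IsMOSVA A) : IsMOSVA hA.op where
  lowerBound := hA.lowerBound
  d_commutator u v := by
    rw [add_comm]
    exact VertexMap.skew_d_commutator hA.truncated hA.d_D
      (fun a b => (hA.d_commutator a b).trans (add_comm _ _)) u v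
  identity v := by
    change BiSeries.exp A.D (BiSeries.subNeg (A.Y v A.vac)) = _
    have h := BiSeries.exp_subNeg_exp_subNeg A.D (BiSeries.lowerTruncated_const v)
    rwa [BiSeries.subNeg_const, ← hA.creation_eq_exp] at h
  creation u := by
    change (∀ i < 0, BiSeries.exp A.D (BiSeries.subNeg (A.Y A.vac u)) i = 0) ∧
      BiSeries.exp A.D (BiSeries.subNeg (A.Y A.vac u)) 0 = u
    rw [hA.identity, BiSeries.subNeg_const]
    exact ⟨fun i hi => BiSeries.exp_const_neg _ _ hi,
      by simpa using BiSeries.exp_const_natCast A.D u 0⟩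
  D_derivative u v := by
    rw [hA.op_D]
    exact VertexMap.skew_D_derivative hA.truncated hA.D_commutator u v
  D_commutator u v := by
    rw [hA.op_D]
    exact VertexMap.skew_D_commutator hA.truncated hA.D_derivative u v
  products_rational := hA.vertexSystem.skew_products_rational
  iterates_rational := hA.vertexSystem.skew_iterates_rational
  associativity := hA.vertexSystem.skew_associativity

end IsMOSVA

/-! ### Opposites of modules -/

variable {gr : ℂ → Submodule ℂ W} {d D : W →ₗ[ℂ] W}

theorem commutator_of_weights (internal : DirectSum.IsInternal gr)
    (hD : ∀ m, ∀ w ∈ gr m, D w ∈ gr (m + 1)) (hd : ∀ m, ∀ w ∈ gr m, d w = m • w) (w : W) :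
    d (D w) = D (d w) + D w := by
  classical
  exact commutator_of_grading internal id hd hD (fun _ => rfl) w

theorem gradedDual_comp_pow_eq_zero_of_re (internal : DirectSum.IsInternal gr)
    (hD : ∀ m, ∀ w ∈ gr m, D w ∈ gr (m + 1)) (hL : ∃ L : ℝ, ∀ m : ℂ, m.re < L → gr m = ⊥)
    {w' : Module.Dual ℂ W} (hw' : w' ∈ gradedDual gr) : ∃ K, w' ∘ₗ D ^ K = 0 := by
  classical
  exact gradedDual_comp_pow_eq_zero internal hD Complex.re (fun m => by simp) hL hw'

theorem IsLeftModule.vertexSystem (hA : IsMOSVA A) {Y : VertexMap V W W}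
    (hY : IsLeftModule A gr Y d D) : IsVertexSystem gr Y Y A.Y A.D D D where
  truncated₁ := hY.truncated
  truncated₂ := hY.truncated
  truncated₄ := hA.truncated
  D_derivative := hY.D_derivative
  D_commutator := hY.D_commutator
  dual_pow _ hm' k := gradedDual_comp_pow (add_left_injective 1) hY.D_weight hm' k
  dual_nilpotent _ hm' :=
    gradedDual_comp_pow_eq_zero_of_re hY.internal hY.D_weight hY.lowerBound hm'
  products_rational := hY.products_rational
  iterates_rational := hY.iterates_rational
  associativity := hY.associativity

/-- The roles are exchanged relative to a left module: here `A` and `M` are `W`, while `B` and `P`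
are `V`. Skewing therefore passes between the two patterns. -/
theorem IsRightModule.vertexSystem (hA : IsMOSVA A) {Y : VertexMap W V W}
    (hY : IsRightModule A gr Y d D) : IsVertexSystem gr Y A.Y Y D A.D D where
  truncated₁ := hY.truncated
  truncated₂ := hA.truncated
  truncated₄ := hY.truncated
  D_derivative := hY.D_derivative
  D_commutator := hY.D_commutator
  dual_pow _ hm' k := gradedDual_comp_pow (add_left_injective 1) hY.D_weight hm' k
  dual_nilpotent _ hm' :=
    gradedDual_comp_pow_eq_zero_of_re hY.internal hY.D_weight hY.lowerBound hm'
  products_rational := hY.products_rational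
  iterates_rational := hY.iterates_rational
  associativity := hY.associativity

theorem IsLeftModule.isRightModule_skew (hA : IsMOSVA A) {Y : VertexMap V W W}
    (hY : IsLeftModule A gr Y d D) : IsRightModule hA.op gr hY.skew d D where
  internal := hY.internal
  D_weight := hY.D_weight
  lowerBound := hY.lowerBound
  d_grading := hY.d_grading
  d_commutator := VertexMap.skew_d_commutator hY.truncated
    (commutator_of_weights hY.internal hY.D_weight hY.d_grading) hY.d_commutator
  creation w := by
    change (∀ i < 0, BiSeries.exp D (BiSeries.subNeg (Y A.vac w)) i = 0) ∧
      BiSeries.exp D (BiSeries.subNeg (Y A.vac w)) 0 = w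
    rw [hY.identity, BiSeries.subNeg_const]
    exact ⟨fun i hi => BiSeries.exp_const_neg _ _ hi,
      by simpa using BiSeries.exp_const_natCast D w 0⟩
  D_derivative := VertexMap.skew_D_derivative hY.truncated hY.D_commutator
  D_commutator := by
    rw [hA.op_D]
    exact VertexMap.skew_D_commutator hY.truncated hY.D_derivative
  products_rational := (hY.vertexSystem hA).skew_products_rational
  iterates_rational := (hY.vertexSystem hA).skew_iterates_rational
  associativity := (hY.vertexSystem hA).skew_associativity

theorem IsRightModule.isLeftModule_skew (hA : IsMOSVA A) {Y : VertexMap W V W}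
    (hY : IsRightModule hA.op gr Y d D) : IsLeftModule A gr hY.skew d D where
  internal := hY.internal
  D_weight := hY.D_weight
  lowerBound := hY.lowerBound
  d_grading := hY.d_grading
  d_commutator := VertexMap.skew_d_commutator hY.truncated
    (commutator_of_weights hY.internal hY.D_weight hY.d_grading) hY.d_commutator
  identity w := by
    change BiSeries.exp D (BiSeries.subNeg (Y w A.vac)) = _
    have h1 : Y w A.vac = BiSeries.exp D (BiSeries.const w) :=
      BiSeries.eq_exp_const (hY.creation w).1 (hY.creation w).2 (by
        rw [hY.D_commutator, hA.op_D, hA.D_vac, map_zero, sub_zero])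
    have h2 := BiSeries.exp_subNeg_exp_subNeg D (BiSeries.lowerTruncated_const w)
    rwa [BiSeries.subNeg_const, ← h1] at h2
  D_derivative u w := by
    refine VertexMap.skew_D_derivative hY.truncated (fun w u => ?_) u w
    rw [hY.D_commutator, hA.op_D]
  D_commutator := VertexMap.skew_D_commutator hY.truncated hY.D_derivative
  products_rational := (hY.vertexSystem hA.isMOSVA_op).skew_products_rational
  -- The inner operator is the skew of the vertex map of `V^op`, which `skew_op` identifies with
  -- that of `V`.
  iterates_rational := by
    have h := (hY.vertexSystem hA.isMOSVA_op).skew_iterates_rational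
    rwa [hA.skew_op] at h
  associativity := by
    have h := (hY.vertexSystem hA.isMOSVA_op).skew_associativity
    rwa [hA.skew_op] at h

end Opposite

theorem mainTheorem6 {V W : Type*} [AddCommGroup V] [Module ℂ V] [AddCommGroup W] [Module ℂ W]
    (A : VertexData V) (hA : IsMOSVA A)
    (gr : ℂ → Submodule ℂ W) (d D : W →ₗ[ℂ] W) :
    -- the opposite is a MOSVA, so that it makes sense to speak of right modules for it
    IsMOSVA hA.op ∧
    -- a left module for `V` gives a right module for `V^op`, and doing both constructions
    -- returns the original vertex operator map
    (∀ (Y : VertexMap V W W) (hY : IsLeftModule A gr Y d D),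
      ∃ hR : IsRightModule hA.op gr hY.skew d D, hR.skew = Y) ∧
    -- and conversely
    (∀ (Y : VertexMap W V W) (hY : IsRightModule hA.op gr Y d D),
      ∃ hL : IsLeftModule A gr hY.skew d D, hL.skew = Y) :=
  ⟨hA.isMOSVA_op,
    fun _ hY => ⟨hY.isRightModule_skew hA, VertexMap.skew_skew hY.truncated _⟩,
    fun _ hY => ⟨hY.isLeftModule_skew hA, VertexMap.skew_skew hY.truncated _⟩⟩
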